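/- Let $\Bbbk$ be an algebraically closed field of characteristic zero. Let $\mathrm{Bl}_3\mathbb{P}^2$ be the blow-up of $\mathbb{P}^2$ at $[1:0:0],[0:1:0],[0:0:1]$, and for $i=1,2,3$ let $\pi_i\colon \mathrm{Bl}_3\mathbb{P}^2\to\mathbb{P}^1$ be the pencil induced by the lines through the $i$-th of these points. For each $i$ let $\ell_i\neq\ell_i'$ be two distinct irreducible members of the $i$-th pencil, and assume that no three of the six curves $\ell_1,\ell_1',\ell_2,\ell_2',\ell_3,\ell_3'$ have a common point. Let $([X_0:X_1],[Y_0:Y_1],[Z_0:Z_1])$ be coordinates on $(\mathbb{P}^1)^3$ and let $\Delta=V(X_0X_1Y_0Y_1Z_0Z_1)$ be its toric boundary. Then there exists $$B=V\Big(\sum_{i,j,k\in\{0,1\}}c_{ijk}X_iY_jZ_k\Big)\subset(\mathbb{P}^1)^3$$ with all coefficients $c_{ijk}$ nonzero such that the pair $\left(\mathrm{Bl}_3\mathbb{P}^2,\sum_{i=1}^3(\ell_i+\ell_i')\right)$ is isomorphic over $\Bbbk$ to $(B,\Delta|_B)$. Moreover, such a $B\subset(\mathbb{P}^1)^3$ is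 unique up to the action of $\mathbb{G}_m^3\rtimes\mathrm{Sym}(Q)$ on $(\mathbb{P}^1)^3$: if $B$ and $B'$ are two closed subschemes of this form, then $B'=g(B)$ for some $g\in\mathbb{G}_m^3\rtimes\mathrm{Sym}(Q)$. Here $\mathbb{G}_m^3$ is the torus acting by $([X_0:X_1],[Y_0:Y_1],[Z_0:Z_1])\mapsto([X_0:t_1X_1],[Y_0:t_2Y_1],[Z_0:t_3Z_1])$, and $\mathrm{Sym}(Q)\cong\mathbb{Z}/2\wr S_3$, the symmetry group of the unit cube $Q$, acts by permuting the three factors and exchanging the two homogeneous coordinates of any of the factors. -/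

import Mathlib

open CategoryTheory CategoryTheory.Limits AlgebraicGeometry TopologicalSpace

universe u

noncomputable section

namespace ThreePairs

/-! ### Projective space over a field -/

/-- The standard grading of `k[x₀, …, xₙ]`. -/
abbrev grading (k : Type u) [Field k] (n : ℕ) :
    ℕ → Submodule k (MvPolynomial (Fin (n + 1)) k) :=
  MvPolynomial.homogeneousSubmodule (Fin (n + 1)) k

instance (k : Type u) [Field k] (n : ℕ) : GradedAlgebra (grading k n) :=
  MvPolynomial.gradedAlgebra

/-- Projective space `ℙⁿ = Proj k[x₀, …, xₙ]`. -/
abbrev PSpace (k : Type u) [Field k] (n : ℕ) : Scheme.{u} := Proj (grading k n)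

/-- The structure morphism `ℙⁿ ⟶ Spec k`. -/
def PSpace.toSpec (k : Type u) [Field k] (n : ℕ) : PSpace k n ⟶ Spec (.of k) :=
  Proj.toSpecZero (grading k n) ≫
    Spec.map (CommRingCat.ofHom (algebraMap k (grading k n 0)))

/-- The standard open set `{x_b ≠ 0}` of `ℙⁿ`. -/
def PSpace.std (k : Type u) [Field k] (n : ℕ) (b : Fin (n + 1)) : (PSpace k n).Opens :=
  Proj.basicOpen (grading k n) (MvPolynomial.X b)

/-- The function `x_a / x_b` on the open set `{x_b ≠ 0}` of `ℙⁿ`. -/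
def PSpace.frac (k : Type u) [Field k] (n : ℕ) (a b : Fin (n + 1)) :
    Γ(PSpace k n, PSpace.std k n b) :=
  (Proj.awayToSection (grading k n) (MvPolynomial.X b)).hom
    (HomogeneousLocalization.Away.mk (grading k n)
      (f := MvPolynomial.X b) (d := 1) (MvPolynomial.isHomogeneous_X k b) 1
      (MvPolynomial.X a) (by simpa using MvPolynomial.isHomogeneous_X k a))

/-- The closed subset of `ℙⁿ` where the coordinates `x_a`, `a ∈ s`, vanish. -/
def PSpace.coordLocus (k : Type u) [Field k] (n : ℕ) (s : Set (Fin (n + 1))) :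
    Closeds (PSpace k n) :=
  ⟨ProjectiveSpectrum.zeroLocus (grading k n) (MvPolynomial.X '' s),
    ProjectiveSpectrum.isClosed_zeroLocus (grading k n) _⟩

/-- The function `x_a / x_b` pulled back along `f : W ⟶ ℙⁿ` to an open set `U` of `W` that is
contained in the preimage of `{x_b ≠ 0}`. -/
def pullFrac {k : Type u} [Field k] {n : ℕ} {W : Scheme.{u}} (f : W ⟶ PSpace k n)
    (a b : Fin (n + 1)) (U : W.Opens) (hU : U ≤ f ⁻¹ᵁ PSpace.std k n b) : Γ(W, U) :=
  (W.presheaf.map (homOfLE hU).op).hom ((f.app (PSpace.std k n b)).hom (PSpace.frac k n a b))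

/-! ### The blow-up of the plane at the three coordinate points -/

/-- An ideal sheaf is invertible if it is locally generated by one nonzerodivisor, i.e. if it
is the ideal sheaf of an effective Cartier divisor. -/
def IsInvertibleIdeal {X : Scheme.{u}} (I : X.IdealSheafData) : Prop :=
  ∀ x : X, ∃ U : X.affineOpens, x ∈ U.1 ∧
    ∃ f ∈ nonZeroDivisors Γ(X, U.1), I.ideal U = Ideal.span {f}

/-- `β : X ⟶ Y` is the blow-up of `Y` along the closed subscheme with ideal sheaf `I`: the
inverse image ideal sheaf of `I` on `X` is invertible, and every morphism to `Y` with this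
property factors uniquely through `β`. -/
structure IsBlowUp {X Y : Scheme.{u}} (β : X ⟶ Y) (I : Y.IdealSheafData) : Prop where
  invertible : IsInvertibleIdeal (I.comap β)
  existsUnique_lift : ∀ {T : Scheme.{u}} (g : T ⟶ Y), IsInvertibleIdeal (I.comap g) →
    ∃! h : T ⟶ X, h ≫ β = g

/-- The coordinate point of `ℙ²` whose only nonzero coordinate is the `i`-th one. -/
def coordPoint (k : Type u) [Field k] (i : Fin 3) : Closeds (PSpace k 2) :=
  PSpace.coordLocus k 2 {i}ᶜ

/-- The ideal sheaf of the reduced subscheme `{[1:0:0], [0:1:0], [0:0:1]}` of `ℙ²`. -/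
def threePoints (k : Type u) [Field k] : (PSpace k 2).IdealSheafData :=
  Scheme.IdealSheafData.vanishingIdeal
    (coordPoint k 0 ⊔ coordPoint k 1 ⊔ coordPoint k 2)

/-- `π : X ⟶ ℙ¹` is the pencil given by the lines through the `i`-th coordinate point of `ℙ²`:
it is a morphism over `k` and, with `[x₀ : x₁ : x₂]` the coordinates of `β` and `[y₀ : y₁]`
those of `π`, one has `x_{i+1} y₁ = x_{i+2} y₀` (indices modulo 3), i.e. `π` extends the
projection `[x_{i+1} : x_{i+2}]` from the `i`-th coordinate point. -/
structure IsPencil {k : Type u} [Field k] {X : Scheme.{u}} (β : X ⟶ PSpace k 2)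
    (i : Fin 3) (π : X ⟶ PSpace k 1) : Prop where
  over_base : π ≫ PSpace.toSpec k 1 = β ≫ PSpace.toSpec k 2
  incidence : ∀ (m : Fin 3) (b : Fin 2) (U : X.Opens)
    (h₂ : U ≤ β ⁻¹ᵁ PSpace.std k 2 m) (h₁ : U ≤ π ⁻¹ᵁ PSpace.std k 1 b),
    pullFrac β (i + 1) m U h₂ * pullFrac π 1 b U h₁ =
      pullFrac β (i + 2) m U h₂ * pullFrac π 0 b U h₁

/-- The ideal sheaf of the fibre of `π` over a closed point `p`. -/
def fibreIdeal {k : Type u} [Field k] {X : Scheme.{u}} (π : X ⟶ PSpace k 1)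
    (p : closedPoints (PSpace k 1)) : X.IdealSheafData :=
  (Scheme.IdealSheafData.vanishingIdeal ⟨{p.1}, p.2⟩).comap π

/-- The underlying set of the fibre of `π` over a closed point `p`. -/
def fibreSet {k : Type u} [Field k] {X : Scheme.{u}} (π : X ⟶ PSpace k 1)
    (p : closedPoints (PSpace k 1)) : Set X :=
  {x | π x = p.1}

/-- The ideal sheaf of the divisor `∑ᵢ (ℓᵢ + ℓᵢ')`, where `ℓᵢ` and `ℓᵢ'` are the fibres of the
`i`-th pencil over `a i 0` and `a i 1`. -/
def pairsDivisor {k : Type u} [Field k] {X : Scheme.{u}} (π : Fin 3 → (X ⟶ PSpace k 1))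
    (a : Fin 3 → Fin 2 → closedPoints (PSpace k 1)) : X.IdealSheafData :=
  ∏ i, ∏ e, fibreIdeal (π i) (a i e)

/-! ### The threefold `(ℙ¹)³` -/

/-- The product `(ℙ¹)³` over `k`. -/
def Cube (k : Type u) [Field k] : Scheme.{u} :=
  pullback (PSpace.toSpec k 1)
    (pullback.fst (PSpace.toSpec k 1) (PSpace.toSpec k 1) ≫ PSpace.toSpec k 1)

/-- The projection of `(ℙ¹)³` to the first factor. -/
def Cube.fst (k : Type u) [Field k] : Cube k ⟶ PSpace k 1 :=
  pullback.fst (PSpace.toSpec k 1)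
    (pullback.fst (PSpace.toSpec k 1) (PSpace.toSpec k 1) ≫ PSpace.toSpec k 1)

/-- The projection of `(ℙ¹)³` to the product of the last two factors. -/
def Cube.snd (k : Type u) [Field k] :
    Cube k ⟶ pullback (PSpace.toSpec k 1) (PSpace.toSpec k 1) :=
  pullback.snd (PSpace.toSpec k 1)
    (pullback.fst (PSpace.toSpec k 1) (PSpace.toSpec k 1) ≫ PSpace.toSpec k 1)

/-- The three projections `(ℙ¹)³ ⟶ ℙ¹`. -/
def Cube.proj (k : Type u) [Field k] (i : Fin 3) : Cube k ⟶ PSpace k 1 :=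
  match i with
  | 0 => Cube.fst k
  | 1 => Cube.snd k ≫ pullback.fst _ _
  | 2 => Cube.snd k ≫ pullback.snd _ _

/-- The structure morphism `(ℙ¹)³ ⟶ Spec k`. -/
def Cube.toSpec (k : Type u) [Field k] : Cube k ⟶ Spec (.of k) :=
  Cube.proj k 0 ≫ PSpace.toSpec k 1

lemma Cube.proj_toSpec (k : Type u) [Field k] (i : Fin 3) :
    Cube.proj k i ≫ PSpace.toSpec k 1 = Cube.toSpec k := by
  have h1 : Cube.proj k 1 ≫ PSpace.toSpec k 1 = Cube.toSpec k :=
    (Category.assoc _ _ _).trans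
      (pullback.condition (f := PSpace.toSpec k 1)
        (g := pullback.fst (PSpace.toSpec k 1) (PSpace.toSpec k 1) ≫ PSpace.toSpec k 1)).symm
  have h2 : Cube.proj k 2 ≫ PSpace.toSpec k 1 = Cube.toSpec k := by
    rw [← h1]
    simp only [Cube.proj, Category.assoc, pullback.condition]
  fin_cases i
  exacts [rfl, h1, h2]

/-- The morphism to `(ℙ¹)³` with given components. -/
def Cube.lift {k : Type u} [Field k] {W : Scheme.{u}} (s : W ⟶ Spec (.of k))
    (f : Fin 3 → (W ⟶ PSpace k 1)) (hf : ∀ i, f i ≫ PSpace.toSpec k 1 = s) : W ⟶ Cube k :=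
  pullback.lift (f 0) (pullback.lift (f 1) (f 2) ((hf 1).trans (hf 2).symm))
    (by rw [pullback.lift_fst_assoc, hf, hf])

/-- The affine chart `{x_{i, v i} ≠ 0 for all i}` of `(ℙ¹)³`, where `[x_{i,0} : x_{i,1}]` are
the coordinates of the `i`-th factor. -/
def Cube.chart (k : Type u) [Field k] (v : Fin 3 → Fin 2) : (Cube k).Opens :=
  ⨅ i, Cube.proj k i ⁻¹ᵁ PSpace.std k 1 (v i)

lemma Cube.chart_le (k : Type u) [Field k] (v : Fin 3 → Fin 2) (i : Fin 3) :
    Cube.chart k v ≤ Cube.proj k i ⁻¹ᵁ PSpace.std k 1 (v i) :=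
  iInf_le _ i

/-- The scalars `k` as functions on an open subset of `(ℙ¹)³`. -/
def Cube.scalar (k : Type u) [Field k] (U : (Cube k).Opens) : k →+* Γ(Cube k, U) :=
  ((Scheme.ΓSpecIso (.of k)).inv ≫ (Cube.toSpec k).appTop ≫
    (Cube k).presheaf.map (homOfLE le_top).op).hom

/-- The function `x_{i,a} / x_{i, v i}` on the chart of `v`. -/
def Cube.coord (k : Type u) [Field k] (v : Fin 3 → Fin 2) (i : Fin 3) (a : Fin 2) :
    Γ(Cube k, Cube.chart k v) :=
  pullFrac (k := k) (n := 1) (W := Cube k) (Cube.proj k i) a (v i) (Cube.chart k v)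
    (Cube.chart_le k v i)

/-- The function on the chart of `v` obtained from a multihomogeneous polynomial
`F ∈ k[x_{i,a}]` by dehomogenization, i.e. by the substitution
`x_{i,a} ↦ x_{i,a} / x_{i, v i}`. -/
def Cube.dehomogenize {k : Type u} [Field k] (F : MvPolynomial (Fin 3 × Fin 2) k)
    (v : Fin 3 → Fin 2) : Γ(Cube k, Cube.chart k v) :=
  F.eval₂ (Cube.scalar k (Cube.chart k v)) (fun p => Cube.coord k v p.1 p.2)

/-- The ideal sheaf of the closed subscheme `V(F) ⊂ (ℙ¹)³` of a multihomogeneous polynomial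
`F`: its sections are those functions whose restriction to each chart is a multiple of the
dehomogenization of `F`. -/
def Cube.zeroScheme {k : Type u} [Field k] (F : MvPolynomial (Fin 3 × Fin 2) k) :
    (Cube k).IdealSheafData :=
  ⨅ v : Fin 3 → Fin 2,
    (Scheme.IdealSheafData.ofIdealTop
      (Ideal.span {(Cube.chart k v).topIso.inv.hom (Cube.dehomogenize F v)})).map
        (Cube.chart k v).ι

/-- The ideal sheaf of the toric boundary `Δ = V(X₀X₁Y₀Y₁Z₀Z₁) ⊂ (ℙ¹)³`. -/
def Cube.boundary (k : Type u) [Field k] : (Cube k).IdealSheafData :=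
  Cube.zeroScheme (∏ p : Fin 3 × Fin 2, MvPolynomial.X p)

/-- The ideal sheaf of `B = V(∑ c_{ijk} X_i Y_j Z_k) ⊂ (ℙ¹)³`. -/
def triDivisor {k : Type u} [Field k] (c : (Fin 3 → Fin 2) → k) : (Cube k).IdealSheafData :=
  Cube.zeroScheme (∑ v : Fin 3 → Fin 2,
    MvPolynomial.C (c v) * ∏ i, MvPolynomial.X (i, v i))

/-- The pair `(X, D)`, where `X` is a scheme over `k` with structure morphism `s` and `D` is a
closed subscheme of `X` given by its ideal sheaf, is isomorphic over `k` to the pair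
`(B, Δ|_B)`, where `B ⊂ (ℙ¹)³` is the closed subscheme with ideal sheaf `I`. -/
def IsoToBoundaryPair {k : Type u} [Field k] {X : Scheme.{u}} (s : X ⟶ Spec (.of k))
    (D : X.IdealSheafData) (I : (Cube k).IdealSheafData) : Prop :=
  ∃ e : X ≅ I.subscheme, e.hom ≫ I.subschemeι ≫ Cube.toSpec k = s ∧
    ((Cube.boundary k).comap I.subschemeι).comap e.hom = D

/-! ### The action of `𝔾ₘ³ ⋊ Sym(Q)` -/

/-- The monomial substitution `x_a ↦ s_a x_{ε a}` on `k[x₀, x₁]`. -/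
def monomialHom {k : Type u} [Field k] (s : Fin 2 → kˣ) (ε : Equiv.Perm (Fin 2)) :
    GradedRingHom (grading k 1) (grading k 1) where
  toRingHom := (MvPolynomial.aeval
    (fun a => MvPolynomial.C (s a : k) * MvPolynomial.X (ε a))).toRingHom
  map_mem := by
    intro i x hx
    have h := MvPolynomial.IsHomogeneous.aeval (n := 1) hx
      (fun a : Fin 2 => (MvPolynomial.C (s a : k) * MvPolynomial.X (ε a) :
        MvPolynomial (Fin 2) k))
      (fun a => by
        simpa using (MvPolynomial.isHomogeneous_C (Fin 2) (s a : k)).mul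
          (MvPolynomial.isHomogeneous_X k (ε a)))
    simpa using h

lemma monomialHom_surj {k : Type u} [Field k] (s : Fin 2 → kˣ) (ε : Equiv.Perm (Fin 2))
    (x : MvPolynomial (Fin 2) k) :
    monomialHom s ε (monomialHom (fun a => (s (ε.symm a))⁻¹) ε.symm x) = x := by
  change MvPolynomial.aeval _ (MvPolynomial.aeval _ x) = x
  rw [← AlgHom.comp_apply]
  conv_rhs => rw [← AlgHom.id_apply (R := k) x]
  congr 1
  ext a : 1
  simp [← mul_assoc, ← MvPolynomial.C_mul]

lemma irrelevant_le_monomialHom {k : Type u} [Field k] (s : Fin 2 → kˣ)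
    (ε : Equiv.Perm (Fin 2)) :
    HomogeneousIdeal.irrelevant (grading k 1) ≤
      (HomogeneousIdeal.irrelevant (grading k 1)).map (monomialHom s ε) := by
  rw [HomogeneousIdeal.irrelevant_le]
  intro i hi x hx
  have hx' : monomialHom (fun a => (s (ε.symm a))⁻¹) ε.symm x ∈ grading k 1 i :=
    (monomialHom (fun a => (s (ε.symm a))⁻¹) ε.symm).map_mem hx
  have h := Ideal.mem_map_of_mem (monomialHom s ε)
    (HomogeneousIdeal.mem_irrelevant_of_mem (grading k 1) hi hx')
  rw [monomialHom_surj] at h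
  exact h

/-- The monomial automorphism of `ℙ¹` given on coordinates by `x_a ↦ s_a x_{ε a}`. -/
def monomialMap {k : Type u} [Field k] (s : Fin 2 → kˣ) (ε : Equiv.Perm (Fin 2)) :
    PSpace k 1 ⟶ PSpace k 1 :=
  Proj.map (monomialHom s ε) (irrelevant_le_monomialHom s ε)

lemma monomialMap_toSpec {k : Type u} [Field k] (s : Fin 2 → kˣ) (ε : Equiv.Perm (Fin 2)) :
    monomialMap s ε ≫ PSpace.toSpec k 1 = PSpace.toSpec k 1 := by
  have key : ∀ (i : ℕ) (hi : 0 < i) (x : MvPolynomial (Fin 2) k) (hx : x ∈ grading k 1 i),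
      Proj.awayι (grading k 1) (monomialHom s ε x) ((monomialHom s ε).map_mem hx) hi ≫
        (monomialMap s ε ≫ PSpace.toSpec k 1) =
      Proj.awayι (grading k 1) (monomialHom s ε x) ((monomialHom s ε).map_mem hx) hi ≫
        PSpace.toSpec k 1 := by
    intro i hi x hx
    simp only [monomialMap, PSpace.toSpec]
    rw [Proj.awayι_comp_map_assoc (monomialHom s ε) (irrelevant_le_monomialHom s ε) hi x hx,
      Proj.awayι_toSpecZero_assoc, Proj.awayι_toSpecZero_assoc, ← Spec.map_comp,
      ← Spec.map_comp, ← Spec.map_comp]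
    congr 1
    ext r
    have hr : monomialHom s ε (algebraMap k (MvPolynomial (Fin 2) k) r) =
        algebraMap k (MvPolynomial (Fin 2) k) r := by
      change MvPolynomial.aeval _ _ = _
      rw [AlgHom.commutes]
    have h1 : monomialHom s ε 1 = 1 := map_one _
    change Localization.mk (monomialHom s ε (algebraMap k (MvPolynomial (Fin 2) k) r))
      ⟨monomialHom s ε 1, _⟩ = Localization.mk (algebraMap k (MvPolynomial (Fin 2) k) r) ⟨1, _⟩
    congr 1
    exact Subtype.ext h1
  exact (Proj.mapAffineOpenCover (monomialHom s ε)
    (irrelevant_le_monomialHom s ε)).openCover.hom_ext _ _ fun j => key _ j.1.2 _ j.2.2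

/-- An element of `𝔾ₘ³ ⋊ Sym(Q)`. The symmetry group `Sym(Q)` of the unit cube `Q = [0,1]³` is
the wreath product of `ℤ/2` with `S₃`: its elements are given by a permutation of the three
axes and, for each axis, a permutation of the two endpoints of `[0,1]`. -/
structure ToricSymmetry (k : Type u) [Field k] where
  /-- The component in the torus. -/
  torus : Fin 3 → kˣ
  /-- The permutations of the endpoints. -/
  flip : Fin 3 → Equiv.Perm (Fin 2)
  /-- The permutation of the axes. -/
  axes : Equiv.Perm (Fin 3)

/-- The automorphism of `(ℙ¹)³` given by an element of `𝔾ₘ³ ⋊ Sym(Q)`: it permutes the three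
factors, exchanges the two coordinates of some of the factors, and scales the second coordinate
of each factor. -/
def ToricSymmetry.toHom {k : Type u} [Field k] (g : ToricSymmetry k) : Cube k ⟶ Cube k :=
  Cube.lift (Cube.toSpec k)
    (fun i => Cube.proj k (g.axes i) ≫ monomialMap ![1, g.torus i] (g.flip i))
    (fun i => by rw [Category.assoc, monomialMap_toSpec, Cube.proj_toSpec])

end ThreePairs
end

/-! Everything is tested on morphisms from affine, mostly local, schemes. There a morphism to `ℙⁿ`
is a tuple of homogeneous coordinates (`HasCoords`), and an ideal sheaf pulls back to an honest
ideal (`idealAlong`). Two ideal sheaves with the same pullbacks to local rings are equal, so the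
scheme-theoretic statements become identities between polynomials in coordinates.

The geometric core is that the blow-up `X` is the hexagonal surface `Y₀₀ Y₁₀ Y₂₀ = Y₀₁ Y₁₁ Y₂₁` in
`(ℙ¹)³`. Multiplying the relations `[x_{i+1} : x_{i+2}] = [y_{i0} : y_{i1}]` suggests that the three
pencils satisfy this equation. Conversely, the surface is covered by six affine planes on which the
ideal of the three points is generated by a single coordinate, so the universal property of the
blow-up maps each plane to `X`. Hence morphisms to `X` are the same as hexagonal triples of
morphisms to `ℙ¹` (`exists_lift_pencils`, `hom_ext_pencils`).

Existence: a closed point of `ℙ¹` is the zero of a linear form, so the two chosen members of each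
pencil are the zeros of the coordinates after a linear change `M i`. In these coordinates the
hexagonal equation is still of tridegree `(1,1,1)`, and the toric boundary pulls back to the six
curves (`exists_iso_subscheme`, `comap_toCube_boundary`). The coefficient at a vertex of the cube is
the value of the form at the corresponding torus-fixed point. It cannot vanish, for then three of
the curves would meet there (`hexagonCoeff_ne_zero`).

Uniqueness: let `ψ : X ⟶ (ℙ¹)³` be the embedding given by an isomorphism of pairs. On a chart `Spec
k[w₀, w₁]`, which is factorial, each component of `ψ` has two global coordinates, and the product of
all six is a unit times the product of the equations of the six curves. Irreducibility of the
members makes these equations prime. None of the six coordinates is a unit, so each is a constant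
times exactly one equation. The two coordinates of one component have no common zero, whereas curves
from different pencils meet, so the components of `ψ` are the pencils up to a permutation and
monomial changes of coordinates (`exists_eq_monomialMap`). Two such embeddings differ by an element
of the symmetry group, and comparing kernels compares their images. -/

noncomputable section

namespace ThreePairs

/-! ### The ideal of the pullback of a closed subscheme to an affine scheme -/

section IdealAlong

variable {Y : Scheme.{u}} {R S : CommRingCat.{u}}

/-- The ideal of `R` defining the pullback of a closed subscheme along `g : Spec R ⟶ Y`. -/
def idealAlong (g : Spec R ⟶ Y) (I : Y.IdealSheafData) : Ideal R :=
  ((I.comap g).ideal ⟨⊤, isAffineOpen_top _⟩).comap (Scheme.ΓSpecIso R).inv.hom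

lemma idealAlong_comap {Z : Scheme.{u}} (g : Spec R ⟶ Y) (f : Y ⟶ Z) (I : Z.IdealSheafData) :
    idealAlong g (I.comap f) = idealAlong (g ≫ f) I := by
  simp [idealAlong]

/-- The universal property that characterises `idealAlong g I`: a point of `Spec R` factors through
the pulled back closed subscheme exactly when its image factors through the original one. Base
change and the computation of concrete ideals are deduced from it. -/
lemma idealAlong_le_ker_iff (g : Spec R ⟶ Y) (I : Y.IdealSheafData) (φ : R ⟶ S) :
    idealAlong g I ≤ RingHom.ker φ.hom ↔ I ≤ (Spec.map φ ≫ g).ker := by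
  have h1 : I ≤ (Spec.map φ ≫ g).ker ↔ I.comap g ≤ (Spec.map φ).ker := by
    rw [← Scheme.IdealSheafData.map_ker, Scheme.IdealSheafData.le_map_iff_comap_le]
  have h2 : I.comap g ≤ (Spec.map φ).ker ↔
      (I.comap g).ideal ⟨⊤, isAffineOpen_top _⟩ ≤
        (Spec.map φ).ker.ideal ⟨⊤, isAffineOpen_top _⟩ :=
    ⟨fun h => h _, Scheme.IdealSheafData.le_of_isAffine⟩
  rw [h1, h2, Scheme.Hom.ker_apply]
  have hnat : φ ≫ (Scheme.ΓSpecIso S).inv = (Scheme.ΓSpecIso R).inv ≫ (Spec.map φ).appTop :=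
    (Scheme.ΓSpecIso_inv_naturality φ)
  constructor
  · intro h x hx
    have hx' : (Scheme.ΓSpecIso R).hom.hom x ∈ idealAlong g I := by
      simpa [idealAlong] using hx
    have h3 := h hx'
    rw [RingHom.mem_ker] at h3 ⊢
    have h4 := congr($hnat ((Scheme.ΓSpecIso R).hom.hom x))
    simp only [CommRingCat.comp_apply] at h4
    rw [h3, map_zero] at h4
    exact (by simpa using h4.symm : (Spec.map φ).appTop.hom x = 0)
  · intro h x hx
    have h3 := h (show (Scheme.ΓSpecIso R).inv.hom x ∈ _ from hx)
    rw [RingHom.mem_ker] at h3 ⊢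
    have h4 := congr($hnat x)
    simp only [CommRingCat.comp_apply] at h4
    have h5 : (Scheme.ΓSpecIso S).inv.hom (φ.hom x) = 0 := h4.trans h3
    have h6 := congr((Scheme.ΓSpecIso S).hom.hom $h5)
    simpa using h6

/-- Testing on the two quotient maps `R ⧸ K` and `R ⧸ J` suffices. -/
lemma ideal_eq_of_le_ker_iff {J K : Ideal R}
    (h : ∀ (S : CommRingCat.{u}) (φ : R ⟶ S), J ≤ RingHom.ker φ.hom ↔ K ≤ RingHom.ker φ.hom) :
    J = K := by
  apply le_antisymm
  · simpa using h (.of (R ⧸ K)) (CommRingCat.ofHom (Ideal.Quotient.mk K))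
  · simpa using h (.of (R ⧸ J)) (CommRingCat.ofHom (Ideal.Quotient.mk J))

lemma idealAlong_comp (g : Spec R ⟶ Y) (I : Y.IdealSheafData) (φ : R ⟶ S) :
    idealAlong (Spec.map φ ≫ g) I = (idealAlong g I).map φ.hom := by
  refine ideal_eq_of_le_ker_iff fun T ψ => ?_
  rw [idealAlong_le_ker_iff, Ideal.map_le_iff_le_comap, RingHom.comap_ker, ← Category.assoc,
    ← Spec.map_comp, ← idealAlong_le_ker_iff]
  rfl

lemma idealAlong_top (g : Spec R ⟶ Y) : idealAlong g ⊤ = ⊤ := by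
  simp [idealAlong]

lemma le_ker_iff_idealAlong_eq_bot (g : Spec R ⟶ Y) (I : Y.IdealSheafData) :
    I ≤ g.ker ↔ idealAlong g I = ⊥ := by
  have h := idealAlong_le_ker_iff g I (𝟙 R)
  rw [Spec.map_id, Category.id_comp] at h
  rw [← h, ← le_bot_iff]
  have : RingHom.ker (𝟙 R : R ⟶ R).hom = ⊥ := by
    ext; simp [RingHom.mem_ker]
  rw [this]

lemma mem_support_iff_idealAlong_le (g : Spec R ⟶ Y) (I : Y.IdealSheafData) (p : Spec R) :
    g p ∈ I.support ↔ idealAlong g I ≤ p.asIdeal := by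
  have h1 : g p ∈ I.support ↔ p ∈ (I.comap g).support := by
    rw [Scheme.IdealSheafData.support_comap]; rfl
  rw [h1, Scheme.IdealSheafData.mem_support_iff_of_mem
    (U := ⟨⊤, isAffineOpen_top _⟩) (show p ∈ (⊤ : (Spec R).Opens) from trivial)]
  rw [Scheme.mem_zeroLocus_iff]
  constructor
  · intro h x hx
    have := h ((Scheme.ΓSpecIso R).inv.hom x) hx
    rw [basicOpen_eq_of_affine] at this
    exact not_not.mp this
  · intro h x hx hp
    rw [← CommRingCat.inv_hom_apply (Scheme.ΓSpecIso R) x, basicOpen_eq_of_affine] at hp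
    refine hp (h ?_)
    simpa [idealAlong] using hx

lemma mem_ideal_restrict_iff (I : Y.IdealSheafData) {U V : Y.affineOpens} (h : V.1 = U.1)
    (x : Γ(Y, U.1)) :
    (Y.presheaf.map (homOfLE h.le).op).hom x ∈ I.ideal V ↔ x ∈ I.ideal U := by
  obtain rfl : V = U := Subtype.ext h
  simp

lemma idealAlong_fromSpec {U : Y.Opens} (hU : IsAffineOpen U) (I : Y.IdealSheafData) :
    idealAlong hU.fromSpec I = I.ideal ⟨U, hU⟩ := by
  ext x
  rw [idealAlong, Scheme.IdealSheafData.ideal_comap_of_isOpenImmersion, Ideal.mem_comap,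
    Ideal.mem_comap]
  have hV : hU.fromSpec ''ᵁ ⊤ = U := by
    rw [Scheme.Hom.image_top_eq_opensRange, hU.opensRange_fromSpec]
  rw [← mem_ideal_restrict_iff I (U := ⟨U, hU⟩) (V := ⟨hU.fromSpec ''ᵁ ⊤, hV.symm ▸ hU⟩) hV]
  have key : (Scheme.ΓSpecIso Γ(Y, U)).inv ≫ (hU.fromSpec.appIso ⊤).inv =
      Y.presheaf.map (homOfLE hV.le).op := by
    have h : (Scheme.ΓSpecIso Γ(Y, U)).inv =
        hU.fromSpec.appLE U ⊤ hU.fromSpec_preimage_self.ge := by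
      rw [Scheme.Hom.appLE, hU.fromSpec_app_self, Category.assoc, ← Functor.map_comp]
      exact (Category.comp_id _).symm.trans
        (congrArg _ ((Spec Γ(Y, U)).presheaf.map_id _).symm)
    rw [h, Scheme.Hom.appLE_appIso_inv]
  rw [← key]
  rfl

/-- A morphism from an affine scheme into an affine open set. -/
lemma exists_eq_map_fromSpec {U : Y.Opens} (hU : IsAffineOpen U) (g : Spec R ⟶ Y)
    (h : Set.range g ⊆ U) : ∃ φ : Γ(Y, U) ⟶ R, g = Spec.map φ ≫ hU.fromSpec := by
  refine ⟨Spec.preimage (IsOpenImmersion.lift hU.fromSpec g (by rwa [hU.range_fromSpec])), ?_⟩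
  rw [Spec.map_preimage, IsOpenImmersion.lift_fac]

/-- Every point of a local scheme specializes to the closed point, and open sets are stable under
generization. This is what makes local rings convenient test objects: a morphism from one lands in a
single chart. -/
lemma range_subset_of_closedPoint_mem [IsLocalRing R] (g : Spec R ⟶ Y) {U : Y.Opens}
    (h : g (IsLocalRing.closedPoint R) ∈ U) : Set.range g ⊆ U := by
  rintro _ ⟨x, rfl⟩
  exact ((IsLocalRing.specializes_closedPoint x).map g.continuous).mem_open U.2 h

lemma exists_affine_factor [IsLocalRing R] (g : Spec R ⟶ Y) :
    ∃ (U : Y.affineOpens) (φ : Γ(Y, U.1) ⟶ R), g = Spec.map φ ≫ U.2.fromSpec := by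
  obtain ⟨U, hU, hx, -⟩ := exists_isAffineOpen_mem_and_subset
    (x := g (IsLocalRing.closedPoint R)) (U := ⊤) trivial
  exact ⟨⟨U, hU⟩, exists_eq_map_fromSpec hU g (range_subset_of_closedPoint_mem g hx)⟩

/-- Ideals of pullbacks can be compared at the local rings. -/
lemma idealAlong_eq_of_local (g : Spec R ⟶ Y) (I : Y.IdealSheafData) (J : Ideal R)
    (h : ∀ (S : CommRingCat.{u}) (φ : R ⟶ S), IsLocalRing S →
      idealAlong (Spec.map φ ≫ g) I = J.map φ.hom) : idealAlong g I = J := by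
  refine Ideal.eq_of_localization_maximal fun P hP => ?_
  have := h (.of (Localization.AtPrime P)) (CommRingCat.ofHom (algebraMap _ _)) (by
    dsimp; infer_instance)
  rwa [idealAlong_comp] at this

lemma idealAlong_mul (g : Spec R ⟶ Y) (I J : Y.IdealSheafData) :
    idealAlong g (I * J) = idealAlong g I * idealAlong g J := by
  refine idealAlong_eq_of_local _ _ _ fun S φ _ => ?_
  obtain ⟨U, ψ, hψ⟩ := exists_affine_factor (Spec.map φ ≫ g)
  rw [Ideal.map_mul, ← idealAlong_comp, ← idealAlong_comp, hψ]
  rw [idealAlong_comp, idealAlong_comp, idealAlong_comp, idealAlong_fromSpec U.2,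
    idealAlong_fromSpec U.2, idealAlong_fromSpec U.2, Scheme.IdealSheafData.ideal_mul,
    Pi.mul_apply, Ideal.map_mul]

lemma idealAlong_prod {ι : Type*} (s : Finset ι) (g : Spec R ⟶ Y) (I : ι → Y.IdealSheafData) :
    idealAlong g (∏ i ∈ s, I i) = ∏ i ∈ s, idealAlong g (I i) := by
  classical
  induction s using Finset.induction_on with
  | empty => simp [idealAlong_top]
  | insert a s ha ih => rw [Finset.prod_insert ha, Finset.prod_insert ha, idealAlong_mul, ih]

/-- Ideal sheaves are determined by their pullbacks to local rings. -/
lemma idealSheaf_ext {I J : Y.IdealSheafData}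
    (h : ∀ (R : CommRingCat.{u}) (g : Spec R ⟶ Y), IsLocalRing R →
      idealAlong g I = idealAlong g J) : I = J := by
  ext U : 2
  rw [← idealAlong_fromSpec U.2, ← idealAlong_fromSpec U.2]
  refine idealAlong_eq_of_local _ _ _ fun S φ hS => ?_
  rw [h _ _ hS, idealAlong_comp]

lemma le_ker_of_local {T : Scheme.{u}} (f : T ⟶ Y) (I : Y.IdealSheafData)
    (h : ∀ (R : CommRingCat.{u}) (g : Spec R ⟶ T), IsLocalRing R →
      idealAlong (g ≫ f) I = ⊥) : I ≤ f.ker := by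
  rw [← Scheme.IdealSheafData.map_bot, Scheme.IdealSheafData.le_map_iff_comap_le, le_bot_iff]
  refine idealSheaf_ext fun R g hR => ?_
  rw [idealAlong_comap, h _ _ hR]
  rw [eq_comm, ← le_ker_iff_idealAlong_eq_bot]
  exact bot_le

/-- Sections agree if they agree after pullback to local rings. -/
lemma section_ext {U : Y.Opens} {s t : Γ(Y, U)}
    (h : ∀ (R : CommRingCat.{u}) (g : Spec R ⟶ Y) (hg : ⊤ ≤ g ⁻¹ᵁ U), IsLocalRing R →
      (g.appLE U ⊤ hg).hom s = (g.appLE U ⊤ hg).hom t) : s = t := by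
  refine TopCat.Presheaf.section_ext Y.sheaf U s t fun x hx => ?_
  have hU : ⊤ ≤ Y.fromSpecStalk x ⁻¹ᵁ U := fun y _ =>
    range_subset_of_closedPoint_mem (Y.fromSpecStalk x)
      (by rwa [Scheme.fromSpecStalk_closedPoint]) ⟨y, rfl⟩
  have key : (Y.fromSpecStalk x).appLE U ⊤ hU =
      Y.presheaf.germ U x hx ≫ (Scheme.ΓSpecIso _).inv := by
    rw [Scheme.Hom.appLE, Scheme.fromSpecStalk_app hx, Category.assoc, Category.assoc,
      ← Functor.map_comp]
    rfl
  have h1 := h _ (Y.fromSpecStalk x) hU inferInstance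
  rw [key] at h1
  exact (ConcreteCategory.bijective_of_isIso (Scheme.ΓSpecIso (Y.presheaf.stalk x)).inv).1 h1

end IdealAlong

/-! ### Pulling back sections to an affine scheme -/

section PullSection

variable {Y : Scheme.{u}} {R S : CommRingCat.{u}}

/-- The pullback of a section over `U` along a morphism `g : Spec R ⟶ Y` with image in `U`. -/
def pullSection (g : Spec R ⟶ Y) (U : Y.Opens) (h : ⊤ ≤ g ⁻¹ᵁ U) : Γ(Y, U) ⟶ R :=
  g.appLE U ⊤ h ≫ (Scheme.ΓSpecIso R).hom

lemma pullSection_SpecMap (g : Spec R ⟶ Y) (φ : R ⟶ S) (U : Y.Opens) (h : ⊤ ≤ g ⁻¹ᵁ U)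
    (h' : ⊤ ≤ (Spec.map φ ≫ g) ⁻¹ᵁ U) :
    pullSection (Spec.map φ ≫ g) U h' = pullSection g U h ≫ φ := by
  have := (Scheme.Hom.appLE_comp_appLE (Spec.map φ) g U ⊤ ⊤ h le_top).symm
  rw [pullSection, this, pullSection, Category.assoc, Category.assoc,
    ← Scheme.ΓSpecIso_naturality]
  congr 2

lemma pullSection_appLE {Z : Scheme.{u}} (g : Spec R ⟶ Y) (f : Y ⟶ Z) (U : Y.Opens) (V : Z.Opens)
    (h : ⊤ ≤ g ⁻¹ᵁ U) (e : U ≤ f ⁻¹ᵁ V) (h' : ⊤ ≤ (g ≫ f) ⁻¹ᵁ V) :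
    f.appLE V U e ≫ pullSection g U h = pullSection (g ≫ f) V h' := by
  unfold pullSection
  rw [Scheme.Hom.appLE_comp_appLE_assoc]

lemma pullSection_res (g : Spec R ⟶ Y) {U V : Y.Opens} (h : ⊤ ≤ g ⁻¹ᵁ U) (e : U ≤ V)
    (h' : ⊤ ≤ g ⁻¹ᵁ V) :
    Y.presheaf.map (homOfLE e).op ≫ pullSection g U h = pullSection g V h' := by
  unfold pullSection
  rw [Scheme.Hom.map_appLE_assoc]

lemma section_ext_pullSection {U : Y.Opens} {s t : Γ(Y, U)}
    (h : ∀ (R : CommRingCat.{u}) (g : Spec R ⟶ Y) (hg : ⊤ ≤ g ⁻¹ᵁ U), IsLocalRing R →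
      (pullSection g U hg).hom s = (pullSection g U hg).hom t) : s = t :=
  section_ext fun R g hg hR =>
    (ConcreteCategory.bijective_of_isIso (Scheme.ΓSpecIso R).hom).1 (h R g hg hR)

lemma idealAlong_of_range (g : Spec R ⟶ Y) {U : Y.Opens} (hU : IsAffineOpen U)
    (h : ⊤ ≤ g ⁻¹ᵁ U) (I : Y.IdealSheafData) :
    idealAlong g I = (I.ideal ⟨U, hU⟩).map (pullSection g U h).hom := by
  obtain ⟨φ, rfl⟩ := exists_eq_map_fromSpec hU g (by rintro _ ⟨x, rfl⟩; exact h trivial)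
  rw [idealAlong_comp, idealAlong_fromSpec]
  congr 2
  rw [pullSection_SpecMap _ _ _ hU.fromSpec_preimage_self.ge h, pullSection]
  have : hU.fromSpec.appLE U ⊤ hU.fromSpec_preimage_self.ge = (Scheme.ΓSpecIso Γ(Y, U)).inv := by
    rw [Scheme.Hom.appLE, hU.fromSpec_app_self, Category.assoc, ← Functor.map_comp]
    exact (congrArg _ ((Spec Γ(Y, U)).presheaf.map_id _)).trans (Category.comp_id _)
  rw [this, Iso.inv_hom_id, Category.id_comp]

end PullSection

/-! ### Homogeneous coordinates of morphisms to projective space -/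

section Coordinates

open MvPolynomial HomogeneousLocalization

variable {k : Type u} [Field k] {n : ℕ} {R S : CommRingCat.{u}}

lemma eval₂_smul_of_isHomogeneous {K A σ : Type*} [CommSemiring K] [CommSemiring A]
    {p : MvPolynomial σ K} {d : ℕ} (hp : p.IsHomogeneous d) (κ : K →+* A) (ξ : σ → A) (c : A) :
    p.eval₂ κ (fun a => c * ξ a) = c ^ d * p.eval₂ κ ξ := by
  rw [eval₂_eq, eval₂_eq, Finset.mul_sum]
  refine Finset.sum_congr rfl fun m hm => ?_
  have := hp.degree_eq_sum_deg_support hm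
  simp_rw [mul_pow, Finset.prod_mul_distrib, Finset.prod_pow_eq_pow_sum]
  rw [this]
  ring

/-- Evaluation of homogeneous fractions with denominator a power of `f` at a point where `f` is
invertible. -/
def evalAway (κ : k →+* R) (ξ : Fin (n + 1) → R) (f : MvPolynomial (Fin (n + 1)) k)
    (h : IsUnit (f.eval₂ κ ξ)) : Away (grading k n) f →+* R :=
  (IsLocalization.Away.lift (S := Localization.Away f) f (g := eval₂Hom κ ξ)
    (show IsUnit (eval₂Hom κ ξ f) from h)).comp
    (algebraMap (Away (grading k n) f) (Localization.Away f))

lemma evalAway_mk (κ : k →+* R) (ξ : Fin (n + 1) → R) (f : MvPolynomial (Fin (n + 1)) k)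
    (h : IsUnit (f.eval₂ κ ξ)) {d : ℕ} (hf : f ∈ grading k n d) (m : ℕ)
    (p : MvPolynomial (Fin (n + 1)) k) (hp : p ∈ grading k n (m • d)) :
    evalAway κ ξ f h (Away.mk (grading k n) hf m p hp) * f.eval₂ κ ξ ^ m = p.eval₂ κ ξ := by
  have h1 : (Localization.mk p ⟨f ^ m, m, rfl⟩ : Localization.Away f) *
      algebraMap _ _ f ^ m = algebraMap _ _ p := by
    rw [← map_pow, Localization.mk_eq_mk']
    exact IsLocalization.mk'_spec _ _ _
  have h2 := congrArg (IsLocalization.Away.lift (S := Localization.Away f) f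
    (g := eval₂Hom κ ξ) (show IsUnit (eval₂Hom κ ξ f) from h)) h1
  rw [map_mul, map_pow, IsLocalization.Away.lift_eq, IsLocalization.Away.lift_eq] at h2
  exact h2

lemma evalAway_unique (κ : k →+* R) (ξ : Fin (n + 1) → R) (f : MvPolynomial (Fin (n + 1)) k)
    (h : IsUnit (f.eval₂ κ ξ)) {d : ℕ} (hf : f ∈ grading k n d)
    (φ : Away (grading k n) f →+* R)
    (hφ : ∀ m p hp, φ (Away.mk (grading k n) hf m p hp) * f.eval₂ κ ξ ^ m = p.eval₂ κ ξ) :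
    φ = evalAway κ ξ f h := by
  ext z
  obtain ⟨m, p, hp, rfl⟩ := Away.mk_surjective (grading k n) hf z
  refine (h.pow m).mul_right_cancel ?_
  rw [hφ, evalAway_mk]

/-- The morphism `Spec R ⟶ ℙⁿ` with homogeneous coordinates `ξ`, at which the homogeneous
polynomial `f` is invertible. -/
def pointOf (κ : k →+* R) (ξ : Fin (n + 1) → R) (f : MvPolynomial (Fin (n + 1)) k)
    {d : ℕ} (hf : f ∈ grading k n d) (hd : 0 < d) (h : IsUnit (f.eval₂ κ ξ)) :
    Spec R ⟶ PSpace k n :=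
  Spec.map (CommRingCat.ofHom (evalAway κ ξ f h)) ≫ Proj.awayι (grading k n) f hf hd

/-- Shrinking the chart from `{f ≠ 0}` to `{f g ≠ 0}` does not change the morphism. Two admissible
denominators are then compared through their product. -/
lemma pointOf_mul (κ : k →+* R) (ξ : Fin (n + 1) → R) (f g : MvPolynomial (Fin (n + 1)) k)
    {d e : ℕ} (hf : f ∈ grading k n d) (hd : 0 < d) (hg : g ∈ grading k n e)
    (hfu : IsUnit (f.eval₂ κ ξ)) {m : ℕ} (hm : d + e = m) (hm0 : 0 < m)
    (hfg : f * g ∈ grading k n m) (hu : IsUnit ((f * g).eval₂ κ ξ)) :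
    pointOf κ ξ f hf hd hfu = pointOf κ ξ (f * g) hfg hm0 hu := by
  subst hm
  rw [pointOf, pointOf, ← Proj.SpecMap_awayMap_awayι (grading k n) hf hd hg rfl,
    ← Category.assoc, ← Spec.map_comp, ← CommRingCat.ofHom_comp]
  congr 3
  symm
  refine evalAway_unique κ ξ f hfu hf _ fun m p hp => ?_
  rw [RingHom.comp_apply, awayMap_mk]
  have hgu : IsUnit (g.eval₂ κ ξ) := by
    rw [eval₂_mul] at hu
    exact isUnit_of_mul_isUnit_right hu
  refine (hgu.pow m).mul_right_cancel ?_
  rw [mul_assoc, ← mul_pow, ← eval₂_mul, evalAway_mk, eval₂_mul, eval₂_pow]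

lemma pointOf_eq (κ : k →+* R) (ξ : Fin (n + 1) → R) (f g : MvPolynomial (Fin (n + 1)) k)
    {d e : ℕ} (hf : f ∈ grading k n d) (hd : 0 < d) (hg : g ∈ grading k n e) (he : 0 < e)
    (hfu : IsUnit (f.eval₂ κ ξ)) (hgu : IsUnit (g.eval₂ κ ξ)) :
    pointOf κ ξ f hf hd hfu = pointOf κ ξ g hg he hgu := by
  have hu : IsUnit ((f * g).eval₂ κ ξ) := by rw [eval₂_mul]; exact hfu.mul hgu
  rw [pointOf_mul κ ξ f g hf hd hg hfu rfl (by omega) (SetLike.mul_mem_graded hf hg) hu,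
    pointOf_mul κ ξ g f hg he hf hgu (add_comm _ _) (by omega)
      (mul_comm f g ▸ SetLike.mul_mem_graded hf hg) (mul_comm f g ▸ hu)]
  congr 1
  exact mul_comm f g

lemma SpecMap_pointOf (κ : k →+* R) (ξ : Fin (n + 1) → R) (f : MvPolynomial (Fin (n + 1)) k)
    {d : ℕ} (hf : f ∈ grading k n d) (hd : 0 < d) (h : IsUnit (f.eval₂ κ ξ)) (φ : R ⟶ S)
    (h' : IsUnit (f.eval₂ (φ.hom.comp κ) (fun a => φ.hom (ξ a)))) :
    Spec.map φ ≫ pointOf κ ξ f hf hd h =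
      pointOf (φ.hom.comp κ) (fun a => φ.hom (ξ a)) f hf hd h' := by
  have hev : ∀ p : MvPolynomial (Fin (n + 1)) k,
      p.eval₂ (φ.hom.comp κ) (fun a => φ.hom (ξ a)) = φ.hom (p.eval₂ κ ξ) := fun p =>
    (MvPolynomial.eval₂_comp_left φ.hom κ ξ p).symm
  rw [pointOf, pointOf, ← Category.assoc, ← Spec.map_comp]
  congr 2
  ext1
  refine evalAway_unique _ _ f h' hf _ fun m p hp => ?_
  rw [hev, hev, ← evalAway_mk κ ξ f h hf m p hp, map_mul, map_pow]
  rfl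

lemma pointOf_toSpec (κ : k →+* R) (ξ : Fin (n + 1) → R) (f : MvPolynomial (Fin (n + 1)) k)
    {d : ℕ} (hf : f ∈ grading k n d) (hd : 0 < d) (h : IsUnit (f.eval₂ κ ξ)) :
    pointOf κ ξ f hf hd h ≫ PSpace.toSpec k n = Spec.map (CommRingCat.ofHom κ) := by
  rw [pointOf, PSpace.toSpec, Category.assoc, Proj.awayι_toSpecZero_assoc, ← Spec.map_comp,
    ← Spec.map_comp]
  congr 1
  ext r
  have := evalAway_mk κ ξ f h hf 0 (C r) (by simp)
  rw [pow_zero, mul_one, eval₂_C] at this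
  refine Eq.trans ?_ this
  change evalAway κ ξ f h (fromZeroRingHom (grading k n) _ (algebraMap k _ r)) = _
  congr 1
  ext
  simp only [Away.val_mk, pow_zero]
  rfl

end Coordinates

/-! ### Gluing over basic open covers and localization -/

section LocalToGlobal

variable {Y : Scheme.{u}} {R : CommRingCat.{u}}

/-- The localization of `R` away from `r`. -/
abbrev awayHom (r : R) : R ⟶ CommRingCat.of (Localization.Away r) :=
  CommRingCat.ofHom (algebraMap R (Localization.Away r))

lemma isUnit_awayHom (r : R) : IsUnit ((awayHom r).hom r) :=
  IsLocalization.Away.algebraMap_isUnit r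

lemma range_SpecMap_awayHom (r : R) (p : Spec R) (h : r ∉ p.asIdeal) :
    ∃ q, Spec.map (awayHom r) q = p := by
  have := PrimeSpectrum.localization_away_comap_range (Localization.Away r) r
  exact (eq_iff_iff.mp congr(p ∈ $this)).mpr h

lemma SpecMap_awayHom_notMem (r : R) (q : Spec (.of (Localization.Away r))) :
    r ∉ (Spec.map (awayHom r) q).asIdeal := fun h =>
  q.2.ne_top (Ideal.eq_top_of_isUnit_mem _ h (isUnit_awayHom r))

lemma span_eq_top_of_forall_exists {ι : Type*} (s : ι → R)
    (h : ∀ p : Spec R, ∃ i, s i ∉ p.asIdeal) : Ideal.span (Set.range s) = ⊤ := by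
  by_contra hne
  obtain ⟨m, hm, hle⟩ := Ideal.exists_le_maximal _ hne
  obtain ⟨i, hi⟩ := h ⟨m, hm.isPrime⟩
  exact hi (hle (Ideal.subset_span ⟨i, rfl⟩))

lemma exists_notMem_of_span_eq_top {ι : Type*} {s : ι → R}
    (h : Ideal.span (Set.range s) = ⊤) (p : Spec R) : ∃ i, s i ∉ p.asIdeal := by
  by_contra! hp
  exact p.2.ne_top (top_le_iff.1 (h ▸ Ideal.span_le.2 (by rintro _ ⟨i, rfl⟩; exact hp i)))

lemma spec_hom_ext {f g : Spec R ⟶ Y}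
    (h : ∀ p : Spec R, ∃ r ∉ p.asIdeal,
      Spec.map (awayHom r) ≫ f = Spec.map (awayHom r) ≫ g) : f = g := by
  choose r hr hfg using h
  exact (Scheme.affineOpenCoverOfSpanRangeEqTop r
    (span_eq_top_of_forall_exists r fun p => ⟨p, hr p⟩)).openCover.hom_ext _ _ hfg

lemma eq_of_forall_local {x y : R} (h : ∀ (S : CommRingCat.{u}) (φ : R ⟶ S), IsLocalRing S →
    φ.hom x = φ.hom y) : x = y := by
  rw [← sub_eq_zero, ← Ideal.mem_bot]
  refine Ideal.mem_of_localization_maximal fun P hP => ?_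
  have := h (.of (Localization.AtPrime P)) (CommRingCat.ofHom (algebraMap _ _))
    (by dsimp; infer_instance)
  rw [Ideal.map_bot, Ideal.mem_bot, map_sub, sub_eq_zero]
  exact this

end LocalToGlobal

/-! ### Points of projective space with an invertible coordinate -/

section Coordinates

open MvPolynomial HomogeneousLocalization

variable {k : Type u} [Field k] {n : ℕ} {R S : CommRingCat.{u}}

lemma X_mem (b : Fin (n + 1)) : (X b : MvPolynomial (Fin (n + 1)) k) ∈ grading k n 1 :=
  isHomogeneous_X k b

lemma evalAway_mk_X (κ : k →+* R) (ξ : Fin (n + 1) → R) (b : Fin (n + 1))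
    (h : IsUnit ((X b : MvPolynomial (Fin (n + 1)) k).eval₂ κ ξ)) (m : ℕ)
    (p : MvPolynomial (Fin (n + 1)) k) (hp : p ∈ grading k n (m • 1)) :
    evalAway κ ξ (X b) h (Away.mk (grading k n) (X_mem b) m p hp) * ξ b ^ m = p.eval₂ κ ξ := by
  have h1 := evalAway_mk κ ξ (X b) h (X_mem b) m p hp
  simp only [eval₂_X] at h1
  exact h1

/-- The morphism `Spec R ⟶ ℙⁿ` with homogeneous coordinates `ξ`, where `ξ b` is invertible. -/
def pointAt (κ : k →+* R) (ξ : Fin (n + 1) → R) (b : Fin (n + 1)) (h : IsUnit (ξ b)) :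
    Spec R ⟶ PSpace k n :=
  pointOf κ ξ (X b) (X_mem b) one_pos (by rwa [eval₂_X])

lemma pointAt_eq (κ : k →+* R) (ξ : Fin (n + 1) → R) (b c : Fin (n + 1)) (hb : IsUnit (ξ b))
    (hc : IsUnit (ξ c)) : pointAt κ ξ b hb = pointAt κ ξ c hc :=
  pointOf_eq _ _ _ _ _ _ _ _ _ _

lemma SpecMap_pointAt (κ : k →+* R) (ξ : Fin (n + 1) → R) (b : Fin (n + 1)) (h : IsUnit (ξ b))
    (φ : R ⟶ S) : Spec.map φ ≫ pointAt κ ξ b h =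
      pointAt (φ.hom.comp κ) (fun a => φ.hom (ξ a)) b (h.map φ.hom) :=
  SpecMap_pointOf _ _ _ _ _ _ _ _

lemma pointAt_toSpec (κ : k →+* R) (ξ : Fin (n + 1) → R) (b : Fin (n + 1)) (h : IsUnit (ξ b)) :
    pointAt κ ξ b h ≫ PSpace.toSpec k n = Spec.map (CommRingCat.ofHom κ) :=
  pointOf_toSpec _ _ _ _ _ _

lemma pointAt_smul (κ : k →+* R) (ξ ζ : Fin (n + 1) → R) (b : Fin (n + 1)) (h : IsUnit (ξ b))
    (h' : IsUnit (ζ b)) (c : R) (hc : ∀ a, ζ a = c * ξ a) :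
    pointAt κ ξ b h = pointAt κ ζ b h' := by
  unfold pointAt pointOf
  congr 3
  refine evalAway_unique _ _ _ _ (X_mem b) _ fun m p hp => ?_
  rw [eval₂_X, hc b, mul_pow, mul_left_comm, evalAway_mk_X,
    show ζ = fun a => c * ξ a from funext hc, eval₂_smul_of_isHomogeneous (d := m)
    (by simpa using hp)]

lemma pointAt_preimage_std (κ : k →+* R) (ξ : Fin (n + 1) → R) (b c : Fin (n + 1))
    (h : IsUnit (ξ b)) (p : Spec R) :
    pointAt κ ξ b h p ∈ PSpace.std k n c ↔ ξ c ∉ p.asIdeal := by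
  have h1 : pointAt κ ξ b h p ∈ PSpace.std k n c ↔
      Spec.map (CommRingCat.ofHom (evalAway κ ξ (X b) (by rwa [eval₂_X]))) p ∈
        Proj.awayι (grading k n) (X b) (X_mem b) one_pos ⁻¹ᵁ
          Proj.basicOpen (grading k n) (X c) := Iff.rfl
  rw [h1, Proj.awayι_preimage_basicOpen (grading k n) (X_mem b) one_pos
    (X_mem c) one_pos]
  change Away.isLocalizationElem _ _ ∉
    (Spec.map (CommRingCat.ofHom (evalAway κ ξ (X b) (by rwa [eval₂_X]))) p).asIdeal ↔ _
  change evalAway κ ξ (X b) (by rwa [eval₂_X]) _ ∉ p.asIdeal ↔ _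
  rw [not_iff_not]
  have h2 := evalAway_mk_X κ ξ b (by rwa [eval₂_X]) 1 (X c ^ 1)
    (by simpa using X_mem c)
  rw [pow_one (ξ b), eval₂_pow, pow_one (eval₂ _ _ _), eval₂_X κ ξ c] at h2
  rw [← h2]
  constructor
  · intro h; exact Ideal.mul_mem_right _ _ h
  · intro h3
    exact (p.2.mem_or_mem h3).resolve_right fun h4 =>
      p.2.ne_top (Ideal.eq_top_of_isUnit_mem _ h4 h)

lemma iSup_std (k : Type u) [Field k] (n : ℕ) : ⨆ b, PSpace.std k n b = ⊤ := by
  refine Proj.iSup_basicOpen_eq_top' (grading k n) _ (fun b => ⟨1, X_mem b⟩) ?_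
  rw [eq_top_iff]
  intro p _
  have := MvPolynomial.adjoin_range_X (R := k) (σ := Fin (n + 1))
  have hp : p ∈ Algebra.adjoin k (Set.range (X : Fin (n + 1) → MvPolynomial (Fin (n + 1)) k)) :=
    this ▸ trivial
  induction hp using Algebra.adjoin_induction with
  | mem x hx => exact Algebra.subset_adjoin hx
  | algebraMap r => exact Subalgebra.algebraMap_mem _ (algebraMap k (grading k n 0) r)
  | add x y _ _ hx hy => exact add_mem (hx trivial) (hy trivial)
  | mul x y _ _ hx hy => exact mul_mem (hx trivial) (hy trivial)

lemma exists_mem_std (x : PSpace k n) : ∃ b, x ∈ PSpace.std k n b := by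
  have : x ∈ ⨆ b, PSpace.std k n b := iSup_std k n ▸ trivial
  simpa using this

lemma awayToSection_pullSection (f : MvPolynomial (Fin (n + 1)) k) {d : ℕ}
    (hf : f ∈ grading k n d) (hd : 0 < d)
    (h : ⊤ ≤ Proj.awayι (grading k n) f hf hd ⁻¹ᵁ Proj.basicOpen (grading k n) f) :
    Proj.awayToSection (grading k n) f ≫ pullSection (Proj.awayι (grading k n) f hf hd) _ h =
      𝟙 _ := by
  have h1 := Proj.basicOpenToSpec_app_top (grading k n) f
  rw [← Proj.basicOpenIsoSpec_hom (grading k n) f hf hd] at h1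
  have h2 : pullSection (Proj.awayι (grading k n) f hf hd) _ h =
      (Proj.basicOpen (grading k n) f).topIso.inv ≫
        (Proj.basicOpenIsoSpec (grading k n) f hf hd).inv.appTop ≫ (Scheme.ΓSpecIso _).hom := by
    unfold pullSection Proj.awayι
    rw [← Scheme.Hom.appLE_comp_appLE (Proj.basicOpenIsoSpec (grading k n) f hf hd).inv
      (Proj.basicOpen (grading k n) f).ι _ ⊤ ⊤ (by simp) le_top, Category.assoc]
    congr 1
  rw [h2]
  have h3 : Proj.awayToSection (grading k n) f ≫ (Proj.basicOpen (grading k n) f).topIso.inv =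
      (Scheme.ΓSpecIso _).inv ≫ (Proj.basicOpenIsoSpec (grading k n) f hf hd).hom.appTop := by
    rw [Iso.eq_inv_comp]; exact h1.symm
  rw [reassoc_of% h3, ← Scheme.Hom.comp_appTop_assoc, Iso.inv_hom_id]
  simp

lemma isAffineOpen_std (b : Fin (n + 1)) : IsAffineOpen (PSpace.std k n b) :=
  Proj.isAffineOpen_basicOpen _ _ (X_mem b) one_pos

lemma le_awayι_preimage (f : MvPolynomial (Fin (n + 1)) k) {d : ℕ}
    (hf : f ∈ grading k n d) (hd : 0 < d) :
    ⊤ ≤ Proj.awayι (grading k n) f hf hd ⁻¹ᵁ Proj.basicOpen (grading k n) f := by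
  rw [← Proj.opensRange_awayι (grading k n) f hf hd]
  exact fun x _ => ⟨x, rfl⟩

lemma pullSection_pointAt_frac (κ : k →+* R) (ξ : Fin (n + 1) → R) (a b : Fin (n + 1))
    (hb : IsUnit (ξ b)) (h : ⊤ ≤ pointAt κ ξ b hb ⁻¹ᵁ PSpace.std k n b) :
    (pullSection (pointAt κ ξ b hb) (PSpace.std k n b) h).hom (PSpace.frac k n a b) * ξ b =
      ξ a := by
  have h1 := evalAway_mk_X κ ξ b (by rwa [eval₂_X]) 1 (X a)
    (by simpa using X_mem a)
  rw [eval₂_X κ ξ a, pow_one] at h1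
  refine Eq.trans ?_ h1
  congr 1
  rw [show pullSection (pointAt κ ξ b hb) (PSpace.std k n b) h = _ from
    pullSection_SpecMap (Proj.awayι (grading k n) (X b) (X_mem b) one_pos)
      (CommRingCat.ofHom (evalAway κ ξ (X b) (by rwa [eval₂_X]))) _
      (le_awayι_preimage (X b : MvPolynomial (Fin (n + 1)) k) (X_mem b) one_pos) h]
  unfold PSpace.frac
  have := awayToSection_pullSection (X b : MvPolynomial (Fin (n + 1)) k) (X_mem b) one_pos
    (le_awayι_preimage (X b) (X_mem b) one_pos)
  have h2 := congr($this (Away.mk (grading k n)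
      (f := MvPolynomial.X b) (d := 1) (MvPolynomial.isHomogeneous_X k b) 1
      (MvPolynomial.X a) (by simpa using X_mem a)))
  rw [CommRingCat.comp_apply] at h2
  exact congrArg (evalAway κ ξ (X b) (by rwa [eval₂_X])) h2

lemma const_toSpec (f : MvPolynomial (Fin (n + 1)) k) {d : ℕ}
    (hf : f ∈ grading k n d) (hd : 0 < d) (κ : k →+* R)
    (φ : CommRingCat.of (Away (grading k n) f) ⟶ R)
    (h : (Spec.map φ ≫ Proj.awayι (grading k n) f hf hd) ≫ PSpace.toSpec k n =
      Spec.map (CommRingCat.ofHom κ)) (r : k) :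
    φ.hom (Away.mk (grading k n) hf 0 (C r) (by simp)) = κ r := by
  rw [PSpace.toSpec, Category.assoc, Proj.awayι_toSpecZero_assoc, ← Spec.map_comp,
    ← Spec.map_comp] at h
  have h1 := congr($(Spec.map_injective h) r)
  refine Eq.trans ?_ h1
  change φ.hom _ = φ.hom (fromZeroRingHom (grading k n) _ (algebraMap k _ r))
  congr 1
  ext
  simp only [Away.val_mk, pow_zero]
  rfl

/-- The degree-zero part of the localization is generated over `k` by the fractions `x_a / x_b`,
since a homogeneous `p` of degree `m` satisfies `p / x_b ^ m = p (x / x_b)`. A homomorphism out of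
it is therefore determined by the scalars and these fractions. -/
lemma away_mk_eq_eval₂ (b : Fin (n + 1)) (m : ℕ) (p : MvPolynomial (Fin (n + 1)) k)
    (hp : p ∈ grading k n (m • 1)) (φ : Away (grading k n) (X b : MvPolynomial _ k) →+* R)
    (κ : k →+* R)
    (hκ : ∀ r, φ (Away.mk (grading k n) (X_mem b) 0 (C r) (by simp)) = κ r) :
    φ (Away.mk (grading k n) (X_mem b) m p hp) =
      p.eval₂ κ (fun a => φ (Away.mk (grading k n) (X_mem b) 1 (X a)
        (by simpa using X_mem a))) := by
  let c : k →+* Away (grading k n) (X b : MvPolynomial _ k) :=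
    (fromZeroRingHom (grading k n) _).comp (algebraMap k (grading k n 0))
  let L := Localization.Away (X b : MvPolynomial (Fin (n + 1)) k)
  have hc : φ.comp c = κ := by
    ext r
    rw [← hκ]
    change φ (fromZeroRingHom (grading k n) _ (algebraMap k _ r)) = _
    congr 1
  have hcv : (algebraMap (Away (grading k n) (X b)) L).comp c = algebraMap k L := by
    rfl
  have hmk : ∀ (m : ℕ) (q : MvPolynomial (Fin (n + 1)) k) (hq : q ∈ grading k n (m • 1)),
      algebraMap (MvPolynomial (Fin (n + 1)) k) L (X b) ^ m *
        algebraMap _ L (Away.mk (grading k n) (X_mem b) m q hq) = algebraMap _ L q := by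
    intro m q hq
    change algebraMap (MvPolynomial (Fin (n + 1)) k) L (X b) ^ m *
      HomogeneousLocalization.val (Away.mk (grading k n) (X_mem b) m q hq) = _
    rw [Away.val_mk, ← map_pow, Localization.mk_eq_mk', mul_comm]
    exact IsLocalization.mk'_spec _ _ _
  rw [← hc]
  have h1 : Away.mk (grading k n) (X_mem b) m p hp = p.eval₂ c
      (fun a => Away.mk (grading k n) (X_mem b) 1 (X a) (by simpa using X_mem a)) := by
    apply HomogeneousLocalization.val_injective
    refine ((IsLocalization.Away.algebraMap_isUnit (S := L) (X b)).pow m).mul_left_cancel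
      ((hmk m p hp).trans ?_)
    refine Eq.trans ?_ (congrArg _
      (MvPolynomial.eval₂_comp_left (algebraMap (Away (grading k n) (X b)) L) c _ p).symm)
    rw [hcv, ← eval₂_smul_of_isHomogeneous (d := m) (by simpa using hp)]
    have h3 : (fun a => algebraMap (MvPolynomial (Fin (n + 1)) k) L (X b) *
        ((algebraMap (Away (grading k n) (X b)) L) ∘
        fun a => Away.mk (grading k n) (X_mem b) 1 (X a) (by simpa using X_mem a)) a) =
        algebraMap (MvPolynomial (Fin (n + 1)) k) L ∘ X := by
      funext a
      simpa using hmk 1 (X a) (by simpa using X_mem (k := k) a)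
    rw [h3]
    exact (MvPolynomial.eval₂_comp_left (algebraMap _ L) C X p).symm ▸ (by rw [eval₂_eta])
  rw [h1]
  exact MvPolynomial.eval₂_comp_left φ c _ p

lemma exists_pointAt (κ : k →+* R) (f : Spec R ⟶ PSpace k n)
    (hf : f ≫ PSpace.toSpec k n = Spec.map (CommRingCat.ofHom κ)) (b : Fin (n + 1))
    (hb : ⊤ ≤ f ⁻¹ᵁ PSpace.std k n b) :
    ∃ (ξ : Fin (n + 1) → R) (h : ξ b = 1), f = pointAt κ ξ b (h ▸ isUnit_one) := by
  have hr : Set.range f ⊆ Set.range (Proj.awayι (grading k n) (X b) (X_mem b)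
      one_pos) := by
    rintro _ ⟨x, rfl⟩
    have : f x ∈ (Proj.awayι (grading k n) (X b) (X_mem b) one_pos).opensRange := by
      rw [Proj.opensRange_awayι]; exact hb trivial
    exact this
  obtain ⟨φ, rfl⟩ : ∃ φ, f = Spec.map φ ≫ Proj.awayι (grading k n) (X b) (X_mem b)
      one_pos :=
    ⟨Spec.preimage (IsOpenImmersion.lift _ f hr), by
      rw [Spec.map_preimage, IsOpenImmersion.lift_fac]⟩
  have hκ := const_toSpec _ _ _ κ φ hf
  let ξ : Fin (n + 1) → R := fun a => φ.hom (Away.mk (grading k n) (X_mem b) 1 (X a)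
        (by simpa using X_mem a))
  have hξ : ξ b = 1 := by
    rw [← map_one φ.hom]
    change φ.hom _ = φ.hom _
    congr 1
    ext
    rw [Away.val_mk, val_one]
    exact (Localization.mk_eq_mk_iff.mpr (Localization.r_of_eq (by simp))).trans
      Localization.mk_one
  refine ⟨ξ, hξ, ?_⟩
  unfold pointAt pointOf
  congr 2
  ext1
  refine evalAway_unique κ ξ (X b) (by rw [eval₂_X, hξ]; exact isUnit_one) (X_mem b) _
    fun m p hp => ?_
  rw [eval₂_X, hξ, one_pow, mul_one, away_mk_eq_eval₂ b m p hp φ.hom κ hκ]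

end Coordinates

lemma exists_awayHom_le {Y : Scheme.{u}} {R : CommRingCat.{u}} (f : Spec R ⟶ Y) (U : Y.Opens)
    (p : Spec R) (hp : f p ∈ U) :
    ∃ r ∉ p.asIdeal, ⊤ ≤ (Spec.map (awayHom r) ≫ f) ⁻¹ᵁ U := by
  obtain ⟨_, ⟨r, rfl⟩, hpr, hle⟩ :=
    PrimeSpectrum.isTopologicalBasis_basic_opens.exists_subset_of_mem_open
      (show p ∈ (f ⁻¹ᵁ U : Set (Spec R)) from hp) (f ⁻¹ᵁ U).2
  refine ⟨r, hpr, fun q _ => ?_⟩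
  change f (Spec.map (awayHom r) q) ∈ U
  exact hle (SpecMap_awayHom_notMem r q)

lemma exists_isUnit_of_span_eq_top {R : CommRingCat.{u}} [IsLocalRing R] {ι : Type*} {s : ι → R}
    (h : Ideal.span (Set.range s) = ⊤) : ∃ i, IsUnit (s i) := by
  obtain ⟨i, hi⟩ := exists_notMem_of_span_eq_top h (IsLocalRing.closedPoint R)
  exact ⟨i, by simpa [IsLocalRing.closedPoint] using hi⟩

/-! ### Homogeneous coordinates over an arbitrary ring -/

section Coordinates

variable {k : Type u} [Field k] {n : ℕ} {R S : CommRingCat.{u}}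

/-- The morphism `f : Spec R ⟶ ℙⁿ` is given by the homogeneous coordinates `ξ`. -/
structure HasCoords (κ : k →+* R) (f : Spec R ⟶ PSpace k n) (ξ : Fin (n + 1) → R) : Prop where
  span_eq_top : Ideal.span (Set.range ξ) = ⊤
  -- Over a general ring no single coordinate need be invertible, so the morphism is described after
  -- every base change that makes one invertible. This also makes stability under base change
  -- immediate.
  map_eq : ∀ {S : CommRingCat.{u}} (φ : R ⟶ S) (b : Fin (n + 1)) (hb : IsUnit (φ.hom (ξ b))),
    Spec.map φ ≫ f = pointAt (φ.hom.comp κ) (fun a => φ.hom (ξ a)) b hb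

lemma span_map_eq_top {ι : Type*} {ξ : ι → R} (h : Ideal.span (Set.range ξ) = ⊤) (φ : R ⟶ S) :
    Ideal.span (Set.range fun a => φ.hom (ξ a)) = ⊤ := by
  have := congrArg (Ideal.map φ.hom) h
  rwa [Ideal.map_span, Ideal.map_top, ← Set.range_comp] at this

namespace HasCoords

variable {κ : k →+* R} {f g : Spec R ⟶ PSpace k n} {ξ ζ : Fin (n + 1) → R}

lemma comp (h : HasCoords κ f ξ) (φ : R ⟶ S) :
    HasCoords (φ.hom.comp κ) (Spec.map φ ≫ f) (fun a => φ.hom (ξ a)) where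
  span_eq_top := span_map_eq_top h.span_eq_top φ
  map_eq ψ b hb := by
    rw [← Category.assoc, ← Spec.map_comp]
    exact h.map_eq (φ ≫ ψ) b hb

lemma ext (hf : HasCoords κ f ξ) (hg : HasCoords κ g ξ) : f = g := by
  refine spec_hom_ext fun p => ?_
  obtain ⟨b, hb⟩ := exists_notMem_of_span_eq_top hf.span_eq_top p
  exact ⟨_, hb, by rw [hf.map_eq _ b (isUnit_awayHom _), hg.map_eq _ b (isUnit_awayHom _)]⟩

lemma toSpec (h : HasCoords κ f ξ) :
    f ≫ PSpace.toSpec k n = Spec.map (CommRingCat.ofHom κ) := by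
  refine spec_hom_ext fun p => ?_
  obtain ⟨b, hb⟩ := exists_notMem_of_span_eq_top h.span_eq_top p
  refine ⟨_, hb, ?_⟩
  rw [← Category.assoc, h.map_eq _ b (isUnit_awayHom _), pointAt_toSpec, ← Spec.map_comp]
  rfl

lemma eq_pointAt (h : HasCoords κ f ξ) (b : Fin (n + 1)) (hb : IsUnit (ξ b)) :
    f = pointAt κ ξ b hb := by
  have := h.map_eq (𝟙 R) b hb
  rwa [Spec.map_id, Category.id_comp] at this

lemma smul (h : HasCoords κ f ξ) {c : R} (hc : IsUnit c) :
    HasCoords κ f (fun a => c * ξ a) where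
  span_eq_top := by
    rw [eq_top_iff, ← h.span_eq_top, Ideal.span_le]
    rintro _ ⟨a, rfl⟩
    have h1 : c * ξ a ∈ Ideal.span (Set.range fun a => c * ξ a) := Ideal.subset_span ⟨a, rfl⟩
    exact (Ideal.unit_mul_mem_iff_mem _ hc).1 h1
  map_eq φ b hb := by
    rw [map_mul] at hb
    rw [h.map_eq φ b (isUnit_of_mul_isUnit_right hb)]
    exact pointAt_smul _ _ _ _ _ _ (φ.hom c) fun a => map_mul _ _ _

lemma mem_std_iff (h : HasCoords κ f ξ) (b : Fin (n + 1)) (p : Spec R) :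
    f p ∈ PSpace.std k n b ↔ ξ b ∉ p.asIdeal := by
  obtain ⟨c, hc⟩ := exists_notMem_of_span_eq_top h.span_eq_top p
  obtain ⟨q, rfl⟩ := range_SpecMap_awayHom _ _ hc
  have := pointAt_preimage_std ((awayHom (ξ c)).hom.comp κ) (fun a => (awayHom (ξ c)).hom (ξ a)) c
    b (isUnit_awayHom _) q
  rw [← h.map_eq] at this
  exact this

lemma le_std (h : HasCoords κ f ξ) {b : Fin (n + 1)} (hb : IsUnit (ξ b)) :
    ⊤ ≤ f ⁻¹ᵁ PSpace.std k n b := fun p _ =>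
  (h.mem_std_iff b p).2 fun hp => p.2.ne_top (Ideal.eq_top_of_isUnit_mem _ hp hb)

lemma isUnit_of_le_std (h : HasCoords κ f ξ) {b : Fin (n + 1)}
    (hb : ⊤ ≤ f ⁻¹ᵁ PSpace.std k n b) : IsUnit (ξ b) := by
  by_contra hu
  obtain ⟨m, hm, hle⟩ := exists_max_ideal_of_mem_nonunits hu
  exact (h.mem_std_iff b ⟨m, hm.isPrime⟩).1 (hb trivial) hle

lemma pullSection_frac (h : HasCoords κ f ξ) (a b : Fin (n + 1))
    (hb : ⊤ ≤ f ⁻¹ᵁ PSpace.std k n b) :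
    (pullSection f (PSpace.std k n b) hb).hom (PSpace.frac k n a b) * ξ b = ξ a := by
  have hu := h.isUnit_of_le_std hb
  obtain rfl := h.eq_pointAt b hu
  exact pullSection_pointAt_frac _ _ _ _ _ _

end HasCoords

lemma hasCoords_pointAt (κ : k →+* R) (ξ : Fin (n + 1) → R) (b : Fin (n + 1)) (hb : IsUnit (ξ b)) :
    HasCoords κ (pointAt κ ξ b hb) ξ where
  span_eq_top := Ideal.eq_top_of_isUnit_mem _ (Ideal.subset_span ⟨b, rfl⟩) hb
  map_eq _ _ _ := (SpecMap_pointAt _ _ _ _ _).trans (pointAt_eq _ _ _ _ _ _)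

lemma exists_hasCoords_of_le_std {κ : k →+* R} {f : Spec R ⟶ PSpace k n}
    (hf : f ≫ PSpace.toSpec k n = Spec.map (CommRingCat.ofHom κ)) {b : Fin (n + 1)}
    (hb : ⊤ ≤ f ⁻¹ᵁ PSpace.std k n b) : ∃ ξ, ξ b = 1 ∧ HasCoords κ f ξ := by
  obtain ⟨ξ, h, rfl⟩ := exists_pointAt κ f hf b hb
  exact ⟨ξ, h, hasCoords_pointAt _ _ _ _⟩

lemma exists_hasCoords_of_isLocalRing [IsLocalRing R] {κ : k →+* R} {f : Spec R ⟶ PSpace k n}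
    (hf : f ≫ PSpace.toSpec k n = Spec.map (CommRingCat.ofHom κ)) :
    ∃ ξ b, ξ b = 1 ∧ HasCoords κ f ξ := by
  obtain ⟨b, hb⟩ := exists_mem_std (f (IsLocalRing.closedPoint R))
  obtain ⟨ξ, h, h'⟩ := exists_hasCoords_of_le_std hf (b := b)
    fun p _ => range_subset_of_closedPoint_mem f hb ⟨p, rfl⟩
  exact ⟨ξ, b, h, h'⟩

namespace HasCoords

variable {κ : k →+* R} {f g : Spec R ⟶ PSpace k n} {ξ ζ : Fin (n + 1) → R}

/-- Both tuples compute the same pulled back functions `x_a / x_c` over local rings, hence are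
proportional. -/
lemma cross (h : HasCoords κ f ξ) (h' : HasCoords κ f ζ) (a b : Fin (n + 1)) :
    ξ a * ζ b = ξ b * ζ a := by
  refine eq_of_forall_local fun S φ _ => ?_
  obtain ⟨c, hc⟩ := exists_isUnit_of_span_eq_top (h.comp φ).span_eq_top
  have h1 := fun a => (h.comp φ).pullSection_frac a c ((h.comp φ).le_std hc)
  have h2 := fun a => (h'.comp φ).pullSection_frac a c ((h.comp φ).le_std hc)
  simp only [map_mul]
  rw [← h1 a, ← h1 b, ← h2 a, ← h2 b]
  ring

end HasCoords

end Coordinates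

/-! ### Quasi-compactness of the charts of the cube -/

section QuasiCompact

lemma isAffineHom_ι_of_isAffineOpen {Y : Scheme.{u}} [Y.IsSeparated] {U : Y.Opens}
    (hU : IsAffineOpen U) : IsAffineHom U.ι := by
  have : IsAffine U := hU
  have : IsAffineHom (U.ι ≫ terminal.from Y) := inferInstance
  exact IsAffineHom.of_comp _ (terminal.from Y)

lemma isAffineOpen_preimage_inf {X Y : Scheme.{u}} [Y.IsSeparated] (f : X ⟶ Y) {U : Y.Opens}
    (hU : IsAffineOpen U) {V : X.Opens} (hV : IsAffineOpen V) : IsAffineOpen (V ⊓ f ⁻¹ᵁ U) := by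
  have := isAffineHom_ι_of_isAffineOpen hU
  have h : IsAffineHom (f ⁻¹ᵁ U).ι :=
    MorphismProperty.of_isPullback (isPullback_morphismRestrict f U) this
  have h1 := (hV.preimage (f ⁻¹ᵁ U).ι).image_of_isOpenImmersion (f ⁻¹ᵁ U).ι
  rw [Scheme.Hom.image_preimage_eq_opensRange_inf, Scheme.Opens.opensRange_ι, inf_comm] at h1
  exact h1

lemma quasiCompact_ι {X : Scheme.{u}} {U : X.Opens}
    (h : ∀ V : X.Opens, IsAffineOpen V → IsAffineOpen (V ⊓ U)) : QuasiCompact U.ι := by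
  rw [quasiCompact_iff_forall_isAffineOpen]
  intro V hV
  have h1 := (h V hV).isCompact
  rw [U.ι.isOpenEmbedding.isCompact_iff]
  convert h1 using 1
  change (U.ι ''ᵁ U.ι ⁻¹ᵁ V : Set X) = (V ⊓ U : X.Opens)
  rw [Scheme.Hom.image_preimage_eq_opensRange_inf, Scheme.Opens.opensRange_ι, inf_comm]

/-- A chart is an intersection of three preimages of affine opens of the separated scheme `ℙ¹`, so
it meets affine opens in affine opens. Quasi-compactness is what allows the ideals in
`Cube.zeroScheme`, pushed forward from the charts, to be read off as kernels on sections. -/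
instance {k : Type u} [Field k] (v : Fin 3 → Fin 2) : QuasiCompact (Cube.chart k v).ι := by
  refine quasiCompact_ι fun V hV => ?_
  have : V ⊓ Cube.chart k v = ((V ⊓ Cube.proj k 0 ⁻¹ᵁ PSpace.std k 1 (v 0)) ⊓
      Cube.proj k 1 ⁻¹ᵁ PSpace.std k 1 (v 1)) ⊓ Cube.proj k 2 ⁻¹ᵁ PSpace.std k 1 (v 2) := by
    rw [Cube.chart, inf_assoc, inf_assoc]
    congr 1
    apply le_antisymm
    · exact le_inf (iInf_le _ 0) (le_inf (iInf_le _ 1) (iInf_le _ 2))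
    · refine le_iInf fun i => ?_
      fin_cases i
      exacts [inf_le_left, inf_le_right.trans inf_le_left, inf_le_right.trans inf_le_right]
  rw [this]
  exact isAffineOpen_preimage_inf _ (isAffineOpen_std _)
    (isAffineOpen_preimage_inf _ (isAffineOpen_std _)
      (isAffineOpen_preimage_inf _ (isAffineOpen_std _) hV))

end QuasiCompact

lemma idealAlong_ofIdealTop {Y : Scheme.{u}} {R : CommRingCat.{u}} (g : Spec R ⟶ Y)
    (I : Ideal Γ(Y, ⊤)) :
    idealAlong g (Scheme.IdealSheafData.ofIdealTop I) = I.map (pullSection g ⊤ le_top).hom := by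
  refine idealAlong_eq_of_local _ _ _ fun S φ _ => ?_
  obtain ⟨U, ψ, hψ⟩ := exists_affine_factor (Spec.map φ ≫ g)
  have hU : ⊤ ≤ (Spec.map φ ≫ g) ⁻¹ᵁ U.1 := by
    rw [hψ]
    exact fun x _ => U.2.range_fromSpec.le ⟨_, rfl⟩
  rw [idealAlong_of_range _ U.2 hU, Scheme.IdealSheafData.ofIdealTop_ideal, Ideal.map_map,
    Ideal.map_map, ← CommRingCat.hom_comp, ← CommRingCat.hom_comp,
    ← pullSection_SpecMap g φ ⊤ le_top le_top]
  congr 2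
  exact pullSection_res _ hU le_top le_top

lemma idealAlong_subschemeι {Y : Scheme.{u}} {R : CommRingCat.{u}} (I : Y.IdealSheafData)
    (g : Spec R ⟶ I.subscheme) : idealAlong (g ≫ I.subschemeι) I = ⊥ := by
  rw [← le_ker_iff_idealAlong_eq_bot]
  exact I.ker_subschemeι.ge.trans (Scheme.Hom.le_ker_comp _ _)

/-! ### Zero schemes of multihomogeneous polynomials -/

section ZeroScheme

variable {k : Type u} [Field k] {R S : CommRingCat.{u}}

/-- A multihomogeneous polynomial of multidegree `d`. -/
def IsMultihomogeneous (F : MvPolynomial (Fin 3 × Fin 2) k) (d : Fin 3 → ℕ) : Prop :=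
  ∀ {A : Type u} [CommRing A] (κ : k →+* A) (l : Fin 3 → A) (ξ : Fin 3 × Fin 2 → A),
    F.eval₂ κ (fun p => l p.1 * ξ p) = (∏ i, l i ^ d i) * F.eval₂ κ ξ

lemma isMultihomogeneous_boundary :
    IsMultihomogeneous (∏ p : Fin 3 × Fin 2, MvPolynomial.X p : MvPolynomial _ k) (fun _ => 2) := by
  intro A _ κ l ξ
  simp only [MvPolynomial.eval₂_prod, MvPolynomial.eval₂_X, Finset.prod_mul_distrib,
    Fintype.prod_prod_type, Finset.prod_const, Finset.card_univ, Fintype.card_fin]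

lemma isMultihomogeneous_tri (c : (Fin 3 → Fin 2) → k) :
    IsMultihomogeneous (∑ v : Fin 3 → Fin 2,
      MvPolynomial.C (c v) * ∏ i, MvPolynomial.X (i, v i)) (fun _ => 1) := by
  intro A _ κ l ξ
  simp only [MvPolynomial.eval₂_sum, MvPolynomial.eval₂_mul, MvPolynomial.eval₂_C,
    MvPolynomial.eval₂_prod, MvPolynomial.eval₂_X, Finset.prod_mul_distrib, pow_one,
    Finset.mul_sum]
  exact Finset.sum_congr rfl fun v _ => mul_left_comm _ _ _

lemma pullSection_top_eq {S : CommRingCat.{u}} {g : Spec R ⟶ Spec S} {φ : S ⟶ R}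
    (h : g = Spec.map φ) : pullSection g ⊤ le_top = (Scheme.ΓSpecIso S).hom ≫ φ := by
  subst h
  rw [← Scheme.ΓSpecIso_naturality]
  unfold pullSection
  rw [show (Spec.map φ).appTop = _ from Scheme.Hom.app_eq_appLE (Spec.map φ)]
  rfl

lemma pullSection_dehomogenize {F : MvPolynomial (Fin 3 × Fin 2) k} {d : Fin 3 → ℕ}
    (hF : IsMultihomogeneous F d) {κ : k →+* R} (g : Spec R ⟶ Cube k) {ξ : Fin 3 → Fin 2 → R}
    (hξ : ∀ i, HasCoords κ (g ≫ Cube.proj k i) (ξ i)) (v : Fin 3 → Fin 2)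
    (h : ⊤ ≤ g ⁻¹ᵁ Cube.chart k v) :
    (pullSection g (Cube.chart k v) h).hom (Cube.dehomogenize F v) * ∏ i, ξ i (v i) ^ d i =
      F.eval₂ κ (fun p => ξ p.1 p.2) := by
  have hκ : (pullSection g (Cube.chart k v) h).hom.comp (Cube.scalar k (Cube.chart k v)) = κ := by
    have h1 : g ≫ Cube.toSpec k = Spec.map (CommRingCat.ofHom κ) := by
      rw [← Cube.proj_toSpec k 0, ← Category.assoc, (hξ 0).toSpec]
    have h2 : (Scheme.ΓSpecIso (.of k)).inv ≫ (Cube.toSpec k).appTop ≫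
        (Cube k).presheaf.map (homOfLE le_top).op ≫ pullSection g (Cube.chart k v) h =
        CommRingCat.ofHom κ := by
      have h3 := pullSection_appLE g (Cube.toSpec k) (Cube.chart k v) ⊤ h le_top le_top
      unfold Scheme.Hom.appLE at h3
      rw [Category.assoc] at h3
      rw [Iso.inv_comp_eq]
      exact h3.trans (pullSection_top_eq h1)
    exact congrArg CommRingCat.Hom.hom h2
  have hcoord : ∀ i a, (pullSection g (Cube.chart k v) h).hom (Cube.coord k v i a) * ξ i (v i) =
      ξ i a := by
    intro i a
    have hle : ⊤ ≤ (g ≫ Cube.proj k i) ⁻¹ᵁ PSpace.std k 1 (v i) :=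
      fun x hx => Cube.chart_le k v i (h hx)
    rw [← (hξ i).pullSection_frac a (v i) hle,
      ← pullSection_appLE g (Cube.proj k i) _ _ h (Cube.chart_le k v i) hle]
    rfl
  rw [mul_comm, Cube.dehomogenize]
  have h1 := MvPolynomial.eval₂_comp_left (pullSection g (Cube.chart k v) h).hom
    (Cube.scalar k (Cube.chart k v)) (fun p : Fin 3 × Fin 2 => Cube.coord k v p.1 p.2) F
  rw [h1, hκ, ← hF κ (fun i => ξ i (v i))]
  congr 1
  funext p
  rw [mul_comm]
  exact hcoord p.1 p.2

lemma exists_chart (x : Cube k) : ∃ v, x ∈ Cube.chart k v := by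
  choose v hv using fun i => exists_mem_std (Cube.proj k i x)
  refine ⟨v, ?_⟩
  rw [Cube.chart, ← SetLike.mem_coe, Opens.coe_iInf]
  exact Set.mem_iInter.2 hv

lemma prod_isUnit_of_le_chart {κ : k →+* R} {g : Spec R ⟶ Cube k} {ξ : Fin 3 → Fin 2 → R}
    (hξ : ∀ i, HasCoords κ (g ≫ Cube.proj k i) (ξ i)) (v : Fin 3 → Fin 2) (d : Fin 3 → ℕ)
    (h : ⊤ ≤ g ⁻¹ᵁ Cube.chart k v) : IsUnit (∏ i, ξ i (v i) ^ d i) :=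
  (Finset.prod_induction _ IsUnit (fun _ _ => IsUnit.mul) isUnit_one) fun i _ =>
    ((hξ i).isUnit_of_le_std fun _ hx => Cube.chart_le k v i (h hx)).pow _

lemma idealAlong_chart (F : MvPolynomial (Fin 3 × Fin 2) k) (v : Fin 3 → Fin 2)
    (g : Spec R ⟶ (Cube.chart k v).toScheme) (h : ⊤ ≤ (g ≫ (Cube.chart k v).ι) ⁻¹ᵁ Cube.chart k v) :
    idealAlong g (Scheme.IdealSheafData.ofIdealTop
      (Ideal.span {(Cube.chart k v).topIso.inv.hom (Cube.dehomogenize F v)})) =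
    Ideal.span {(pullSection (g ≫ (Cube.chart k v).ι) (Cube.chart k v) h).hom
      (Cube.dehomogenize F v)} := by
  rw [idealAlong_ofIdealTop, Ideal.map_span, Set.image_singleton]
  have h1 := pullSection_appLE g (Cube.chart k v).ι ⊤ (Cube.chart k v) le_top (by simp) h
  have h2 : (Cube.chart k v).ι.appLE (Cube.chart k v) ⊤ (by simp) =
      (Cube.chart k v).topIso.inv := by simp; rfl
  rw [h2] at h1
  rw [← h1]
  rfl

/-- On a chart, the value of `F` at the coordinates is its dehomogenization times a unit. One
direction needs the dehomogenization on one chart to be a section of the whole infimum defining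
`Cube.zeroScheme`; the other needs only the member of the infimum belonging to a chart that contains
the point. -/
lemma zeroScheme_le_ker_iff {F : MvPolynomial (Fin 3 × Fin 2) k} {d : Fin 3 → ℕ}
    (hF : IsMultihomogeneous F d) {κ : k →+* R} (g : Spec R ⟶ Cube k) {ξ : Fin 3 → Fin 2 → R}
    (hξ : ∀ i, HasCoords κ (g ≫ Cube.proj k i) (ξ i)) :
    Cube.zeroScheme F ≤ g.ker ↔ F.eval₂ κ (fun p => ξ p.1 p.2) = 0 := by
  have hev : ∀ {S : CommRingCat.{u}} (φ : R ⟶ S), φ.hom (F.eval₂ κ (fun p => ξ p.1 p.2)) =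
      F.eval₂ (φ.hom.comp κ) (fun p => φ.hom (ξ p.1 p.2)) := fun φ =>
    MvPolynomial.eval₂_comp_left φ.hom κ (fun p : Fin 3 × Fin 2 => ξ p.1 p.2) F
  have hξ' : ∀ {S : CommRingCat.{u}} (φ : R ⟶ S) (i : Fin 3),
      HasCoords (φ.hom.comp κ) ((Spec.map φ ≫ g) ≫ Cube.proj k i) (fun a => φ.hom (ξ i a)) := by
    intro S φ i
    rw [Category.assoc]
    exact (hξ i).comp φ
  constructor
  · intro hle
    refine eq_of_forall_local fun S φ _ => ?_
    rw [map_zero, hev]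
    obtain ⟨w, hw⟩ := exists_chart ((Spec.map φ ≫ g) (IsLocalRing.closedPoint S))
    obtain ⟨U, hU, hxU, hUw'⟩ := exists_isAffineOpen_mem_and_subset hw
    have hUw : U ≤ Cube.chart k w := hUw'
    have hgU : ⊤ ≤ (Spec.map φ ≫ g) ⁻¹ᵁ U := fun p _ =>
      range_subset_of_closedPoint_mem _ hxU ⟨p, rfl⟩
    have hgw : ⊤ ≤ (Spec.map φ ≫ g) ⁻¹ᵁ Cube.chart k w := fun p hp => hUw (hgU hp)
    -- On the subscheme cut out in the chart of `v`, over `U`, the dehomogenizations at `v` and at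
    -- `w` agree up to units with the same value of `F`. The first vanishes there, hence so does the
    -- second.
    have hmem : ((Cube k).presheaf.map (homOfLE hUw).op).hom (Cube.dehomogenize F w) ∈
        (Cube.zeroScheme F).ideal ⟨U, hU⟩ := by
      rw [Cube.zeroScheme, Scheme.IdealSheafData.ideal_iInf, iInf_apply, Submodule.mem_iInf]
      intro v
      rw [Scheme.IdealSheafData.map, Scheme.Hom.ker_apply, RingHom.mem_ker]
      set J := Scheme.IdealSheafData.ofIdealTop
        (Ideal.span {(Cube.chart k v).topIso.inv.hom (Cube.dehomogenize F v)}) with hJ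
      set f : J.subscheme ⟶ Cube k := J.subschemeι ≫ (Cube.chart k v).ι
      refine section_ext_pullSection fun T h hh _ => ?_
      have hU' : ⊤ ≤ (h ≫ f) ⁻¹ᵁ U := hh
      have hw' : ⊤ ≤ (h ≫ f) ⁻¹ᵁ Cube.chart k w := fun p hp => hUw (hU' hp)
      have hv' : ⊤ ≤ (h ≫ f) ⁻¹ᵁ Cube.chart k v := fun p _ => (J.subschemeι (h p)).2
      have e1 : (Cube k).presheaf.map (homOfLE hUw).op ≫ f.app U ≫ pullSection h (f ⁻¹ᵁ U) hh =
          pullSection (h ≫ f) (Cube.chart k w) hw' := by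
        rw [Scheme.Hom.app_eq_appLE, pullSection_appLE h f (f ⁻¹ᵁ U) U hh le_rfl hU',
          pullSection_res (h ≫ f) hU' hUw hw']
      have e2 := congr(($e1).hom (Cube.dehomogenize F w))
      rw [map_zero]
      refine Eq.trans e2 ?_
      obtain ⟨κ', hκ'⟩ : ∃ κ' : CommRingCat.of k ⟶ T, (h ≫ f) ≫ Cube.toSpec k = Spec.map κ' :=
        ⟨Spec.preimage _, (Spec.map_preimage _).symm⟩
      choose ζ _ _ hζ using fun i => exists_hasCoords_of_isLocalRing (κ := κ'.hom)
        (f := (h ≫ f) ≫ Cube.proj k i) (by rw [Category.assoc, Cube.proj_toSpec, hκ']; rfl)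
      have h3 := pullSection_dehomogenize hF (h ≫ f) hζ w hw'
      have h4 := pullSection_dehomogenize hF (h ≫ f) hζ v hv'
      have h5 := idealAlong_chart F v (h ≫ J.subschemeι) hv'
      rw [← hJ, idealAlong_subschemeι, eq_comm, Ideal.span_singleton_eq_bot] at h5
      have h6 : (pullSection (h ≫ f) (Cube.chart k v) hv').hom (Cube.dehomogenize F v) = 0 := h5
      rw [h6, zero_mul] at h4
      rw [← h4, (prod_isUnit_of_le_chart hζ w d hw').mul_left_eq_zero] at h3
      exact h3
    have h7 : idealAlong (Spec.map φ ≫ g) (Cube.zeroScheme F) = ⊥ := by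
      rw [idealAlong_comp, (le_ker_iff_idealAlong_eq_bot _ _).1 hle, Ideal.map_bot]
    rw [idealAlong_of_range _ hU hgU] at h7
    have h8 := Ideal.mem_map_of_mem (pullSection (Spec.map φ ≫ g) U hgU).hom hmem
    rw [h7, Ideal.mem_bot] at h8
    have h9 := congr(($(pullSection_res (Spec.map φ ≫ g) hgU hUw hgw)).hom
      (Cube.dehomogenize F w))
    have h10 : (pullSection (Spec.map φ ≫ g) (Cube.chart k w) hgw).hom
        (Cube.dehomogenize F w) = 0 := h9.symm.trans h8
    rw [← pullSection_dehomogenize hF (Spec.map φ ≫ g) (hξ' φ) w hgw, h10, zero_mul]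
  · intro h0
    rw [le_ker_iff_idealAlong_eq_bot]
    refine idealAlong_eq_of_local _ _ _ fun S φ _ => ?_
    rw [Ideal.map_bot, ← le_ker_iff_idealAlong_eq_bot]
    obtain ⟨w, hw⟩ := exists_chart ((Spec.map φ ≫ g) (IsLocalRing.closedPoint S))
    have hgw : ⊤ ≤ (Spec.map φ ≫ g) ⁻¹ᵁ Cube.chart k w := fun p _ =>
      range_subset_of_closedPoint_mem _ hw ⟨p, rfl⟩
    have h1 := pullSection_dehomogenize hF (Spec.map φ ≫ g) (hξ' φ) w hgw
    rw [← hev φ, h0, map_zero, (prod_isUnit_of_le_chart (hξ' φ) w d hgw).mul_left_eq_zero] at h1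
    obtain ⟨g', hg'⟩ : ∃ g' : Spec S ⟶ (Cube.chart k w).toScheme,
        g' ≫ (Cube.chart k w).ι = Spec.map φ ≫ g :=
      ⟨IsOpenImmersion.lift (Cube.chart k w).ι (Spec.map φ ≫ g) (by
        rw [Scheme.Opens.range_ι]; rintro _ ⟨x, rfl⟩; exact hgw trivial),
        IsOpenImmersion.lift_fac _ _ _⟩
    refine (iInf_le _ w).trans ?_
    simp only [← hg'] at hgw h1 ⊢
    rw [← Scheme.IdealSheafData.map_ker]
    refine Scheme.IdealSheafData.map_mono _ ?_
    rw [le_ker_iff_idealAlong_eq_bot, idealAlong_chart F w g' hgw, h1, Ideal.span_singleton_eq_bot]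

/-- The pullback of `V(F) ⊂ (ℙ¹)³` is cut out by the value of `F` at the coordinates. -/
theorem idealAlong_zeroScheme {F : MvPolynomial (Fin 3 × Fin 2) k} {d : Fin 3 → ℕ}
    (hF : IsMultihomogeneous F d) {κ : k →+* R} (g : Spec R ⟶ Cube k) {ξ : Fin 3 → Fin 2 → R}
    (hξ : ∀ i, HasCoords κ (g ≫ Cube.proj k i) (ξ i)) :
    idealAlong g (Cube.zeroScheme F) = Ideal.span {F.eval₂ κ (fun p => ξ p.1 p.2)} := by
  refine ideal_eq_of_le_ker_iff fun S φ => ?_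
  rw [idealAlong_le_ker_iff, Ideal.span_singleton_le_iff_mem, RingHom.mem_ker]
  have h1 := MvPolynomial.eval₂_comp_left φ.hom κ (fun p : Fin 3 × Fin 2 => ξ p.1 p.2) F
  rw [h1]
  refine zeroScheme_le_ker_iff hF (Spec.map φ ≫ g) (ξ := fun i a => φ.hom (ξ i a)) fun i => ?_
  rw [Category.assoc]
  exact (hξ i).comp φ

end ZeroScheme

/-! ### Vanishing ideals on the standard charts of projective space -/

section Away

open MvPolynomial HomogeneousLocalization

variable {k : Type u} [Field k] {n : ℕ} {R S : CommRingCat.{u}}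

variable (k) in
/-- The coordinate ring of the standard chart `{x_b ≠ 0}` of `ℙⁿ`. -/
abbrev chartRing (n : ℕ) (b : Fin (n + 1)) : CommRingCat.{u} :=
  .of (Away (grading k n) (X b : MvPolynomial (Fin (n + 1)) k))

/-- The scalars in the coordinate ring of a standard chart. -/
def chartScalar (b : Fin (n + 1)) : k →+* chartRing k n b :=
  (fromZeroRingHom (grading k n) _).comp (algebraMap k (grading k n 0))

/-- The coordinates on a standard chart. -/
def chartCoord (b a : Fin (n + 1)) : chartRing k n b :=
  Away.mk (grading k n) (X_mem b) 1 (X a) (by simpa using X_mem a)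

variable (k) in
/-- The inclusion of a standard chart. -/
abbrev chartι (b : Fin (n + 1)) : Spec (chartRing k n b) ⟶ PSpace k n :=
  Proj.awayι (grading k n) (X b) (X_mem b) one_pos

lemma chartCoord_self (b : Fin (n + 1)) : chartCoord (k := k) b b = 1 := by
  ext
  unfold chartCoord
  rw [Away.val_mk, val_one]
  exact (Localization.mk_eq_mk_iff.mpr (Localization.r_of_eq (by simp))).trans
    Localization.mk_one

lemma mk_eq_eval₂ (b : Fin (n + 1)) (m : ℕ) (p : MvPolynomial (Fin (n + 1)) k)
    (hp : p ∈ grading k n (m • 1)) :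
    Away.mk (grading k n) (X_mem b) m p hp = p.eval₂ (chartScalar b) (chartCoord b) := by
  refine away_mk_eq_eval₂ (R := chartRing k n b) b m p hp (RingHom.id _) _ fun r => ?_
  change Away.mk (grading k n) (X_mem b) 0 (C r) _ =
    fromZeroRingHom (grading k n) _ (algebraMap k _ r)
  ext
  simp only [Away.val_mk, pow_zero]
  rfl

lemma eval₂_chartCoord_surjective (b : Fin (n + 1)) (x : chartRing k n b) :
    ∃ p : MvPolynomial (Fin (n + 1)) k, p.eval₂ (chartScalar b) (chartCoord b) = x := by
  obtain ⟨m, p, hp, rfl⟩ := Away.mk_surjective (grading k n) (X_mem b) x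
  exact ⟨p, (mk_eq_eval₂ b m p hp).symm⟩

lemma hasCoords_chartι (b : Fin (n + 1)) :
    HasCoords (chartScalar b) (chartι k b) (chartCoord b) := by
  have hu : IsUnit (chartCoord (k := k) b b) := chartCoord_self (k := k) b ▸ isUnit_one
  have h : pointAt (chartScalar b) (chartCoord b) b hu = chartι k b := by
    unfold pointAt pointOf
    rw [← evalAway_unique (R := chartRing k n b) (chartScalar b) (chartCoord b) (X b)
      (by rwa [eval₂_X]) (X_mem b) (RingHom.id _) fun m p hp => ?_]
    · exact (congrArg (· ≫ _) (Spec.map_id _)).trans (Category.id_comp _)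
    · rw [eval₂_X, chartCoord_self, one_pow, mul_one]
      exact mk_eq_eval₂ b m p hp
  rw [← h]
  exact hasCoords_pointAt _ _ _ _

lemma HasCoords.exists_eq_chartι {κ : k →+* R} {f : Spec R ⟶ PSpace k n} {ξ : Fin (n + 1) → R}
    (h : HasCoords κ f ξ) {b : Fin (n + 1)} (hb : IsUnit (ξ b)) :
    ∃ φ : chartRing k n b ⟶ R, f = Spec.map φ ≫ chartι k b ∧
      φ.hom.comp (chartScalar b) = κ ∧ ∀ a, φ.hom (chartCoord b a) * ξ b = ξ a := by
  have hu : IsUnit ((X b : MvPolynomial _ k).eval₂ κ ξ) := by rwa [eval₂_X]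
  refine ⟨CommRingCat.ofHom (evalAway κ ξ (X b) hu), h.eq_pointAt b hb, ?_, fun a => ?_⟩
  · ext r
    have h1 := evalAway_mk_X κ ξ b hu 0 (C r) (by simp)
    rw [pow_zero, mul_one, eval₂_C] at h1
    refine Eq.trans ?_ h1
    change evalAway κ ξ _ hu (fromZeroRingHom (grading k n) _ (algebraMap k _ r)) = _
    congr 1
  · have h1 := evalAway_mk_X κ ξ b hu 1 (X a) (by simpa using X_mem a)
    rw [pow_one (ξ b), eval₂_X κ ξ a] at h1
    exact h1

lemma isIso_pullSection_chartι (b : Fin (n + 1)) :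
    IsIso (pullSection (chartι k b) (PSpace.std k n b) (le_awayι_preimage _ _ _)) := by
  have h := awayToSection_pullSection (X b : MvPolynomial (Fin (n + 1)) k) (X_mem b) one_pos
    (le_awayι_preimage _ _ _)
  have : IsIso (Proj.awayToSection (grading k n) (X b)) := by
    rw [← Proj.basicOpenIsoAway_hom (grading k n) (X b) (X_mem b) one_pos]
    infer_instance
  have h2 : IsIso (Proj.awayToSection (grading k n) (X b) ≫
      pullSection (chartι k b) (PSpace.std k n b) (le_awayι_preimage _ _ _)) := by
    refine (congrArg IsIso h).mpr ?_
    infer_instance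
  exact IsIso.of_isIso_comp_left (Proj.awayToSection (grading k n) (X b)) _

lemma map_eq_comap_inv {R S : CommRingCat.{u}} (f : R ⟶ S) [IsIso f] (I : Ideal R) :
    I.map f.hom = I.comap (inv f).hom := by
  apply le_antisymm
  · rw [Ideal.map_le_iff_le_comap]
    intro x hx
    have : (inv f).hom (f.hom x) = x := congr($(IsIso.hom_inv_id f) x)
    rwa [Ideal.mem_comap, Ideal.mem_comap, this]
  · intro x hx
    have : f.hom ((inv f).hom x) = x := congr($(IsIso.inv_hom_id f) x)
    rw [← this]
    exact Ideal.mem_map_of_mem _ hx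

lemma isRadical_idealAlong_chartι (b : Fin (n + 1)) (Z : Closeds (PSpace k n)) :
    (idealAlong (chartι k b) (Scheme.IdealSheafData.vanishingIdeal Z)).IsRadical := by
  have := isIso_pullSection_chartι (k := k) b
  rw [idealAlong_of_range (chartι k b) (isAffineOpen_std b) (le_awayι_preimage _ _ _),
    map_eq_comap_inv]
  refine Ideal.IsRadical.comap _ ?_
  rw [Scheme.IdealSheafData.vanishingIdeal_ideal]
  exact PrimeSpectrum.isRadical_vanishingIdeal _

/-- Both ideals are radical and lie in the same primes. -/
lemma idealAlong_chartι_vanishingIdeal (b : Fin (n + 1)) (Z : Closeds (PSpace k n))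
    (I : Ideal (chartRing k n b)) (hI : I.IsRadical)
    (h : ∀ q, chartι k b q ∈ Z ↔ I ≤ q.asIdeal) :
    idealAlong (chartι k b) (Scheme.IdealSheafData.vanishingIdeal Z) = I := by
  have h1 := isRadical_idealAlong_chartι b Z
  have h2 : ∀ q : Spec (chartRing k n b),
      idealAlong (chartι k b) (Scheme.IdealSheafData.vanishingIdeal Z) ≤ q.asIdeal ↔
        I ≤ q.asIdeal := by
    intro q
    rw [← h q, ← mem_support_iff_idealAlong_le, ← SetLike.mem_coe,
      Scheme.IdealSheafData.coe_support_vanishingIdeal]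
    rfl
  rw [← h1.radical, ← hI.radical, Ideal.radical_eq_sInf, Ideal.radical_eq_sInf]
  congr 1
  ext J
  constructor
  · rintro ⟨h3, hJ⟩
    exact ⟨(h2 ⟨J, hJ⟩).1 h3, hJ⟩
  · rintro ⟨h3, hJ⟩
    exact ⟨(h2 ⟨J, hJ⟩).2 h3, hJ⟩

/-- The quotient is zero or a copy of the field. This is how the ideals of rational points, and of
the empty set, are seen to be radical. -/
lemma eq_top_or_isMaximal_of_forall_exists_sub_mem {κ : Type*} [Field κ] {A : Type*} [CommRing A]
    (c : κ →+* A) (I : Ideal A) (h : ∀ x, ∃ r, x - c r ∈ I) : I = ⊤ ∨ I.IsMaximal := by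
  by_cases hI : I = ⊤
  · exact Or.inl hI
  refine Or.inr ?_
  have : Nontrivial (A ⧸ I) := Ideal.Quotient.nontrivial_iff.2 hI
  refine Ideal.Quotient.maximal_of_isField _ (IsField.mk ?_ mul_comm ?_)
  · exact exists_pair_ne _
  · intro x hx
    obtain ⟨x, rfl⟩ := Ideal.Quotient.mk_surjective x
    obtain ⟨r, hr⟩ := h x
    have h1 : Ideal.Quotient.mk I x = Ideal.Quotient.mk I (c r) := Ideal.Quotient.eq.2 hr
    refine ⟨Ideal.Quotient.mk I (c r⁻¹), ?_⟩
    have hr0 : r ≠ 0 := by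
      rintro rfl
      rw [map_zero, map_zero] at h1
      exact hx h1
    rw [h1, ← map_mul, ← map_mul, mul_inv_cancel₀ hr0, map_one, map_one]

lemma eq_top_or_isMaximal_of_chartCoord_sub_mem (b : Fin (n + 1)) (I : Ideal (chartRing k n b))
    (h : ∀ a, ∃ r, chartCoord b a - chartScalar b r ∈ I) : I = ⊤ ∨ I.IsMaximal := by
  refine eq_top_or_isMaximal_of_forall_exists_sub_mem (chartScalar b) I fun x => ?_
  obtain ⟨p, rfl⟩ := eval₂_chartCoord_surjective b x
  choose α hα using h
  refine ⟨p.eval α, ?_⟩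
  rw [← Ideal.Quotient.eq]
  have h1 := MvPolynomial.eval₂_comp_left (Ideal.Quotient.mk I) (chartScalar b) (chartCoord b) p
  have h2 := MvPolynomial.eval₂_comp_left ((Ideal.Quotient.mk I).comp (chartScalar b))
    (RingHom.id k) α p
  refine h1.trans (Eq.trans ?_ h2.symm)
  rw [RingHom.comp_id]
  congr 1
  funext a
  exact Ideal.Quotient.eq.2 (hα a)

lemma isRadical_of_chartCoord_sub_mem (b : Fin (n + 1)) (I : Ideal (chartRing k n b))
    (h : ∀ a, ∃ r, chartCoord b a - chartScalar b r ∈ I) : I.IsRadical := by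
  rcases eq_top_or_isMaximal_of_chartCoord_sub_mem b I h with h1 | h1
  · rw [h1]; exact fun x _ => trivial
  · exact h1.isPrime.isRadical

/-- Ideals of closed subsets of `ℙⁿ` along a morphism can be computed on the charts. -/
lemma idealAlong_vanishingIdeal {Z : Closeds (PSpace k n)} {ι : Type*}
    (F : ι → MvPolynomial (Fin (n + 1)) k) {d : ι → ℕ} (hF : ∀ i, F i ∈ grading k n (d i))
    (hrad : ∀ b, (Ideal.span (Set.range fun i =>
      (F i).eval₂ (chartScalar b) (chartCoord b))).IsRadical)
    (hZ : ∀ b (q : Spec (chartRing k n b)), chartι k b q ∈ Z ↔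
      ∀ i, (F i).eval₂ (chartScalar b) (chartCoord b) ∈ q.asIdeal)
    {κ : k →+* R} {f : Spec R ⟶ PSpace k n} {ξ : Fin (n + 1) → R} (h : HasCoords κ f ξ) :
    idealAlong f (Scheme.IdealSheafData.vanishingIdeal Z) =
      Ideal.span (Set.range fun i => (F i).eval₂ κ ξ) := by
  refine idealAlong_eq_of_local _ _ _ fun S φ _ => ?_
  have h' := h.comp φ
  obtain ⟨b, hb⟩ := exists_isUnit_of_span_eq_top h'.span_eq_top
  obtain ⟨ψ, hψ, hκ, hψ'⟩ := h'.exists_eq_chartι hb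
  rw [hψ, idealAlong_comp, idealAlong_chartι_vanishingIdeal b Z _ (hrad b) fun q => ?_,
    Ideal.map_span, Ideal.map_span, ← Set.range_comp, ← Set.range_comp]
  · have key : ∀ i, φ.hom ((F i).eval₂ κ ξ) =
        φ.hom (ξ b) ^ d i * ψ.hom ((F i).eval₂ (chartScalar b) (chartCoord b)) := by
      intro i
      have e1 := MvPolynomial.eval₂_comp_left φ.hom κ ξ (F i)
      have e2 := MvPolynomial.eval₂_comp_left ψ.hom (chartScalar b) (chartCoord b) (F i)
      rw [e1, e2, hκ, ← eval₂_smul_of_isHomogeneous (hF i)]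
      congr 1
      funext a
      rw [Function.comp_apply, ← hψ', mul_comm]
      rfl
    apply le_antisymm <;> rw [Ideal.span_le] <;> rintro _ ⟨i, rfl⟩
    · have h1 : φ.hom ((F i).eval₂ κ ξ) ∈ Ideal.span
          (Set.range (φ.hom ∘ fun i => (F i).eval₂ κ ξ)) := Ideal.subset_span ⟨i, rfl⟩
      rw [key] at h1
      exact (Ideal.unit_mul_mem_iff_mem _ (hb.pow _)).1 h1
    · change φ.hom ((F i).eval₂ κ ξ) ∈ _
      rw [key]
      exact Ideal.mul_mem_left _ _ (Ideal.subset_span ⟨i, rfl⟩)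
  · rw [hZ, Ideal.span_le]
    exact ⟨fun hq => by rintro _ ⟨i, rfl⟩; exact hq i, fun hq i => hq ⟨i, rfl⟩⟩

end Away

/-! ### Closed points of the projective line and linear forms -/

section ClosedPoint

open MvPolynomial

variable {k : Type u} [Field k] {R : CommRingCat.{u}}

lemma exists_chartCoord_sub_mem [IsAlgClosed k] (b : Fin 2) (m : Ideal (chartRing k 1 b))
    [hm : m.IsMaximal] :
    ∃ α : Fin 2 → k, ∀ a, chartCoord b a - chartScalar b (α a) ∈ m := by
  let ev : MvPolynomial (Fin 2) k →+* chartRing k 1 b := eval₂Hom (chartScalar b) (chartCoord b)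
  have hs : Function.Surjective ev := eval₂_chartCoord_surjective b
  have hm' := Ideal.comap_isMaximal_of_surjective ev hs (K := m)
  obtain ⟨α, hα⟩ := isMaximal_iff_eq_vanishingIdeal_singleton.1 hm'
  refine ⟨α, fun a => ?_⟩
  have h1 : (X a - C (α a) : MvPolynomial (Fin 2) k) ∈ m.comap ev := by
    rw [hα, mem_vanishingIdeal_singleton_iff]
    simp
  simpa [ev] using h1

/-- The linear form `l₀ X₀ + l₁ X₁`. -/
def linearForm (l : Fin 2 → k) : MvPolynomial (Fin 2) k := C (l 0) * X 0 + C (l 1) * X 1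

lemma linearForm_mem (l : Fin 2 → k) : linearForm l ∈ grading k 1 1 := by
  refine add_mem ?_ ?_
  all_goals simpa using (isHomogeneous_C (Fin 2) _).mul (isHomogeneous_X k _)

lemma eval₂_linearForm {A : Type*} [CommRing A] (κ : k →+* A) (l : Fin 2 → k) (ξ : Fin 2 → A) :
    (linearForm l).eval₂ κ ξ = κ (l 0) * ξ 0 + κ (l 1) * ξ 1 := by
  simp [linearForm]

/-- On a chart of `ℙ¹` the form either is a nonzero constant, and the ideal is everything, or can be
solved for the other coordinate. -/
lemma exists_sub_mem_span_linearForm {l : Fin 2 → k} (hl : l ≠ 0) (b a : Fin 2) :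
    ∃ r, chartCoord b a - chartScalar b r ∈
      Ideal.span {(linearForm l).eval₂ (chartScalar b) (chartCoord b)} := by
  by_cases hab : a = b
  · subst hab
    exact ⟨1, by rw [chartCoord_self, map_one, sub_self]; exact zero_mem _⟩
  have hL : (linearForm l).eval₂ (chartScalar b) (chartCoord b) =
      chartScalar b (l a) * chartCoord b a + chartScalar b (l b) := by
    rw [eval₂_linearForm]
    have hb := chartCoord_self (k := k) b
    fin_cases a <;> fin_cases b <;> simp_all [add_comm]
  rw [hL]
  by_cases ha : l a = 0
  · have hb : l b ≠ 0 := by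
      intro hb
      refine hl (funext fun c => ?_)
      fin_cases a <;> fin_cases b <;> fin_cases c <;> simp_all
    refine ⟨0, ?_⟩
    rw [ha, map_zero, zero_mul, zero_add, Ideal.span_singleton_eq_top.2
      ((isUnit_iff_ne_zero.2 hb).map _)]
    trivial
  · refine ⟨-(l a)⁻¹ * l b, Ideal.mem_span_singleton'.2 ⟨chartScalar b (l a)⁻¹, ?_⟩⟩
    rw [mul_add, ← mul_assoc, ← map_mul, inv_mul_cancel₀ ha, map_one, one_mul, neg_mul, map_neg,
      sub_neg_eq_add, map_mul]

lemma eval₂_linearForm_comp {A B : Type*} [CommRing A] [CommRing B] (φ : A →+* B) (κ : k →+* A)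
    (l : Fin 2 → k) (ξ : Fin 2 → A) : φ ((linearForm l).eval₂ κ ξ) =
      (linearForm l).eval₂ (φ.comp κ) (fun a => φ (ξ a)) :=
  MvPolynomial.eval₂_comp_left φ κ ξ _

lemma mem_of_mul_add_neg_one_mul_mem {A : Type*} [CommRing A] {I : Ideal A} {x y c : A}
    (hx : x ∈ I) (h : c * x + -1 * y ∈ I) : y ∈ I := by
  have := sub_mem (I.mul_mem_left c hx) h
  rwa [show c * x - (c * x + -1 * y) = y by ring] at this

/-- A closed point of the projective line is the zero scheme of a linear form. -/
theorem exists_linearForm [IsAlgClosed k] (p : closedPoints (PSpace k 1)) : ∃ l : Fin 2 → k, l ≠ 0 ∧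
    ∀ {R : CommRingCat.{u}} {κ : k →+* R} {f : Spec R ⟶ PSpace k 1} {ξ : Fin 2 → R},
      HasCoords κ f ξ →
      idealAlong f (Scheme.IdealSheafData.vanishingIdeal ⟨{p.1}, p.2⟩) =
        Ideal.span {κ (l 0) * ξ 0 + κ (l 1) * ξ 1} := by
  obtain ⟨b, hb⟩ := exists_mem_std p.1
  obtain ⟨q, hq⟩ : ∃ q, chartι k b q = p.1 := by
    have : p.1 ∈ (chartι k b).opensRange := by rwa [Proj.opensRange_awayι]
    exact this
  have hmax : q.asIdeal.IsMaximal := by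
    refine (PrimeSpectrum.isClosed_singleton_iff_isMaximal (R := chartRing k 1 b) q).1 ?_
    have : ({q} : Set (Spec (chartRing k 1 b))) = chartι k b ⁻¹' {p.1} := by
      ext x
      simp [← hq, (chartι k b).isOpenEmbedding.injective.eq_iff]
    exact (congrArg IsClosed this).mpr (IsClosed.preimage (chartι k b).continuous p.2)
  obtain ⟨α, hα⟩ := exists_chartCoord_sub_mem b q.asIdeal
  have hαb : α b = 1 := by
    have h1 := hα b
    rw [chartCoord_self, ← map_one (chartScalar b), ← map_sub] at h1
    by_contra hne
    refine hmax.ne_top (Ideal.eq_top_of_isUnit_mem _ h1 (IsUnit.map _ ?_))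
    exact isUnit_iff_ne_zero.2 (sub_ne_zero.2 (Ne.symm hne))
  -- The form `α₁ X₀ - α₀ X₁`, which vanishes at `[α₀ : α₁]`.
  let l : Fin 2 → k := ![α 1, -α 0]
  have hl : l ≠ 0 := by
    intro h0
    have h1 := congrFun h0 0
    have h2 := congrFun h0 1
    simp only [l, Matrix.cons_val_zero, Matrix.cons_val_one, Pi.zero_apply, neg_eq_zero] at h1 h2
    fin_cases b
    · exact one_ne_zero (hαb.symm.trans h2)
    · exact one_ne_zero (hαb.symm.trans h1)
  refine ⟨l, hl, fun {R κ f ξ} h => ?_⟩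
  have key := fun b' => exists_sub_mem_span_linearForm hl b'
  have hLq : (linearForm l).eval₂ (chartScalar b) (chartCoord b) ∈ q.asIdeal := by
    rw [eval₂_linearForm]
    have h0 := Ideal.mul_mem_left q.asIdeal (chartScalar b (α 1)) (hα 0)
    have h1 := Ideal.mul_mem_left q.asIdeal (chartScalar b (α 0)) (hα 1)
    have h2 := sub_mem h0 h1
    refine (congrArg (· ∈ q.asIdeal) ?_).mp h2
    simp only [l, Matrix.cons_val_zero, Matrix.cons_val_one, map_neg]
    ring
  have hq_eq : Ideal.span {(linearForm l).eval₂ (chartScalar b) (chartCoord b)} = q.asIdeal := by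
    have hle := (Ideal.span_singleton_le_iff_mem q.asIdeal).2 hLq
    rcases eq_top_or_isMaximal_of_chartCoord_sub_mem b _ (key b) with h1 | h1
    · exact absurd (top_le_iff.1 (h1 ▸ hle)) hmax.ne_top
    · exact h1.eq_of_le hmax.ne_top hle
  have h1 := idealAlong_vanishingIdeal (Z := ⟨{p.1}, p.2⟩) (ι := Unit) (fun _ => linearForm l)
    (fun _ => linearForm_mem l) (fun b' => by
      rw [Set.range_const]
      exact isRadical_of_chartCoord_sub_mem _ _ (key b')) ?_ h
  · rw [h1, Set.range_const, eval₂_linearForm]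
  intro b' q'
  have hb' := hasCoords_chartι (k := k) b'
  change chartι k b' q' = p.1 ↔ _
  rw [forall_const]
  -- On the overlap with the chart of `p` the two dehomogenizations of the form differ by a unit,
  -- and in that chart the form generates the maximal ideal of `p`.
  by_cases hx : chartι k b' q' ∈ PSpace.std k 1 b
  · obtain ⟨q'', rfl⟩ := range_SpecMap_awayHom _ _ ((hb'.mem_std_iff b q').1 hx)
    obtain ⟨ψ, hψ, hκ, hψ'⟩ := (hb'.comp (awayHom (chartCoord b' b))).exists_eq_chartι
      (isUnit_awayHom _)
    have h2 : chartι k b' (Spec.map (awayHom (chartCoord b' b)) q'') =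
        chartι k b (Spec.map ψ q'') := congr($hψ q'')
    rw [h2, ← hq, (chartι k b).isOpenEmbedding.injective.eq_iff]
    have h3 : (awayHom (chartCoord b' b)).hom
        ((linearForm l).eval₂ (chartScalar b') (chartCoord b')) =
        (awayHom (chartCoord b' b)).hom (chartCoord b' b) *
          ψ.hom ((linearForm l).eval₂ (chartScalar b) (chartCoord b)) := by
      rw [eval₂_linearForm_comp, eval₂_linearForm_comp, hκ, eval₂_linearForm, eval₂_linearForm,
        ← hψ' 0, ← hψ' 1]
      ring
    change _ ↔ (awayHom (chartCoord b' b)).hom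
        ((linearForm l).eval₂ (chartScalar b') (chartCoord b')) ∈ q''.asIdeal
    rw [h3, Ideal.unit_mul_mem_iff_mem _ (isUnit_awayHom _)]
    change _ ↔ (linearForm l).eval₂ (chartScalar b) (chartCoord b) ∈ (Spec.map ψ q'').asIdeal
    rw [← Ideal.span_singleton_le_iff_mem, hq_eq]
    constructor
    · intro h4; rw [h4]
    · intro h4
      exact (PrimeSpectrum.ext (hmax.eq_of_le (Spec.map ψ q'').2.ne_top h4)).symm
  -- Off that chart the coordinate of index `b` vanishes. As `α b = 1`, the form would make the
  -- other coordinate vanish too, but one of the two is `1`.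
  · refine iff_of_false (fun h2 => hx (h2 ▸ hb)) fun h2 => ?_
    have h3 : chartCoord b' b ∈ q'.asIdeal := by
      by_contra h4
      exact hx ((hb'.mem_std_iff b q').2 h4)
    have hall : ∀ a, chartCoord b' a ∈ q'.asIdeal := by
      rw [eval₂_linearForm] at h2
      intro a
      fin_cases b <;> fin_cases a
      · exact h3
      · have h6 : l 1 = -1 := congrArg Neg.neg hαb
        rw [h6, map_neg, map_one] at h2
        exact mem_of_mul_add_neg_one_mul_mem h3 h2
      · have h6 : l 0 = 1 := hαb
        rw [h6, map_one, one_mul] at h2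
        exact ((Ideal.add_mem_iff_left _ (Ideal.mul_mem_left _ _ h3)).1 h2)
      · exact h3
    have h4 := hall b'
    rw [chartCoord_self] at h4
    exact q'.2.ne_top ((Ideal.eq_top_iff_one _).2 h4)

end ClosedPoint

lemma exists_eq_SpecMap_ofHom {A : Type u} [CommRing A] {R : CommRingCat.{u}}
    (s : Spec R ⟶ Spec (.of A)) : ∃ κ : A →+* R, s = Spec.map (CommRingCat.ofHom κ) :=
  ⟨(Spec.preimage s).hom, (Spec.map_preimage s).symm⟩

/-! ### Recognising coordinates by cross-multiplication -/

section Coordinates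

variable {k : Type u} [Field k] {n : ℕ} {R S : CommRingCat.{u}}

lemma pointAt_congr {κ κ' : k →+* R} (h : κ = κ') (ξ : Fin (n + 1) → R) (b : Fin (n + 1))
    (hb : IsUnit (ξ b)) : pointAt κ ξ b hb = pointAt κ' ξ b hb := by
  subst h; rfl

/-- Over `S'` the tuple `ξ` is `ξ c` times the genuine coordinates `ζ`, and `ξ c` is a unit there
because the unit `ξ b` is a multiple of it. -/
lemma HasCoords.map_eq_of_cross {R' S' : CommRingCat.{u}} {κ : k →+* R}
    {f : Spec R ⟶ PSpace k n} {ξ : Fin (n + 1) → R} {α : R ⟶ R'} {φ : R ⟶ S} {β : S ⟶ S'}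
    {ψ : R' ⟶ S'} (hψ : α ≫ ψ = φ ≫ β) {ζ : Fin (n + 1) → R'} {c : Fin (n + 1)} (hζc : ζ c = 1)
    (hζ : HasCoords (α.hom.comp κ) (Spec.map α ≫ f) ζ)
    (h : ∀ a b, α.hom (ξ a) * ζ b = α.hom (ξ b) * ζ a) {b : Fin (n + 1)}
    (hb : IsUnit (φ.hom (ξ b))) :
    Spec.map β ≫ Spec.map φ ≫ f =
      Spec.map β ≫ pointAt (φ.hom.comp κ) (fun a => φ.hom (ξ a)) b hb := by
  have hψ' : ∀ x, ψ.hom (α.hom x) = β.hom (φ.hom x) := fun x => congr($hψ x)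
  have hb' : IsUnit (β.hom (φ.hom (ξ b))) := hb.map β.hom
  have key : ∀ a, β.hom (φ.hom (ξ a)) = β.hom (φ.hom (ξ c)) * ψ.hom (ζ a) := by
    intro a
    rw [← hψ', ← hψ', ← map_mul, ← h, hζc, mul_one]
  have hc' : IsUnit (β.hom (φ.hom (ξ c))) := by
    rw [key b] at hb'
    exact isUnit_of_mul_isUnit_left hb'
  have hζ' := hζ.comp ψ
  have e1 : Spec.map β ≫ Spec.map φ ≫ f = Spec.map ψ ≫ Spec.map α ≫ f := by
    rw [← Category.assoc, ← Category.assoc, ← Spec.map_comp, ← Spec.map_comp, hψ]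
  have hζc' : IsUnit (ψ.hom (ζ c)) := by rw [hζc, map_one]; exact isUnit_one
  have hκ : ψ.hom.comp (α.hom.comp κ) = β.hom.comp (φ.hom.comp κ) := RingHom.ext fun x => hψ' _
  rw [e1, SpecMap_pointAt, hζ'.eq_pointAt c hζc', pointAt_eq _ _ b c _ hc', pointAt_congr hκ]
  exact pointAt_smul _ _ _ _ _ _ _ key

lemma exists_lift_away {A B : Type*} [CommRing A] [CommRing B] {φ : A →+* B} {r : A}
    (hu : IsUnit (φ r)) : ∃ ψ : Localization.Away r →+* B,
      ψ.comp (algebraMap A (Localization.Away r)) = φ :=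
  ⟨IsLocalization.Away.lift r hu, IsLocalization.Away.lift_comp r hu⟩

lemma exists_awayHom_comp (φ : R ⟶ S) (r : R) :
    ∃ ψ : CommRingCat.of (Localization.Away r) ⟶ CommRingCat.of (Localization.Away (φ.hom r)),
      awayHom r ≫ ψ = φ ≫ awayHom (φ.hom r) := by
  have hu : IsUnit ((φ ≫ awayHom (φ.hom r)).hom r) := isUnit_awayHom (φ.hom r)
  obtain ⟨ψ, hψ⟩ := exists_lift_away hu
  exact ⟨CommRingCat.ofHom ψ, CommRingCat.hom_ext hψ⟩

/-- Coordinates can be checked up to proportionality on a basic open cover. -/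
lemma HasCoords.of_cross_away {κ : k →+* R} {f : Spec R ⟶ PSpace k n} {ξ : Fin (n + 1) → R}
    (hf : f ≫ PSpace.toSpec k n = Spec.map (CommRingCat.ofHom κ))
    (hξ : Ideal.span (Set.range ξ) = ⊤)
    (h : ∀ r c ζ, ζ c = 1 → HasCoords ((awayHom r).hom.comp κ) (Spec.map (awayHom r) ≫ f) ζ →
      ∀ a b, (awayHom r).hom (ξ a) * ζ b = (awayHom r).hom (ξ b) * ζ a) : HasCoords κ f ξ where
  span_eq_top := hξ
  map_eq {S} φ b hb := by
    refine spec_hom_ext fun p => ?_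
    obtain ⟨c, hc⟩ := exists_mem_std ((Spec.map φ ≫ f) p)
    obtain ⟨r, hr, hle⟩ := exists_awayHom_le f _ (Spec.map φ p) hc
    have hf' : (Spec.map (awayHom r) ≫ f) ≫ PSpace.toSpec k n =
        Spec.map (CommRingCat.ofHom ((awayHom r).hom.comp κ)) := by
      rw [Category.assoc, hf, ← Spec.map_comp]
      rfl
    obtain ⟨ζ, hζc, hζ⟩ := exists_hasCoords_of_le_std hf' hle
    obtain ⟨ψ, hψ⟩ := exists_awayHom_comp φ r
    exact ⟨φ.hom r, hr, HasCoords.map_eq_of_cross hψ hζc hζ (h r c ζ hζc hζ) hb⟩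

end Coordinates

lemma exists_add_one_add_two {a b : Fin 3} (h : a ≠ b) :
    ∃ i : Fin 3, (i + 1 = a ∧ i + 2 = b) ∨ (i + 1 = b ∧ i + 2 = a) := by
  revert a b; decide

lemma add_two_ne_add_one (j : Fin 3) : j + 2 ≠ j + 1 := by
  revert j; decide

/-! ### The ideal of the three coordinate points -/

section ThreePoints

open MvPolynomial

variable {k : Type u} [Field k] {R S : CommRingCat.{u}}

lemma mem_coordPoint_iff (i : Fin 3) (x : PSpace k 2) :
    x ∈ coordPoint k i ↔ ∀ a, a ≠ i → x ∉ PSpace.std k 2 a := by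
  change (X '' {i}ᶜ : Set (MvPolynomial (Fin 3) k)) ⊆ x.asHomogeneousIdeal ↔ _
  rw [Set.image_subset_iff]
  constructor
  · intro h a ha hx
    exact hx (h ha)
  · intro h a ha
    exact not_not.1 (h a ha)

/-- On the chart `x_b = 1` the products of two distinct coordinates include every other coordinate,
so they generate the ideal of a rational point. A prime contains all three products exactly when it
contains two of the coordinates. -/
lemma idealAlong_threePoints {κ : k →+* R} {f : Spec R ⟶ PSpace k 2} {ξ : Fin 3 → R}
    (h : HasCoords κ f ξ) : idealAlong f (threePoints k) =
      Ideal.span (Set.range fun i : Fin 3 => ξ (i + 1) * ξ (i + 2)) := by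
  have key := idealAlong_vanishingIdeal
    (Z := coordPoint k 0 ⊔ coordPoint k 1 ⊔ coordPoint k 2)
    (fun i : Fin 3 => (X (i + 1) * X (i + 2) : MvPolynomial (Fin 3) k)) (d := fun _ => 2)
    (fun i => (isHomogeneous_X k _).mul (isHomogeneous_X k _)) (fun b => ?_) (fun b q => ?_) h
  · rw [threePoints, key]
    simp only [eval₂_mul, eval₂_X]
  · refine isRadical_of_chartCoord_sub_mem _ _ fun a => ?_
    have hb := chartCoord_self (k := k) b
    by_cases hab : a = b
    · subst hab
      exact ⟨1, by rw [hb, map_one, sub_self]; exact zero_mem _⟩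
    · refine ⟨0, ?_⟩
      rw [map_zero, sub_zero]
      obtain ⟨i, hi⟩ : ∃ i : Fin 3, (i + 1 = a ∧ i + 2 = b) ∨ (i + 1 = b ∧ i + 2 = a) :=
        exists_add_one_add_two hab
      refine Ideal.subset_span ⟨i, ?_⟩
      rcases hi with ⟨h1, h2⟩ | ⟨h1, h2⟩
      · simp only [h1, h2, eval₂_mul, eval₂_X, hb, mul_one]
      · simp only [h1, h2, eval₂_mul, eval₂_X, hb, one_mul]
  · have hc := fun a => (hasCoords_chartι (k := k) b).mem_std_iff a q
    have h1 : chartι k b q ∈ coordPoint k 0 ⊔ coordPoint k 1 ⊔ coordPoint k 2 ↔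
        ∃ i : Fin 3, ∀ a, a ≠ i → chartCoord b a ∈ q.asIdeal := by
      have h2 : ∀ i, chartι k b q ∈ coordPoint k i ↔
          ∀ a, a ≠ i → chartCoord b a ∈ q.asIdeal := by
        intro i
        rw [mem_coordPoint_iff]
        simp only [hc, not_not]
      rw [Fin.exists_fin_succ, Fin.exists_fin_two]
      simp only [← h2]
      exact or_assoc
    rw [h1]
    simp only [eval₂_mul, eval₂_X]
    constructor
    · rintro ⟨i, hi⟩ j
      by_cases hj : j + 1 = i
      · exact Ideal.mul_mem_left _ _ (hi _ (hj ▸ add_two_ne_add_one j))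
      · exact Ideal.mul_mem_right _ _ (hi _ hj)
    · intro hall
      by_contra! hne
      have h3 := fun j => q.2.mem_or_mem (hall j)
      obtain ⟨a, ha, ha'⟩ := hne 0
      obtain ⟨c, hc, hc'⟩ := hne a
      obtain ⟨i, hi⟩ : ∃ i : Fin 3, (i + 1 = a ∧ i + 2 = c) ∨ (i + 1 = c ∧ i + 2 = a) :=
        exists_add_one_add_two hc.symm
      have h4 := h3 i
      rcases hi with ⟨h1, h2⟩ | ⟨h1, h2⟩ <;> rw [h1, h2] at h4 <;> tauto

end ThreePoints

/-! ### Invertible ideal sheaves on affine schemes -/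

section Invertible

lemma isInvertibleIdeal_comap {Y : Scheme.{u}} {R : CommRingCat.{u}} (g : Spec R ⟶ Y)
    (I : Y.IdealSheafData) {d : R} (hd : d ∈ nonZeroDivisors R)
    (h : idealAlong g I = Ideal.span {d}) : IsInvertibleIdeal (I.comap g) := by
  intro x
  refine ⟨⟨⊤, isAffineOpen_top _⟩, trivial, (Scheme.ΓSpecIso R).inv.hom d, ?_, ?_⟩
  · rw [mem_nonZeroDivisors_iff_right] at hd ⊢
    intro y hy
    have h1 := hd ((Scheme.ΓSpecIso R).hom.hom y) (by
      have := congrArg (Scheme.ΓSpecIso R).hom.hom hy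
      rw [map_mul, map_zero] at this
      simpa using this)
    simpa using congrArg (Scheme.ΓSpecIso R).inv.hom h1
  · ext y
    have h1 : y ∈ (I.comap g).ideal ⟨⊤, isAffineOpen_top _⟩ ↔
        (Scheme.ΓSpecIso R).hom.hom y ∈ idealAlong g I := by
      simp [idealAlong]
    rw [h1, h, Ideal.mem_span_singleton', Ideal.mem_span_singleton']
    constructor
    · rintro ⟨a, ha⟩
      refine ⟨(Scheme.ΓSpecIso R).inv.hom a, ?_⟩
      rw [← map_mul, ha]
      simp
    · rintro ⟨a, rfl⟩
      refine ⟨(Scheme.ΓSpecIso R).hom.hom a, ?_⟩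
      rw [map_mul]
      simp

lemma IsInvertibleIdeal.exists_openImmersion {X : Scheme.{u}} {I : X.IdealSheafData}
    (hI : IsInvertibleIdeal I) (x : X) (W : X.Opens) (hx : x ∈ W) :
    ∃ (R : CommRingCat.{u}) (g : Spec R ⟶ X) (_ : IsOpenImmersion g),
      x ∈ g.opensRange ∧ g.opensRange ≤ W ∧
      ∃ d ∈ nonZeroDivisors R, idealAlong g I = Ideal.span {d} := by
  obtain ⟨U, hxU, f, hf, hfU⟩ := hI x
  obtain ⟨s, hs, hxs⟩ := U.2.exists_basicOpen_le ⟨x, hx⟩ hxU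
  have hU' : IsAffineOpen (X.basicOpen s) := U.2.basicOpen s
  refine ⟨Γ(X, X.basicOpen s), hU'.fromSpec, inferInstance, ?_, ?_, ?_⟩
  · rwa [hU'.opensRange_fromSpec]
  · rwa [hU'.opensRange_fromSpec]
  have hloc := U.2.isLocalization_basicOpen s
  refine ⟨(X.presheaf.map (homOfLE (X.basicOpen_le s)).op).hom f, ?_, ?_⟩
  · exact IsLocalization.map_nonZeroDivisors_le (Submonoid.powers s) _ ⟨f, hf, rfl⟩
  · rw [idealAlong_fromSpec hU', ← I.map_ideal (U := ⟨_, hU'⟩) (V := U) (X.basicOpen_le s), hfU,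
      Ideal.map_span, Set.image_singleton]
    rfl

end Invertible

/-! ### Coordinate formulas on the six affine planes -/

section Model

/-- The affine charts of the blow-up are indexed by a pencil `p` and an `e ∈ {0, 1}`: the chart
lies over the points of `ℙ¹` whose coordinate with index `chartIndex p e i` does not vanish. -/
def chartIndex (p : Fin 3) (e : Fin 2) (i : Fin 3) : Fin 2 := if i = p then e + 1 else e

variable {A B : Type*} [CommRing A] [CommRing B]

/-- The nontrivial coordinate of the `i`-th pencil on a chart with coordinates `w`. -/
def modelFrac (p : Fin 3) (w : Fin 2 → A) (i : Fin 3) : A :=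
  if i = p then w 0 * w 1 else if i = p + 1 then w 0 else w 1

/-- The homogeneous coordinates of the `i`-th pencil on a chart with coordinates `w`. -/
def modelCoord (p : Fin 3) (e : Fin 2) (w : Fin 2 → A) (i : Fin 3) (a : Fin 2) : A :=
  if a = chartIndex p e i then 1 else modelFrac p w i

/-- The index of the coordinate of the plane that is invertible on a chart. -/
def planeIndex (p : Fin 3) (e : Fin 2) : Fin 3 := if e = 0 then p + 2 else p + 1

/-- The homogeneous coordinates of the blow-down on a chart with coordinates `w`. -/
def planeCoord (p : Fin 3) (e : Fin 2) (w : Fin 2 → A) (m : Fin 3) : A :=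
  if m = p then w e else if m = planeIndex p e then 1 else w 0 * w 1

lemma map_modelFrac (φ : A →+* B) (p : Fin 3) (w : Fin 2 → A) (i : Fin 3) :
    φ (modelFrac p w i) = modelFrac p (φ ∘ w) i := by
  unfold modelFrac
  split_ifs <;> simp

lemma map_modelCoord (φ : A →+* B) (p : Fin 3) (e : Fin 2) (w : Fin 2 → A) (i : Fin 3)
    (a : Fin 2) : φ (modelCoord p e w i a) = modelCoord p e (φ ∘ w) i a := by
  unfold modelCoord
  split_ifs
  · simp
  · exact map_modelFrac _ _ _ _

lemma map_planeCoord (φ : A →+* B) (p : Fin 3) (e : Fin 2) (w : Fin 2 → A) (m : Fin 3) :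
    φ (planeCoord p e w m) = planeCoord p e (φ ∘ w) m := by
  unfold planeCoord
  split_ifs <;> simp

lemma modelCoord_chartIndex (p : Fin 3) (e : Fin 2) (w : Fin 2 → A) (i : Fin 3) :
    modelCoord p e w i (chartIndex p e i) = 1 := by simp [modelCoord]

lemma planeCoord_eq_one (p : Fin 3) (e : Fin 2) (w : Fin 2 → A) :
    planeCoord p e w (planeIndex p e) = 1 := by
  fin_cases p <;> fin_cases e <;> rfl

/-- After normalizing one coordinate of each pencil to `1`, the hexagonal relation only says that
the free coordinate of the pencil `p` is the product of the other two. Thus the chart of the surface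
is an affine plane. -/
lemma modelCoord_eq {p : Fin 3} {e : Fin 2} {η : Fin 3 → Fin 2 → A}
    (h1 : ∀ i, η i (chartIndex p e i) = 1) (h : ∏ i, η i 0 = ∏ i, η i 1) :
    modelCoord p e ![η (p + 1) (e + 1), η (p + 2) (e + 1)] = η := by
  have h10 := h1 0
  have h11 := h1 1
  have h12 := h1 2
  rw [Fin.prod_univ_three, Fin.prod_univ_three] at h
  funext i a
  fin_cases p <;> fin_cases e <;> fin_cases i <;> fin_cases a <;>
    simp_all [modelCoord, chartIndex, modelFrac, mul_comm]

/-- The incidence relation is the desired proportionality up to factors `w 0` and `w 1`. The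
equation `w e = 0` is that of the exceptional divisor, where the plane coordinates lose information,
so its being a nonzerodivisor permits the cancellation. -/
lemma modelCoord_cross {p : Fin 3} {e : Fin 2} {w : Fin 2 → A} {η : Fin 2 → A} (i : Fin 3)
    (hw : w e ∈ nonZeroDivisors A)
    (h : planeCoord p e w (i + 1) * η 1 = planeCoord p e w (i + 2) * η 0) (a b : Fin 2) :
    modelCoord p e w i a * η b = modelCoord p e w i b * η a := by
  have hc : ∀ x y : A, w e * x = w e * y → x = y := fun x y hxy =>
    (mul_cancel_left_mem_nonZeroDivisors hw).1 hxy
  fin_cases a <;> fin_cases b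
  · rfl
  all_goals
    apply hc
    fin_cases p <;> fin_cases e <;> fin_cases i <;>
      simp [modelCoord, chartIndex, modelFrac, planeCoord, planeIndex] at h ⊢ <;>
      first
        | linear_combination h | linear_combination -h | linear_combination w 0 * h
        | linear_combination -w 0 * h | linear_combination w 1 * h | linear_combination -w 1 * h

lemma planeCoord_cross {p : Fin 3} {e : Fin 2} {w : Fin 2 → A} {ξ : Fin 3 → A}
    (h : ∀ i, ξ (i + 1) * modelCoord p e w i 1 = ξ (i + 2) * modelCoord p e w i 0) (m : Fin 3) :
    ξ m = ξ (planeIndex p e) * planeCoord p e w m := by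
  have h0 := h 0
  have h1 := h 1
  have h2 := h 2
  fin_cases p <;> fin_cases e <;> fin_cases m <;>
    simp [modelCoord, chartIndex, modelFrac, planeCoord, planeIndex] at h0 h1 h2 ⊢ <;> grind

lemma prod_eq_prod_of_incidence {ξ : Fin 3 → A} {η : Fin 3 → Fin 2 → A} {m : Fin 3}
    (hm : IsUnit (ξ m)) (h : ∀ i, ξ (i + 1) * η i 1 = ξ (i + 2) * η i 0) :
    ∏ i, η i 0 = ∏ i, η i 1 := by
  have h0 := h 0
  have h1 := h 1
  have h2 := h 2
  rw [Fin.prod_univ_three, Fin.prod_univ_three]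
  simp at h0 h1 h2
  -- Multiplying the three relations directly would produce the factor `ξ 0 * ξ 1 * ξ 2`, which may
  -- vanish. With the square of the invertible coordinate the relations can be applied one after
  -- another.
  refine (hm.mul hm).mul_left_cancel ?_
  fin_cases m <;> simp <;> grind

end Model

lemma HasCoords.congr {k : Type u} [Field k] {n : ℕ} {R : CommRingCat.{u}} {κ κ' : k →+* R}
    {f : Spec R ⟶ PSpace k n} {ξ ξ' : Fin (n + 1) → R} (h : HasCoords κ f ξ) (hκ : κ = κ')
    (hξ : ξ = ξ') : HasCoords κ' f ξ' := by
  subst hκ hξ; exact h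

lemma comp_toSpecΓ_SpecMap {T : Scheme.{u}} {R A : CommRingCat.{u}} (g : Spec R ⟶ T)
    (φ : A ⟶ Γ(T, ⊤)) :
    g ≫ T.toSpecΓ ≫ Spec.map φ = Spec.map (φ ≫ pullSection g ⊤ le_top) := by
  have h : pullSection g ⊤ le_top = g.appTop ≫ (Scheme.ΓSpecIso R).hom := by
    rw [Scheme.Hom.appTop, Scheme.Hom.app_eq_appLE]
    rfl
  have h2 : (Spec R).toSpecΓ = Spec.map (Scheme.ΓSpecIso R).hom := Scheme.isoSpec_Spec_hom R
  rw [Scheme.toSpecΓ_naturality_assoc, h, h2, ← Spec.map_comp, ← Spec.map_comp, Category.assoc]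

/-! ### The hexagonal relation and the covering by six charts -/

section LocalCoordinates

variable {k : Type u} [Field k] {n : ℕ} {R : CommRingCat.{u}} {T : Scheme.{u}}

lemma pullSection_pullFrac {f : T ⟶ PSpace k n} {κ : k →+* R} {g : Spec R ⟶ T}
    {ξ : Fin (n + 1) → R} (hξ : HasCoords κ (g ≫ f) ξ) (a b : Fin (n + 1)) (U : T.Opens)
    (hU : U ≤ f ⁻¹ᵁ PSpace.std k n b) (h : ⊤ ≤ g ⁻¹ᵁ U) :
    (pullSection g U h).hom (pullFrac f a b U hU) * ξ b = ξ a := by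
  have hle : ⊤ ≤ (g ≫ f) ⁻¹ᵁ PSpace.std k n b := fun x hx => hU (h hx)
  rw [← hξ.pullSection_frac a b hle, ← pullSection_appLE g f _ _ h hU hle]
  rfl

lemma IsPencil.incidence_coords {X : Scheme.{u}} {β : X ⟶ PSpace k 2} {i : Fin 3}
    {π : X ⟶ PSpace k 1} (hπ : IsPencil β i π) {g : Spec R ⟶ X} {κ : k →+* R} {ξ : Fin 3 → R}
    {η : Fin 2 → R} (hξ : HasCoords κ (g ≫ β) ξ) (hη : HasCoords κ (g ≫ π) η) :
    ξ (i + 1) * η 1 = ξ (i + 2) * η 0 := by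
  refine eq_of_forall_local fun S φ _ => ?_
  have hξ' := hξ.comp φ
  have hη' := hη.comp φ
  rw [← Category.assoc] at hξ' hη'
  obtain ⟨m, hm⟩ := exists_isUnit_of_span_eq_top hξ'.span_eq_top
  obtain ⟨b, hb⟩ := exists_isUnit_of_span_eq_top hη'.span_eq_top
  have hU : ⊤ ≤ (Spec.map φ ≫ g) ⁻¹ᵁ (β ⁻¹ᵁ PSpace.std k 2 m ⊓ π ⁻¹ᵁ PSpace.std k 1 b) :=
    fun x hx => ⟨hξ'.le_std hm hx, hη'.le_std hb hx⟩
  have h1 := congrArg (pullSection (Spec.map φ ≫ g) _ hU).hom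
    (hπ.incidence m b _ inf_le_left inf_le_right)
  rw [map_mul, map_mul] at h1
  rw [map_mul, map_mul]
  have e1 := fun a => pullSection_pullFrac hξ' a m _ inf_le_left hU
  have e2 := fun a => pullSection_pullFrac hη' a b _ inf_le_right hU
  rw [← e1 (i + 1), ← e1 (i + 2), ← e2 1, ← e2 0, mul_mul_mul_comm, h1, mul_mul_mul_comm]

/-- A triple of morphisms to the projective line satisfies the equation
`Y₀₀ Y₁₀ Y₂₀ = Y₀₁ Y₁₁ Y₂₁`. -/
def IsHexagonal (b : Fin 3 → (T ⟶ PSpace k 1)) : Prop :=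
  ∀ {R : CommRingCat.{u}} (g : Spec R ⟶ T) (κ : k →+* R) (η : Fin 3 → Fin 2 → R),
    (∀ i, HasCoords κ (g ≫ b i) (η i)) → ∏ i, η i 0 = ∏ i, η i 1

lemma isHexagonal_of_isPencil {X : Scheme.{u}} {β : X ⟶ PSpace k 2}
    {π : Fin 3 → (X ⟶ PSpace k 1)} (hπ : ∀ i, IsPencil β i (π i)) : IsHexagonal π := by
  intro R g κ η hη
  refine eq_of_forall_local fun S φ _ => ?_
  have hη' : ∀ i, HasCoords (φ.hom.comp κ) ((Spec.map φ ≫ g) ≫ π i) (fun a => φ.hom (η i a)) := by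
    intro i
    rw [Category.assoc]
    exact (hη i).comp φ
  have hs : ((Spec.map φ ≫ g) ≫ β) ≫ PSpace.toSpec k 2 =
      Spec.map (CommRingCat.ofHom (φ.hom.comp κ)) := by
    rw [Category.assoc, ← (hπ 0).over_base, ← Category.assoc, (hη' 0).toSpec]
  obtain ⟨ξ, m, hm, hξ⟩ := exists_hasCoords_of_isLocalRing hs
  rw [map_prod, map_prod]
  exact prod_eq_prod_of_incidence (hm ▸ isUnit_one) fun i => (hπ i).incidence_coords hξ (hη' i)

/-- The open set lying over the chart with index `(p, e)`. -/
def chartOpen (b : Fin 3 → (T ⟶ PSpace k 1)) (p : Fin 3) (e : Fin 2) : T.Opens :=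
  ⨅ i, b i ⁻¹ᵁ PSpace.std k 1 (chartIndex p e i)

lemma chartOpen_le (b : Fin 3 → (T ⟶ PSpace k 1)) (p : Fin 3) (e : Fin 2) (i : Fin 3) :
    chartOpen b p e ≤ b i ⁻¹ᵁ PSpace.std k 1 (chartIndex p e i) := iInf_le _ _

lemma mem_chartOpen_iff (b : Fin 3 → (T ⟶ PSpace k 1)) (p : Fin 3) (e : Fin 2) (x : T) :
    x ∈ chartOpen b p e ↔ ∀ i, b i x ∈ PSpace.std k 1 (chartIndex p e i) := by
  rw [chartOpen, ← SetLike.mem_coe, Opens.coe_iInf]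
  exact Set.mem_iInter

/-- Choose an invertible coordinate of each component at `x`. If the three indices are not all
equal, `e` is the majority value and `p` the odd one out. If all equal `e`, the relation makes the
coordinates of index `e + 1` invertible as well, so any `p` will do. -/
lemma exists_mem_chartOpen {b : Fin 3 → (T ⟶ PSpace k 1)} (hb : IsHexagonal b)
    {s : T ⟶ Spec (.of k)} (hs : ∀ i, b i ≫ PSpace.toSpec k 1 = s) (x : T) :
    ∃ p e, x ∈ chartOpen b p e := by
  obtain ⟨κ, hκ⟩ := exists_eq_SpecMap_ofHom (T.fromSpecStalk x ≫ s)
  choose η v hv hη using fun i => exists_hasCoords_of_isLocalRing (κ := κ)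
    (f := T.fromSpecStalk x ≫ b i) (by rw [Category.assoc, hs, hκ])
  have hrel := hb _ κ η hη
  have key : ∀ i c, IsUnit (η i c) → b i x ∈ PSpace.std k 1 c := by
    intro i c hc
    have h1 := (hη i).le_std hc (show IsLocalRing.closedPoint _ ∈ (⊤ : (Spec _).Opens) from trivial)
    have h2 : (T.fromSpecStalk x ≫ b i) (IsLocalRing.closedPoint (T.presheaf.stalk x)) = b i x :=
      congrArg (b i) Scheme.fromSpecStalk_closedPoint
    exact h2 ▸ h1
  have hv' : ∀ i, IsUnit (η i (v i)) := fun i => hv i ▸ isUnit_one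
  simp only [mem_chartOpen_iff]
  rw [Fin.prod_univ_three, Fin.prod_univ_three] at hrel
  by_cases hc : ∃ e, ∀ i, v i = e
  · obtain ⟨e, he⟩ := hc
    refine ⟨0, e, fun i => key _ _ ?_⟩
    by_cases hi : i = 0
    · subst hi
      simp only [he] at hv hv'
      simp only [chartIndex, if_true]
      have h2 : IsUnit (η 0 (e + 1) * η 1 (e + 1) * η 2 (e + 1)) := by
        fin_cases e
        · change IsUnit (η 0 1 * η 1 1 * η 2 1)
          rw [← hrel]
          exact ((hv' 0).mul (hv' 1)).mul (hv' 2)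
        · change IsUnit (η 0 0 * η 1 0 * η 2 0)
          rw [hrel]
          exact ((hv' 0).mul (hv' 1)).mul (hv' 2)
      exact isUnit_of_mul_isUnit_left (isUnit_of_mul_isUnit_left h2)
    · simp only [chartIndex, hi, if_false]
      rw [← he i]; exact hv' i
  · obtain ⟨p, e, hpe⟩ : ∃ p e, ∀ i, chartIndex p e i = v i := by
      clear hv hv' hη
      revert v; decide
    exact ⟨p, e, fun i => hpe i ▸ key _ _ (hv' i)⟩

end LocalCoordinates

/-! ### The affine planes as schemes and morphisms to them -/

section Model

variable {k : Type u} [Field k] {R : CommRingCat.{u}} {T : Scheme.{u}}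

variable (k) in
/-- The coordinate ring of the charts of the blow-up. -/
abbrev modelRing : CommRingCat.{u} := .of (MvPolynomial (Fin 2) k)

/-- The point of `Spec k[w₀, w₁]` with given coordinates. -/
def modelPoint (κ : k →+* R) (w : Fin 2 → R) : Spec R ⟶ Spec (modelRing k) :=
  Spec.map (CommRingCat.ofHom (MvPolynomial.eval₂Hom κ w))

lemma modelPoint_id : modelPoint (MvPolynomial.C : k →+* modelRing k) MvPolynomial.X = 𝟙 _ := by
  rw [modelPoint, ← Spec.map_id]
  congr 1
  ext1
  exact RingHom.ext fun p => MvPolynomial.eval₂_eta p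

/-- The pencils on a chart. -/
def modelPencil (p : Fin 3) (e : Fin 2) (i : Fin 3) : Spec (modelRing k) ⟶ PSpace k 1 :=
  pointAt (MvPolynomial.C : k →+* modelRing k) (modelCoord p e MvPolynomial.X i)
    (chartIndex p e i) (modelCoord_chartIndex p e (A := modelRing k) _ i ▸ isUnit_one)

/-- The blow-down on a chart. -/
def modelPlane (p : Fin 3) (e : Fin 2) : Spec (modelRing k) ⟶ PSpace k 2 :=
  pointAt (MvPolynomial.C : k →+* modelRing k) (planeCoord p e MvPolynomial.X)
    (planeIndex p e) (planeCoord_eq_one p e (A := modelRing k) _ ▸ isUnit_one)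

lemma hasCoords_modelPencil (p : Fin 3) (e : Fin 2) (i : Fin 3) :
    HasCoords (MvPolynomial.C : k →+* modelRing k) (modelPencil p e i)
      (modelCoord p e MvPolynomial.X i) := hasCoords_pointAt _ _ _ _

lemma hasCoords_modelPlane (p : Fin 3) (e : Fin 2) :
    HasCoords (MvPolynomial.C : k →+* modelRing k) (modelPlane p e)
      (planeCoord p e MvPolynomial.X) := hasCoords_pointAt _ _ _ _

lemma eval₂Hom_comp_X (κ : k →+* R) (w : Fin 2 → R) :
    (MvPolynomial.eval₂Hom κ w ∘ MvPolynomial.X) = w := by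
  funext a; simp

lemma modelPoint_modelPencil (κ : k →+* R) (w : Fin 2 → R) (p : Fin 3) (e : Fin 2) (i : Fin 3) :
    HasCoords κ (modelPoint κ w ≫ modelPencil p e i) (modelCoord p e w i) := by
  have h := (hasCoords_modelPencil (k := k) p e i).comp
    (CommRingCat.ofHom (MvPolynomial.eval₂Hom κ w))
  have h1 : (MvPolynomial.eval₂Hom κ w).comp MvPolynomial.C = κ := by ext; simp
  have h2 : (fun a => MvPolynomial.eval₂Hom κ w (modelCoord p e MvPolynomial.X i a)) =
      modelCoord p e w i := by
    funext a
    rw [map_modelCoord, eval₂Hom_comp_X]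
  exact h.congr h1 h2

lemma modelPoint_modelPlane (κ : k →+* R) (w : Fin 2 → R) (p : Fin 3) (e : Fin 2) :
    HasCoords κ (modelPoint κ w ≫ modelPlane p e) (planeCoord p e w) := by
  have h := (hasCoords_modelPlane (k := k) p e).comp
    (CommRingCat.ofHom (MvPolynomial.eval₂Hom κ w))
  have h1 : (MvPolynomial.eval₂Hom κ w).comp MvPolynomial.C = κ := by ext; simp
  have h2 : (fun a => MvPolynomial.eval₂Hom κ w (planeCoord p e MvPolynomial.X a)) =
      planeCoord p e w := by
    funext a
    rw [map_planeCoord, eval₂Hom_comp_X]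
  exact h.congr h1 h2

/-- The morphism to a chart given by a triple of morphisms to the projective line. -/
def toModel (s : T ⟶ Spec (.of k)) (b : Fin 3 → (T ⟶ PSpace k 1)) (p : Fin 3) (e : Fin 2)
    (h : ∀ i, ⊤ ≤ b i ⁻¹ᵁ PSpace.std k 1 (chartIndex p e i)) : T ⟶ Spec (modelRing k) :=
  T.toSpecΓ ≫ Spec.map (CommRingCat.ofHom (MvPolynomial.eval₂Hom
    ((Scheme.ΓSpecIso (.of k)).inv ≫ s.appTop).hom
    ![pullFrac (b (p + 1)) (chartIndex p e (p + 1) + 1) (chartIndex p e (p + 1)) ⊤ (h _),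
      pullFrac (b (p + 2)) (chartIndex p e (p + 2) + 1) (chartIndex p e (p + 2)) ⊤ (h _)]))

lemma toModel_eq_modelPoint {s : T ⟶ Spec (.of k)} {b : Fin 3 → (T ⟶ PSpace k 1)} {p : Fin 3}
    {e : Fin 2} (h : ∀ i, ⊤ ≤ b i ⁻¹ᵁ PSpace.std k 1 (chartIndex p e i)) (g : Spec R ⟶ T)
    {κ : k →+* R} (hκ : g ≫ s = Spec.map (CommRingCat.ofHom κ)) {η : Fin 3 → Fin 2 → R}
    (hη : ∀ i, HasCoords κ (g ≫ b i) (η i)) (h1 : ∀ i, η i (chartIndex p e i) = 1) :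
    g ≫ toModel s b p e h = modelPoint κ ![η (p + 1) (e + 1), η (p + 2) (e + 1)] := by
  rw [toModel, comp_toSpecΓ_SpecMap, modelPoint]
  congr 1
  ext1
  have e1 : ∀ j, j ≠ p → (pullSection g ⊤ le_top).hom (pullFrac (b j) (chartIndex p e j + 1)
      (chartIndex p e j) ⊤ (h j)) = η j (e + 1) := by
    intro j hj
    have h2 := pullSection_pullFrac (hη j) (chartIndex p e j + 1) (chartIndex p e j) ⊤ (h j) le_top
    rw [h1, mul_one] at h2
    rw [h2, chartIndex, if_neg hj]
  have e2 : (Scheme.ΓSpecIso (.of k)).inv ≫ s.appTop ≫ pullSection g ⊤ le_top =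
      CommRingCat.ofHom κ := by
    have h3 := pullSection_appLE g s ⊤ ⊤ le_top le_top le_top
    rw [Scheme.Hom.appTop, Scheme.Hom.app_eq_appLE, Iso.inv_comp_eq]
    exact h3.trans (pullSection_top_eq hκ)
  refine MvPolynomial.ringHom_ext (fun r => ?_) (fun a => ?_)
  · refine Eq.trans ?_ (MvPolynomial.eval₂_C κ _ r).symm
    refine Eq.trans ?_ congr($e2 r)
    change (pullSection g ⊤ le_top).hom (MvPolynomial.eval₂ _ _ _) = _
    rw [MvPolynomial.eval₂_C]
    rfl
  · refine Eq.trans ?_ (MvPolynomial.eval₂_X κ _ a).symm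
    change (pullSection g ⊤ le_top).hom (MvPolynomial.eval₂ _ _ _) = _
    rw [MvPolynomial.eval₂_X]
    fin_cases a
    · exact e1 (p + 1) ((by decide : ∀ q : Fin 3, q + 1 ≠ q) p)
    · exact e1 (p + 2) ((by decide : ∀ q : Fin 3, q + 2 ≠ q) p)

lemma exists_coords_of_chart {s : T ⟶ Spec (.of k)} {b : Fin 3 → (T ⟶ PSpace k 1)} {p : Fin 3}
    {e : Fin 2} (hs : ∀ i, b i ≫ PSpace.toSpec k 1 = s)
    (h : ∀ i, ⊤ ≤ b i ⁻¹ᵁ PSpace.std k 1 (chartIndex p e i)) (g : Spec R ⟶ T) :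
    ∃ (κ : k →+* R) (η : Fin 3 → Fin 2 → R), g ≫ s = Spec.map (CommRingCat.ofHom κ) ∧
      (∀ i, HasCoords κ (g ≫ b i) (η i)) ∧ ∀ i, η i (chartIndex p e i) = 1 := by
  obtain ⟨κ, hκ⟩ := exists_eq_SpecMap_ofHom (g ≫ s)
  choose η h1 hη using fun i => exists_hasCoords_of_le_std (κ := κ) (f := g ≫ b i)
    (by rw [Category.assoc, hs, hκ]) (fun x _ => h i (show g x ∈ (⊤ : T.Opens) from trivial))
  exact ⟨κ, η, hκ, hη, h1⟩

lemma toModel_modelPencil {s : T ⟶ Spec (.of k)} {b : Fin 3 → (T ⟶ PSpace k 1)} {p : Fin 3}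
    {e : Fin 2} (hs : ∀ i, b i ≫ PSpace.toSpec k 1 = s) (hb : IsHexagonal b)
    (h : ∀ i, ⊤ ≤ b i ⁻¹ᵁ PSpace.std k 1 (chartIndex p e i)) (i : Fin 3) :
    toModel s b p e h ≫ modelPencil p e i = b i := by
  refine T.affineCover.hom_ext _ _ fun j => ?_
  obtain ⟨κ, η, hκ, hη, h1⟩ := exists_coords_of_chart hs h (T.affineCover.f j)
  rw [← Category.assoc]
  have h2 := toModel_eq_modelPoint h (T.affineCover.f j) hκ hη h1
  refine Eq.trans (congrArg (· ≫ modelPencil p e i) h2) ?_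
  refine (modelPoint_modelPencil κ _ p e i).ext ?_
  rw [modelCoord_eq h1 (hb _ κ η hη)]
  exact hη i

end Model

/-- The plane coordinates are `w e`, `1` and `w 0 * w 1` in some order, so all products of two are
multiples of `w e`, and one is `w e` itself. Hence the ideal of the three points becomes invertible
on the chart. -/
lemma span_planeCoord {A : Type*} [CommRing A] (p : Fin 3) (e : Fin 2) (w : Fin 2 → A) :
    Ideal.span (Set.range fun i : Fin 3 => planeCoord p e w (i + 1) * planeCoord p e w (i + 2)) =
      Ideal.span {w e} := by
  apply le_antisymm
  · rw [Ideal.span_le]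
    rintro _ ⟨i, rfl⟩
    rw [SetLike.mem_coe, Ideal.mem_span_singleton']
    fin_cases p <;> fin_cases e <;> fin_cases i <;>
      simp [planeCoord, planeIndex] <;>
      first
        | exact ⟨1, by ring1⟩ | exact ⟨w 0, by ring1⟩ | exact ⟨w 1, by ring1⟩
        | exact ⟨w 0 * w 1, by ring1⟩
  · rw [Ideal.span_le, Set.singleton_subset_iff]
    refine Ideal.subset_span ?_
    obtain ⟨i, hi⟩ := exists_add_one_add_two (a := p) (b := planeIndex p e)
      (by revert p e; decide)
    refine ⟨i, ?_⟩
    rcases hi with ⟨h1, h2⟩ | ⟨h1, h2⟩ <;> simp only [h1, h2, planeCoord_eq_one] <;>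
      simp [planeCoord]

lemma IsBlowUp.hom_ext {X Y : Scheme.{u}} {β : X ⟶ Y} {I : Y.IdealSheafData}
    (hβ : IsBlowUp β I) {T : Scheme.{u}} {f g : T ⟶ X} (h : f ≫ β = g ≫ β)
    (hI : IsInvertibleIdeal (I.comap (g ≫ β))) : f = g :=
  (hβ.existsUnique_lift (g ≫ β) hI).unique h rfl

/-! ### The six charts of the blow-up -/

section Charts

variable {k : Type u} [Field k]

lemma X_mem_nonZeroDivisors (e : Fin 2) :
    (MvPolynomial.X e : MvPolynomial (Fin 2) k) ∈ nonZeroDivisors (MvPolynomial (Fin 2) k) :=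
  mem_nonZeroDivisors_of_ne_zero (MvPolynomial.X_ne_zero e)

lemma isInvertibleIdeal_modelPlane (p : Fin 3) (e : Fin 2) :
    IsInvertibleIdeal ((threePoints k).comap (modelPlane p e)) :=
  isInvertibleIdeal_comap _ _ (d := (MvPolynomial.X e : MvPolynomial (Fin 2) k))
    (X_mem_nonZeroDivisors e)
    ((idealAlong_threePoints (hasCoords_modelPlane p e)).trans (span_planeCoord p e _))

lemma awayHom_mem_nonZeroDivisors {R : CommRingCat.{u}} {x : R} (r : R)
    (hx : x ∈ nonZeroDivisors R) :
    (awayHom r).hom x ∈ nonZeroDivisors (Localization.Away r) :=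
  IsLocalization.map_nonZeroDivisors_le (Submonoid.powers r) _ ⟨x, hx, rfl⟩

variable {X : Scheme.{u}} {β : X ⟶ PSpace k 2}

/-- The chart of the blow-up with index `(p, e)`. -/
def blowUpChart (hβ : IsBlowUp β (threePoints k)) (p : Fin 3) (e : Fin 2) :
    Spec (modelRing k) ⟶ X :=
  (hβ.existsUnique_lift _ (isInvertibleIdeal_modelPlane p e)).choose

lemma blowUpChart_comp (hβ : IsBlowUp β (threePoints k)) (p : Fin 3) (e : Fin 2) :
    blowUpChart hβ p e ≫ β = modelPlane p e :=
  (hβ.existsUnique_lift _ (isInvertibleIdeal_modelPlane p e)).choose_spec.1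

variable {π : Fin 3 → (X ⟶ PSpace k 1)}

lemma blowUpChart_comp_pencil (hβ : IsBlowUp β (threePoints k)) (hπ : ∀ i, IsPencil β i (π i))
    (p : Fin 3) (e : Fin 2) (i : Fin 3) : blowUpChart hβ p e ≫ π i = modelPencil p e i := by
  refine HasCoords.ext ?_ (hasCoords_modelPencil p e i)
  refine HasCoords.of_cross_away ?_ (hasCoords_modelPencil p e i).span_eq_top ?_
  · rw [Category.assoc, (hπ i).over_base, ← Category.assoc, blowUpChart_comp,
      (hasCoords_modelPlane p e).toSpec]
  · intro r c ζ _ hζ a b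
    rw [← Category.assoc] at hζ
    have h2 : HasCoords ((awayHom r).hom.comp MvPolynomial.C)
        ((Spec.map (awayHom r) ≫ blowUpChart hβ p e) ≫ β)
        (planeCoord p e ((awayHom r).hom ∘ MvPolynomial.X)) := by
      have h3 := (hasCoords_modelPlane (k := k) p e).comp (awayHom r)
      rw [Category.assoc, blowUpChart_comp]
      exact h3.congr rfl (funext fun m => map_planeCoord _ _ _ _ _)
    have h4 := modelCoord_cross (p := p) (e := e) i
      (awayHom_mem_nonZeroDivisors r (X_mem_nonZeroDivisors (k := k) e))
      ((hπ i).incidence_coords h2 hζ) a b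
    refine Eq.trans (congrArg (· * ζ b) (map_modelCoord _ _ _ _ _ _)) (h4.trans ?_)
    exact congrArg (· * ζ a) (map_modelCoord _ _ _ _ _ _).symm

/-- On a chart the three incidence relations determine the point of the plane from its pencils. No
division by the exceptional equation is needed in this direction, so arbitrary test rings are
allowed. -/
lemma hasCoords_of_incidence (hπ : ∀ i, IsPencil β i (π i)) {R : CommRingCat.{u}}
    {g : Spec R ⟶ X} {κ : k →+* R} {p : Fin 3} {e : Fin 2} {w : Fin 2 → R}
    (h : ∀ i, HasCoords κ (g ≫ π i) (modelCoord p e w i)) :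
    HasCoords κ (g ≫ β) (planeCoord p e w) := by
  refine HasCoords.of_cross_away ?_ ?_ ?_
  · rw [Category.assoc, ← (hπ 0).over_base, ← Category.assoc, (h 0).toSpec]
  · exact Ideal.eq_top_of_isUnit_mem _ (Ideal.subset_span ⟨planeIndex p e, rfl⟩)
      (planeCoord_eq_one p e w ▸ isUnit_one)
  · intro r c ζ _ hζ a b
    rw [← Category.assoc] at hζ
    have h1 : ∀ i, ζ (i + 1) * modelCoord p e ((awayHom r).hom ∘ w) i 1 =
        ζ (i + 2) * modelCoord p e ((awayHom r).hom ∘ w) i 0 := by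
      intro i
      have h2 := (h i).comp (awayHom r)
      rw [← Category.assoc] at h2
      have h3 := (hπ i).incidence_coords hζ h2
      rw [← map_modelCoord, ← map_modelCoord]
      exact h3
    rw [planeCoord_cross h1 a, planeCoord_cross h1 b, map_planeCoord, map_planeCoord]
    ring

/-- Both sides have the same composite with `β`, because the pencils determine the plane
coordinates. Uniqueness in the universal property then applies, at least on small affine opens of
`X`, where the ideal of the three points is generated by a nonzerodivisor. -/
lemma toModel_blowUpChart (hβ : IsBlowUp β (threePoints k)) (hπ : ∀ i, IsPencil β i (π i))
    {p : Fin 3} {e : Fin 2} {U : X.Opens}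
    (h : ∀ i, ⊤ ≤ (U.ι ≫ π i) ⁻¹ᵁ PSpace.std k 1 (chartIndex p e i)) :
    toModel (U.ι ≫ β ≫ PSpace.toSpec k 2) (fun i => U.ι ≫ π i) p e h ≫ blowUpChart hβ p e =
      U.ι := by
  refine Scheme.hom_ext_of_forall _ _ fun x => ?_
  obtain ⟨R, g, hg, hxg, hgU, d, hd, hgd⟩ :=
    hβ.invertible.exists_openImmersion x.1 U x.2
  have hrange : Set.range g ⊆ Set.range U.ι := by
    rw [Scheme.Opens.range_ι]; exact hgU
  set g' : Spec R ⟶ U := IsOpenImmersion.lift U.ι g hrange with hg'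
  have hfac : g' ≫ U.ι = g := IsOpenImmersion.lift_fac _ _ _
  have hg'o : IsOpenImmersion g' := by
    have : IsOpenImmersion (g' ≫ U.ι) := hfac ▸ hg
    exact IsOpenImmersion.of_comp g' U.ι
  have hs : ∀ i, (U.ι ≫ π i) ≫ PSpace.toSpec k 1 = U.ι ≫ β ≫ PSpace.toSpec k 2 := by
    intro i
    rw [Category.assoc, (hπ i).over_base]
  obtain ⟨κ, η, hκ, hη, h1⟩ := exists_coords_of_chart hs h g'
  have hη' : ∀ i, HasCoords κ (g ≫ π i) (η i) := by
    intro i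
    have := hη i
    rwa [← Category.assoc, hfac] at this
  have key : g' ≫ toModel (U.ι ≫ β ≫ PSpace.toSpec k 2) (fun i => U.ι ≫ π i) p e h ≫
      blowUpChart hβ p e = g' ≫ U.ι := by
    have h2 := toModel_eq_modelPoint h g' hκ hη h1
    rw [hfac]
    refine hβ.hom_ext ?_ ?_
    · rw [Category.assoc, Category.assoc, blowUpChart_comp, ← Category.assoc, h2]
      refine (modelPoint_modelPlane κ _ p e).ext ?_
      refine hasCoords_of_incidence hπ fun i => ?_
      rw [modelCoord_eq h1 (isHexagonal_of_isPencil hπ _ κ η hη')]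
      exact hη' i
    · exact isInvertibleIdeal_comap _ _ hd ((idealAlong_comap g β _).symm.trans hgd)
  obtain ⟨y, hy⟩ := hxg
  refine ⟨g'.opensRange, ⟨y, ?_⟩, ?_⟩
  · apply Subtype.ext
    rw [← hy]
    exact congr($hfac y)
  · have h3 : g' = g'.isoOpensRange.hom ≫ g'.opensRange.ι := by simp
    rw [h3, Category.assoc, Category.assoc, Iso.cancel_iso_hom_left] at key
    exact key

end Charts

/-! ### The blow-up represents hexagonal triples -/

section Representability

variable {k : Type u} [Field k] {X : Scheme.{u}} {β : X ⟶ PSpace k 2}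
  {π : Fin 3 → (X ⟶ PSpace k 1)} {T : Scheme.{u}}

lemma IsHexagonal.comp {b : Fin 3 → (T ⟶ PSpace k 1)} (hb : IsHexagonal b) {T' : Scheme.{u}}
    (f : T' ⟶ T) : IsHexagonal fun i => f ≫ b i := by
  intro R g κ η hη
  exact hb (g ≫ f) κ η fun i => by rw [Category.assoc]; exact hη i

lemma chartOpen_ι_le (b : Fin 3 → (T ⟶ PSpace k 1)) (p : Fin 3) (e : Fin 2) (i : Fin 3) :
    ⊤ ≤ ((chartOpen b p e).ι ≫ b i) ⁻¹ᵁ PSpace.std k 1 (chartIndex p e i) :=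
  fun x _ => chartOpen_le b p e i x.2

/-- A formula for an `R`-point of a chart in terms of its pencils only. It needs no invertibility of
the pulled back ideal, unlike the universal property of the blow-up, and therefore gives
`hom_ext_pencils` for arbitrary sources. -/
lemma eq_modelPoint_blowUpChart (hβ : IsBlowUp β (threePoints k))
    (hπ : ∀ i, IsPencil β i (π i)) {p : Fin 3} {e : Fin 2} {R : CommRingCat.{u}} {g : Spec R ⟶ X}
    {κ : k →+* R} {η : Fin 3 → Fin 2 → R} (hη : ∀ i, HasCoords κ (g ≫ π i) (η i))
    (h1 : ∀ i, η i (chartIndex p e i) = 1) :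
    g = modelPoint κ ![η (p + 1) (e + 1), η (p + 2) (e + 1)] ≫ blowUpChart hβ p e := by
  have hrange : Set.range g ⊆ Set.range (chartOpen π p e).ι := by
    rw [Scheme.Opens.range_ι]
    rintro _ ⟨x, rfl⟩
    rw [SetLike.mem_coe, mem_chartOpen_iff]
    intro i
    exact (hη i).le_std (h1 i ▸ isUnit_one) (show x ∈ (⊤ : (Spec R).Opens) from trivial)
  set g' := IsOpenImmersion.lift (chartOpen π p e).ι g hrange with hg'
  have hfac : g' ≫ (chartOpen π p e).ι = g := IsOpenImmersion.lift_fac _ _ _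
  have hη' : ∀ i, HasCoords κ (g' ≫ (chartOpen π p e).ι ≫ π i) (η i) := by
    intro i
    rw [← Category.assoc, hfac]
    exact hη i
  have hκ : g' ≫ (chartOpen π p e).ι ≫ β ≫ PSpace.toSpec k 2 =
      Spec.map (CommRingCat.ofHom κ) := by
    rw [← (hη' 0).toSpec, ← (hπ 0).over_base]
    simp only [Category.assoc]
  have h2 := toModel_eq_modelPoint (chartOpen_ι_le π p e) g' hκ hη' h1
  rw [← h2, Category.assoc, toModel_blowUpChart hβ hπ, hfac]

lemma hom_ext_pencils (hβ : IsBlowUp β (threePoints k)) (hπ : ∀ i, IsPencil β i (π i))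
    {φ φ' : T ⟶ X} (h : ∀ i, φ ≫ π i = φ' ≫ π i) : φ = φ' := by
  refine Scheme.hom_ext_of_forall _ _ fun x => ?_
  have hs : ∀ i, (φ ≫ π i) ≫ PSpace.toSpec k 1 = φ ≫ β ≫ PSpace.toSpec k 2 := by
    intro i
    rw [Category.assoc, (hπ i).over_base]
  obtain ⟨p, e, hx⟩ := exists_mem_chartOpen (IsHexagonal.comp (isHexagonal_of_isPencil hπ) φ) hs x
  obtain ⟨V, hV, hxV, hVU⟩ := exists_isAffineOpen_mem_and_subset hx
  refine ⟨V, hxV, ?_⟩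
  have hle : ∀ i, ⊤ ≤ (hV.fromSpec ≫ φ ≫ π i) ⁻¹ᵁ PSpace.std k 1 (chartIndex p e i) := by
    intro i y _
    refine chartOpen_le (fun i => φ ≫ π i) p e i (hVU ?_)
    exact hV.range_fromSpec.le ⟨y, rfl⟩
  obtain ⟨κ, η, hκ, hη, h1⟩ := exists_coords_of_chart (s := hV.fromSpec ≫ φ ≫ β ≫ PSpace.toSpec k 2)
    (b := fun i => hV.fromSpec ≫ φ ≫ π i) (fun i => by
      rw [Category.assoc, hs]) hle (𝟙 _)
  simp only [Category.id_comp] at hη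
  have e1 := eq_modelPoint_blowUpChart hβ hπ (g := hV.fromSpec ≫ φ) (fun i => by
    rw [Category.assoc]; exact hη i) h1
  have e2 := eq_modelPoint_blowUpChart hβ hπ (g := hV.fromSpec ≫ φ') (fun i => by
    rw [Category.assoc, ← h]; exact hη i) h1
  rw [← hV.isoSpec_hom_fromSpec, Category.assoc, Category.assoc, e1, e2]

/-- The blow-up of the plane in the three coordinate points is the hexagonal surface
`Y₀₀ Y₁₀ Y₂₀ = Y₀₁ Y₁₁ Y₂₁` in `(ℙ¹)³`. -/
lemma exists_lift_pencils (hβ : IsBlowUp β (threePoints k)) (hπ : ∀ i, IsPencil β i (π i))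
    {s : T ⟶ Spec (.of k)} {b : Fin 3 → (T ⟶ PSpace k 1)} (hb : IsHexagonal b)
    (hs : ∀ i, b i ≫ PSpace.toSpec k 1 = s) : ∃ φ : T ⟶ X, ∀ i, φ ≫ π i = b i := by
  let U : Fin 3 × Fin 2 → T.Opens := fun q => chartOpen b q.1 q.2
  have hU : ⨆ q, U q = ⊤ := by
    rw [eq_top_iff]
    intro x _
    obtain ⟨p, e, hx⟩ := exists_mem_chartOpen hb hs x
    exact Opens.mem_iSup.2 ⟨(p, e), hx⟩
  let 𝒰 := T.openCoverOfIsOpenCover U hU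
  let f : ∀ q : Fin 3 × Fin 2, (U q).toScheme ⟶ X := fun q =>
    toModel ((U q).ι ≫ s) (fun i => (U q).ι ≫ b i) q.1 q.2 (chartOpen_ι_le b q.1 q.2) ≫
      blowUpChart hβ q.1 q.2
  have hf : ∀ q i, f q ≫ π i = (U q).ι ≫ b i := by
    intro q i
    rw [Category.assoc, blowUpChart_comp_pencil hβ hπ]
    exact toModel_modelPencil (fun i => by rw [Category.assoc, hs]) (hb.comp _) _ i
  -- The local lifts agree on overlaps because they have the same pencils there.
  refine ⟨𝒰.glueMorphisms f fun x y => hom_ext_pencils hβ hπ fun i => ?_, fun i => ?_⟩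
  · refine (Category.assoc _ _ _).trans ((congrArg _ (hf x i)).trans (Eq.trans ?_
      ((Category.assoc _ _ _).trans (congrArg _ (hf y i))).symm))
    refine (Category.assoc _ _ _).symm.trans (Eq.trans ?_ (Category.assoc _ _ _))
    exact congrArg (· ≫ b i) pullback.condition
  · refine 𝒰.hom_ext _ _ fun q => ?_
    refine (Category.assoc _ _ _).symm.trans ?_
    refine (congrArg (· ≫ π i) (Scheme.Cover.ι_glueMorphisms 𝒰 f _ q)).trans ?_
    exact hf q i

/-- The morphism `toModel` reads the two coordinates back from the pencils and is inverse to the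
chart, regarded as a morphism to the open set `chartOpen`. -/
lemma isOpenImmersion_blowUpChart (hβ : IsBlowUp β (threePoints k))
    (hπ : ∀ i, IsPencil β i (π i)) (p : Fin 3) (e : Fin 2) :
    IsOpenImmersion (blowUpChart hβ p e) ∧ Set.range (blowUpChart hβ p e) = chartOpen π p e := by
  set U := chartOpen π p e
  set m := toModel (U.ι ≫ β ≫ PSpace.toSpec k 2) (fun i => U.ι ≫ π i) p e (chartOpen_ι_le π p e)
    with hm
  have h1 : m ≫ blowUpChart hβ p e = U.ι := toModel_blowUpChart hβ hπ _
  have hrange : Set.range (blowUpChart hβ p e) ⊆ Set.range U.ι := by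
    rw [Scheme.Opens.range_ι]
    rintro _ ⟨x, rfl⟩
    rw [SetLike.mem_coe, mem_chartOpen_iff]
    intro i
    have h2 := (hasCoords_modelPencil (k := k) p e i).le_std
      (b := chartIndex p e i)
      (modelCoord_chartIndex p e (A := modelRing k) _ i ▸ isUnit_one)
      (show x ∈ (⊤ : (Spec _).Opens) from trivial)
    rw [← blowUpChart_comp_pencil hβ hπ] at h2
    exact h2
  set j := IsOpenImmersion.lift U.ι _ hrange with hj
  have hfac : j ≫ U.ι = blowUpChart hβ p e := IsOpenImmersion.lift_fac _ _ _
  have h3 : m ≫ j = 𝟙 _ := by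
    rw [← cancel_mono U.ι, Category.assoc, hfac, h1, Category.id_comp]
  have h4 : j ≫ m = 𝟙 _ := by
    have h5 := toModel_eq_modelPoint (s := U.ι ≫ β ≫ PSpace.toSpec k 2)
      (b := fun i => U.ι ≫ π i) (chartOpen_ι_le π p e) j
      (κ := (MvPolynomial.C : k →+* modelRing k))
      (η := fun i => modelCoord p e MvPolynomial.X i) ?_ ?_ (modelCoord_chartIndex p e _)
    · rw [← hm] at h5
      rw [h5, ← modelPoint_id]
      congr 1
      funext a
      fin_cases a <;> fin_cases p <;> fin_cases e <;>
        simp [modelCoord, chartIndex, modelFrac]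
    · rw [← Category.assoc, hfac, ← Category.assoc, blowUpChart_comp,
        (hasCoords_modelPlane p e).toSpec]
    · intro i
      rw [← Category.assoc, hfac, blowUpChart_comp_pencil hβ hπ]
      exact hasCoords_modelPencil p e i
  have : IsIso j := ⟨m, h4, h3⟩
  refine ⟨hfac ▸ inferInstance, ?_⟩
  refine subset_antisymm (hrange.trans (by rw [Scheme.Opens.range_ι])) ?_
  rintro x hx
  exact ⟨m ⟨x, hx⟩, congr($h1 ⟨x, hx⟩)⟩

end Representability

lemma hom_ext_of_openImmersion {T Z : Scheme.{u}} {f f' : T ⟶ Z}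
    (h : ∀ x : T, ∃ (W : Scheme.{u}) (g : W ⟶ T) (_ : IsOpenImmersion g), x ∈ Set.range g ∧
      g ≫ f = g ≫ f') : f = f' := by
  refine Scheme.hom_ext_of_forall _ _ fun x => ?_
  obtain ⟨W, g, hg, hx, he⟩ := h x
  refine ⟨g.opensRange, hx, ?_⟩
  have h3 : g = g.isoOpensRange.hom ≫ g.opensRange.ι := by simp
  rw [h3, Category.assoc, Category.assoc, Iso.cancel_iso_hom_left] at he
  exact he

/-! ### Graded substitutions in homogeneous coordinates -/

section ProjMap

open MvPolynomial HomogeneousLocalization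

variable {k : Type u} [Field k] {n : ℕ} {R : CommRingCat.{u}}

lemma pointAt_projMap {φ : GradedRingHom (grading k n) (grading k n)}
    (hφ : HomogeneousIdeal.irrelevant (grading k n) ≤
      (HomogeneousIdeal.irrelevant (grading k n)).map φ) (κ : k →+* R)
    (ξ ζ : Fin (n + 1) → R) (hζ : ∀ p, (φ p).eval₂ κ ξ = p.eval₂ κ ζ) (b c : Fin (n + 1))
    (hb : IsUnit (ξ b)) (hc : IsUnit (ζ c)) :
    pointAt κ ξ b hb ≫ Proj.map φ hφ = pointAt κ ζ c hc := by
  have hc' : IsUnit ((φ (X c)).eval₂ κ ξ) := by rwa [hζ, eval₂_X]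
  have h1 : pointAt κ ξ b hb = pointOf κ ξ (φ (X c)) (φ.map_mem (X_mem c)) one_pos hc' :=
    pointOf_eq _ _ _ _ _ _ _ _ _ _
  rw [h1, pointOf, Category.assoc]
  refine (congrArg _ (Proj.awayι_comp_map φ hφ one_pos (X c) (X_mem c))).trans ?_
  rw [← Category.assoc, ← Spec.map_comp, ← CommRingCat.ofHom_comp, pointAt, pointOf]
  congr 3
  refine evalAway_unique κ ζ (X c) (by rwa [eval₂_X]) (X_mem c) _ fun m p hp => ?_
  rw [RingHom.comp_apply, Away.map_mk, ← hζ, ← hζ]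
  exact evalAway_mk κ ξ (φ (X c)) hc' (φ.map_mem (X_mem c)) m (φ p) (φ.map_mem hp)

lemma HasCoords.projMap {κ : k →+* R} {f : Spec R ⟶ PSpace k n} {ξ : Fin (n + 1) → R}
    (h : HasCoords κ f ξ) {φ : GradedRingHom (grading k n) (grading k n)}
    (hφ : HomogeneousIdeal.irrelevant (grading k n) ≤
      (HomogeneousIdeal.irrelevant (grading k n)).map φ) {ζ : Fin (n + 1) → R}
    (hζ : ∀ p, (φ p).eval₂ κ ξ = p.eval₂ κ ζ) (hspan : Ideal.span (Set.range ζ) = ⊤) :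
    HasCoords κ (f ≫ Proj.map φ hφ) ζ where
  span_eq_top := hspan
  map_eq {S} α c hc := by
    refine spec_hom_ext fun p => ?_
    obtain ⟨b, hb⟩ := exists_notMem_of_span_eq_top (span_map_eq_top h.span_eq_top α) p
    refine ⟨α.hom (ξ b), hb, ?_⟩
    have h1 := h.map_eq (α ≫ awayHom (α.hom (ξ b))) b (isUnit_awayHom _)
    rw [Spec.map_comp, Category.assoc] at h1
    rw [SpecMap_pointAt, ← Category.assoc, ← Category.assoc, Category.assoc (Spec.map _), h1]
    refine pointAt_projMap hφ _ _ _ (fun p => ?_) _ _ _ _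
    have h2 := congrArg (α ≫ awayHom (α.hom (ξ b))).hom (hζ p)
    rw [eval₂_comp_left, eval₂_comp_left] at h2
    exact h2

end ProjMap

/-! ### Monomial and linear automorphisms of the projective line -/

section LinearMaps

open MvPolynomial

variable {k : Type u} [Field k] {R : CommRingCat.{u}}

lemma span_pair_eq_top {A : Type*} [CommRing A] {ι : Type*} {ξ ζ : ι → A}
    (hξ : Ideal.span (Set.range ξ) = ⊤) (h : ∀ a, ξ a ∈ Ideal.span (Set.range ζ)) :
    Ideal.span (Set.range ζ) = ⊤ := by
  rw [eq_top_iff, ← hξ, Ideal.span_le]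
  rintro _ ⟨a, rfl⟩
  exact h a

lemma HasCoords.monomialMap {κ : k →+* R} {f : Spec R ⟶ PSpace k 1} {ξ : Fin 2 → R}
    (h : HasCoords κ f ξ) (s : Fin 2 → kˣ) (ε : Equiv.Perm (Fin 2)) :
    HasCoords κ (f ≫ monomialMap s ε) (fun a => κ (s a) * ξ (ε a)) := by
  refine h.projMap (irrelevant_le_monomialHom s ε) (fun p => ?_)
    (span_pair_eq_top h.span_eq_top fun a => ?_)
  · change eval₂ κ ξ (MvPolynomial.aeval (R := k) _ p) = _
    rw [MvPolynomial.aeval_def, ← coe_eval₂Hom κ ξ, eval₂_comp_left]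
    congr 1
    · ext r; simp
    · funext a; simp
  · have h1 : ξ a = κ (s (ε.symm a))⁻¹.1 * (κ (s (ε.symm a)) * ξ (ε (ε.symm a))) := by
      rw [← mul_assoc, ← map_mul, Units.inv_mul, map_one, one_mul, Equiv.apply_symm_apply]
    rw [h1]
    exact Ideal.mul_mem_left _ _ (Ideal.subset_span ⟨_, rfl⟩)

/-- The linear substitution given by a matrix. -/
def linHom (M : Matrix (Fin 2) (Fin 2) k) : GradedRingHom (grading k 1) (grading k 1) where
  toRingHom := (MvPolynomial.aeval fun a => linearForm (M a)).toRingHom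
  map_mem := by
    intro i x hx
    have h := MvPolynomial.IsHomogeneous.aeval (n := 1) hx
      (fun a : Fin 2 => linearForm (M a)) (fun a => linearForm_mem (M a))
    simpa using h

lemma linHom_linHom (M N : Matrix (Fin 2) (Fin 2) k) (hNM : N * M = 1)
    (x : MvPolynomial (Fin 2) k) : linHom M (linHom N x) = x := by
  change MvPolynomial.aeval _ (MvPolynomial.aeval _ x) = x
  rw [← AlgHom.comp_apply]
  conv_rhs => rw [← AlgHom.id_apply (R := k) x]
  congr 1
  ext a : 1
  have h := fun c => congrFun (congrFun hNM a) c
  simp only [Matrix.mul_apply, Fin.sum_univ_two] at h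
  have h0 := h 0
  have h1 := h 1
  simp only [AlgHom.comp_apply, aeval_X, AlgHom.id_apply, linearForm, map_add, map_mul,
    algHom_C, algebraMap_eq]
  have e : C (N a 0) * (C (M 0 0) * X 0 + C (M 0 1) * X 1) +
      C (N a 1) * (C (M 1 0) * X 0 + C (M 1 1) * X 1) =
      (C (N a 0 * M 0 0 + N a 1 * M 1 0) * X 0 + C (N a 0 * M 0 1 + N a 1 * M 1 1) * X 1 :
        MvPolynomial (Fin 2) k) := by
    simp only [map_add, map_mul]; ring
  rw [e, h0, h1]
  fin_cases a <;> simp [Matrix.one_apply]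

lemma irrelevant_le_linHom (M : GL (Fin 2) k) :
    HomogeneousIdeal.irrelevant (grading k 1) ≤
      (HomogeneousIdeal.irrelevant (grading k 1)).map (linHom M.1) := by
  rw [HomogeneousIdeal.irrelevant_le]
  intro i hi x hx
  have h := Ideal.mem_map_of_mem (linHom M.1)
    (HomogeneousIdeal.mem_irrelevant_of_mem (grading k 1) hi ((linHom M⁻¹.1).map_mem hx))
  exact (congrArg (· ∈ _) (linHom_linHom M.1 M⁻¹.1 (Units.inv_mul M) x)).mp h

/-- The automorphism of the projective line given by a matrix. -/
def linMap (M : GL (Fin 2) k) : PSpace k 1 ⟶ PSpace k 1 :=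
  Proj.map (linHom M.1) (irrelevant_le_linHom M)

/-- The action of a matrix over the base field on pairs of coordinates. -/
def linCoord {A : Type*} [CommRing A] (κ : k →+* A) (M : GL (Fin 2) k) (ξ : Fin 2 → A)
    (a : Fin 2) : A := κ (M.1 a 0) * ξ 0 + κ (M.1 a 1) * ξ 1

lemma linCoord_linCoord {A : Type*} [CommRing A] (κ : k →+* A) (M N : GL (Fin 2) k)
    (ξ : Fin 2 → A) : linCoord κ M (linCoord κ N ξ) = linCoord κ (M * N) ξ := by
  funext a
  simp only [linCoord, Units.val_mul, Matrix.mul_apply, Fin.sum_univ_two, map_add, map_mul]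
  ring

lemma linCoord_one {A : Type*} [CommRing A] (κ : k →+* A) (ξ : Fin 2 → A) :
    linCoord κ 1 ξ = ξ := by
  funext a
  fin_cases a <;> simp [linCoord]

lemma HasCoords.linMap {κ : k →+* R} {f : Spec R ⟶ PSpace k 1} {ξ : Fin 2 → R}
    (h : HasCoords κ f ξ) (M : GL (Fin 2) k) :
    HasCoords κ (f ≫ ThreePairs.linMap M) (linCoord κ M ξ) := by
  refine h.projMap (irrelevant_le_linHom M) (fun p => ?_)
    (span_pair_eq_top h.span_eq_top fun a => ?_)
  · change eval₂ κ ξ (MvPolynomial.aeval (R := k) _ p) = _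
    rw [MvPolynomial.aeval_def, ← coe_eval₂Hom κ ξ, eval₂_comp_left]
    congr 1
    · ext r; simp
    · funext a; simp [linearForm, linCoord]
  · have h1 : ξ a = linCoord κ M⁻¹ (linCoord κ M ξ) a := by
      rw [linCoord_linCoord, inv_mul_cancel, linCoord_one]
    rw [h1]
    exact add_mem (Ideal.mul_mem_left _ _ (Ideal.subset_span ⟨_, rfl⟩))
      (Ideal.mul_mem_left _ _ (Ideal.subset_span ⟨_, rfl⟩))

lemma hom_ext_chartι {n : ℕ} {Z : Scheme.{u}} {f g : PSpace k n ⟶ Z}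
    (h : ∀ b, chartι k b ≫ f = chartι k b ≫ g) : f = g := by
  refine hom_ext_of_openImmersion fun x => ?_
  obtain ⟨b, hb⟩ := exists_mem_std x
  refine ⟨_, chartι k b, inferInstance, ?_, h b⟩
  have : x ∈ (chartι k b).opensRange := by rwa [Proj.opensRange_awayι]
  exact this

lemma linMap_toSpec (M : GL (Fin 2) k) :
    linMap M ≫ PSpace.toSpec k 1 = PSpace.toSpec k 1 := by
  refine hom_ext_chartι fun b => ?_
  have h := hasCoords_chartι (k := k) (n := 1) b
  rw [← Category.assoc, (h.linMap M).toSpec, h.toSpec]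

lemma linMap_linMap_inv (M : GL (Fin 2) k) : linMap M ≫ linMap M⁻¹ = 𝟙 _ := by
  refine hom_ext_chartι fun b => ?_
  have h := hasCoords_chartι (k := k) (n := 1) b
  have h1 := (h.linMap M).linMap M⁻¹
  rw [linCoord_linCoord, inv_mul_cancel, linCoord_one] at h1
  rw [← Category.assoc, Category.comp_id]
  exact h1.ext h

end LinearMaps

/-! ### Linear equations of the chosen members -/

section Equations

variable {k : Type u} [Field k] {R : CommRingCat.{u}}

/-- The linear form with coefficients `l` is an equation of the closed point `p` of `ℙ¹`. -/
def IsEquation (l : Fin 2 → k) (p : closedPoints (PSpace k 1)) : Prop :=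
  ∀ {R : CommRingCat.{u}} {κ : k →+* R} {f : Spec R ⟶ PSpace k 1} {ξ : Fin 2 → R},
    HasCoords κ f ξ →
      idealAlong f (Scheme.IdealSheafData.vanishingIdeal ⟨{p.1}, p.2⟩) =
        Ideal.span {κ (l 0) * ξ 0 + κ (l 1) * ξ 1}

lemma IsEquation.apply_eq_iff {l : Fin 2 → k} {p : closedPoints (PSpace k 1)}
    (h : IsEquation l p) {κ : k →+* R} {f : Spec R ⟶ PSpace k 1} {ξ : Fin 2 → R}
    (hξ : HasCoords κ f ξ) (x : Spec R) :
    f x = p.1 ↔ κ (l 0) * ξ 0 + κ (l 1) * ξ 1 ∈ x.asIdeal := by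
  have h1 := mem_support_iff_idealAlong_le f
    (Scheme.IdealSheafData.vanishingIdeal ⟨{p.1}, p.2⟩) x
  rw [h hξ, Ideal.span_singleton_le_iff_mem, ← SetLike.mem_coe,
    Scheme.IdealSheafData.coe_support_vanishingIdeal] at h1
  exact h1

/-- Proportional forms have the common zero `[l 1 : -l 0]`, a rational point that must be both `p`
and `p'`. -/
lemma IsEquation.eq_of_det_eq_zero {l l' : Fin 2 → k} {p p' : closedPoints (PSpace k 1)}
    (h : IsEquation l p) (h' : IsEquation l' p') (hl : l ≠ 0)
    (hdet : l 0 * l' 1 = l 1 * l' 0) : p = p' := by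
  let κ : k →+* CommRingCat.of k := RingHom.id k
  obtain ⟨b, hb⟩ : ∃ b, IsUnit ((![l 1, -l 0] : Fin 2 → CommRingCat.of k) b) := by
    by_contra! hne
    refine hl (funext fun c => ?_)
    have h0 : ¬ IsUnit (l 1) := hne 0
    have h1 : ¬ IsUnit (-l 0) := hne 1
    rw [isUnit_iff_ne_zero, not_not] at h0 h1
    fin_cases c
    · exact neg_eq_zero.1 h1
    · exact h0
  have hc := hasCoords_pointAt (n := 1) κ _ b hb
  let x : Spec (.of k) := (⊥ : PrimeSpectrum k)
  have e1 := (h.apply_eq_iff hc x).2 (by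
    change l 0 * l 1 + l 1 * -l 0 ∈ _
    rw [show l 0 * l 1 + l 1 * -l 0 = 0 by ring]
    exact zero_mem _)
  have e2 := (h'.apply_eq_iff hc x).2 (by
    change l' 0 * l 1 + l' 1 * -l 0 ∈ _
    rw [show l' 0 * l 1 + l' 1 * -l 0 = 0 by linear_combination -hdet]
    exact zero_mem _)
  exact Subtype.ext (e1.symm.trans e2)

/-- Two distinct points of the projective line are the zeros of the coordinates in a suitable
coordinate system. -/
lemma exists_isEquation [IsAlgClosed k] {a : Fin 2 → closedPoints (PSpace k 1)}
    (ha : a 0 ≠ a 1) : ∃ M : GL (Fin 2) k, ∀ e, IsEquation (M.1 e) (a e) := by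
  choose l hl h using fun e => exists_linearForm (a e)
  have hdet : IsUnit (Matrix.of l).det := by
    rw [isUnit_iff_ne_zero, Matrix.det_fin_two]
    intro h0
    exact ha (IsEquation.eq_of_det_eq_zero (h 0) (h 1) (hl 0) (sub_eq_zero.1 h0))
  exact ⟨Matrix.GeneralLinearGroup.mk'' (Matrix.of l) hdet, fun e => h e⟩

lemma idealAlong_pairsDivisor {X : Scheme.{u}} {π : Fin 3 → (X ⟶ PSpace k 1)}
    {a : Fin 3 → Fin 2 → closedPoints (PSpace k 1)} {M : Fin 3 → GL (Fin 2) k}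
    (hM : ∀ i e, IsEquation ((M i).1 e) (a i e)) {κ : k →+* R} {g : Spec R ⟶ X}
    {η : Fin 3 → Fin 2 → R} (hη : ∀ i, HasCoords κ (g ≫ π i) (η i)) :
    idealAlong g (pairsDivisor π a) =
      Ideal.span {∏ p : Fin 3 × Fin 2, linCoord κ (M p.1) (η p.1) p.2} := by
  have h : ∀ i e, idealAlong g (fibreIdeal (π i) (a i e)) =
      Ideal.span {linCoord κ (M i) (η i) e} := fun i e => by
    rw [fibreIdeal, idealAlong_comap, hM i e (hη i)]
    rfl
  rw [pairsDivisor, idealAlong_prod, Fintype.prod_prod_type]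
  simp only [idealAlong_prod, h, Ideal.prod_span_singleton]

end Equations

/-! ### Morphisms to the cube and the hexagonal form in new coordinates -/

section CubeMaps

variable {k : Type u} [Field k] {R : CommRingCat.{u}} {T : Scheme.{u}}

lemma Cube.lift_proj {s : T ⟶ Spec (.of k)} {f : Fin 3 → (T ⟶ PSpace k 1)}
    (hf : ∀ i, f i ≫ PSpace.toSpec k 1 = s) (i : Fin 3) :
    Cube.lift s f hf ≫ Cube.proj k i = f i := by
  fin_cases i
  · exact pullback.lift_fst _ _ _
  · refine (Category.assoc _ _ _).symm.trans ?_
    refine (congrArg (· ≫ _) (pullback.lift_snd _ _ _)).trans ?_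
    exact pullback.lift_fst _ _ _
  · refine (Category.assoc _ _ _).symm.trans ?_
    refine (congrArg (· ≫ _) (pullback.lift_snd _ _ _)).trans ?_
    exact pullback.lift_snd _ _ _

lemma Cube.hom_ext {f g : T ⟶ Cube k} (h : ∀ i, f ≫ Cube.proj k i = g ≫ Cube.proj k i) :
    f = g := by
  refine pullback.hom_ext (h 0) (pullback.hom_ext ?_ ?_)
  · exact (Category.assoc _ _ _).trans ((h 1).trans (Category.assoc _ _ _).symm)
  · exact (Category.assoc _ _ _).trans ((h 2).trans (Category.assoc _ _ _).symm)

lemma idealAlong_triDivisor (c : (Fin 3 → Fin 2) → k) {κ : k →+* R} {g : Spec R ⟶ Cube k}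
    {ξ : Fin 3 → Fin 2 → R} (hξ : ∀ i, HasCoords κ (g ≫ Cube.proj k i) (ξ i)) :
    idealAlong g (triDivisor c) = Ideal.span {∑ v, κ (c v) * ∏ i, ξ i (v i)} := by
  rw [triDivisor, idealAlong_zeroScheme (isMultihomogeneous_tri c) g hξ]
  simp [MvPolynomial.eval₂_sum, MvPolynomial.eval₂_mul, MvPolynomial.eval₂_prod]

lemma idealAlong_boundary {κ : k →+* R} {g : Spec R ⟶ Cube k}
    {ξ : Fin 3 → Fin 2 → R} (hξ : ∀ i, HasCoords κ (g ≫ Cube.proj k i) (ξ i)) :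
    idealAlong g (Cube.boundary k) = Ideal.span {∏ p : Fin 3 × Fin 2, ξ p.1 p.2} := by
  rw [Cube.boundary, idealAlong_zeroScheme isMultihomogeneous_boundary g hξ]
  simp [MvPolynomial.eval₂_prod]

lemma exists_coords_of_isLocalRing [IsLocalRing R] {s : T ⟶ Spec (.of k)}
    {b : Fin 3 → (T ⟶ PSpace k 1)} (hs : ∀ i, b i ≫ PSpace.toSpec k 1 = s) (g : Spec R ⟶ T) :
    ∃ (κ : k →+* R) (η : Fin 3 → Fin 2 → R), g ≫ s = Spec.map (CommRingCat.ofHom κ) ∧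
      ∀ i, HasCoords κ (g ≫ b i) (η i) := by
  obtain ⟨κ, hκ⟩ := exists_eq_SpecMap_ofHom (g ≫ s)
  choose η v _ hη using fun i => exists_hasCoords_of_isLocalRing (κ := κ) (f := g ≫ b i)
    (by rw [Category.assoc, hs, hκ])
  exact ⟨κ, η, hκ, hη⟩

/-- The coefficients of the hexagonal equation in other coordinates. -/
def hexagonCoeff (N : Fin 3 → GL (Fin 2) k) (v : Fin 3 → Fin 2) : k :=
  ∏ i, (N i).1 0 (v i) - ∏ i, (N i).1 1 (v i)

lemma sum_hexagonCoeff {A : Type*} [CommRing A] (κ : k →+* A) (N : Fin 3 → GL (Fin 2) k)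
    (ξ : Fin 3 → Fin 2 → A) : ∑ v, κ (hexagonCoeff N v) * ∏ i, ξ i (v i) =
      ∏ i, linCoord κ (N i) (ξ i) 0 - ∏ i, linCoord κ (N i) (ξ i) 1 := by
  have h : ∀ a : Fin 2, ∏ i, linCoord κ (N i) (ξ i) a =
      ∑ v : Fin 3 → Fin 2, (∏ i, κ ((N i).1 a (v i))) * ∏ i, ξ i (v i) := by
    intro a
    have h1 : ∀ i, linCoord κ (N i) (ξ i) a = ∑ e : Fin 2, κ ((N i).1 a e) * ξ i e := by
      intro i; rw [Fin.sum_univ_two]; rfl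
    simp only [h1, Fintype.prod_sum, Finset.prod_mul_distrib]
  rw [h, h, ← Finset.sum_sub_distrib]
  refine Finset.sum_congr rfl fun v _ => ?_
  rw [hexagonCoeff, map_sub, map_prod, map_prod, sub_mul]

end CubeMaps

/-! ### Existence of the tridegree (1,1,1) model -/

section Existence

variable {k : Type u} [Field k] {X : Scheme.{u}} {β : X ⟶ PSpace k 2}
  {π : Fin 3 → (X ⟶ PSpace k 1)}

lemma linMap_inv_linMap (M : GL (Fin 2) k) : linMap M⁻¹ ≫ linMap M = 𝟙 _ := by
  simpa using linMap_linMap_inv M⁻¹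

/-- The morphism to `(ℙ¹)³` given by the pencils after changes of coordinates. -/
def toCube (hπ : ∀ i, IsPencil β i (π i)) (M : Fin 3 → GL (Fin 2) k) : X ⟶ Cube k :=
  Cube.lift (β ≫ PSpace.toSpec k 2) (fun i => π i ≫ linMap (M i))
    (fun i => by rw [Category.assoc, linMap_toSpec, (hπ i).over_base])

lemma toCube_proj (hπ : ∀ i, IsPencil β i (π i)) (M : Fin 3 → GL (Fin 2) k) (i : Fin 3) :
    toCube hπ M ≫ Cube.proj k i = π i ≫ linMap (M i) := Cube.lift_proj _ i

lemma hasCoords_toCube (hπ : ∀ i, IsPencil β i (π i)) (M : Fin 3 → GL (Fin 2) k)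
    {R : CommRingCat.{u}} {κ : k →+* R} {g : Spec R ⟶ X} {η : Fin 3 → Fin 2 → R}
    (hη : ∀ i, HasCoords κ (g ≫ π i) (η i)) (i : Fin 3) :
    HasCoords κ ((g ≫ toCube hπ M) ≫ Cube.proj k i) (linCoord κ (M i) (η i)) := by
  have h := (hη i).linMap (M i)
  rw [Category.assoc] at h
  rwa [Category.assoc, toCube_proj]

lemma hasCoords_of_toCube (hπ : ∀ i, IsPencil β i (π i)) (M : Fin 3 → GL (Fin 2) k)
    {R : CommRingCat.{u}} {κ : k →+* R} {g : Spec R ⟶ X} {i : Fin 3} {ξ : Fin 2 → R}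
    (h : HasCoords κ ((g ≫ toCube hπ M) ≫ Cube.proj k i) ξ) :
    HasCoords κ (g ≫ π i) (linCoord κ (M i)⁻¹ ξ) := by
  rw [Category.assoc, toCube_proj] at h
  have h1 := h.linMap (M i)⁻¹
  rwa [Category.assoc, Category.assoc, linMap_linMap_inv, Category.comp_id] at h1

lemma toCube_toSpec (hπ : ∀ i, IsPencil β i (π i)) (M : Fin 3 → GL (Fin 2) k) :
    toCube hπ M ≫ Cube.toSpec k = β ≫ PSpace.toSpec k 2 := by
  rw [← Cube.proj_toSpec k 0, ← Category.assoc, toCube_proj, Category.assoc, linMap_toSpec,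
    (hπ 0).over_base]

lemma comap_toCube_boundary (hπ : ∀ i, IsPencil β i (π i)) {M : Fin 3 → GL (Fin 2) k}
    {a : Fin 3 → Fin 2 → closedPoints (PSpace k 1)}
    (hM : ∀ i e, IsEquation ((M i).1 e) (a i e)) :
    (Cube.boundary k).comap (toCube hπ M) = pairsDivisor π a := by
  refine idealSheaf_ext fun R g _ => ?_
  obtain ⟨κ, η, -, hη⟩ := exists_coords_of_isLocalRing (fun i => (hπ i).over_base) g
  rw [idealAlong_comap, idealAlong_boundary (hasCoords_toCube hπ M hη),
    idealAlong_pairsDivisor hM hη]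

lemma linCoord_inv_linCoord {A : Type*} [CommRing A] (κ : k →+* A) (M : GL (Fin 2) k)
    (ξ : Fin 2 → A) : linCoord κ M⁻¹ (linCoord κ M ξ) = ξ := by
  rw [linCoord_linCoord, inv_mul_cancel, linCoord_one]

lemma linCoord_linCoord_inv {A : Type*} [CommRing A] (κ : k →+* A) (M : GL (Fin 2) k)
    (ξ : Fin 2 → A) : linCoord κ M (linCoord κ M⁻¹ ξ) = ξ := by
  rw [linCoord_linCoord, mul_inv_cancel, linCoord_one]

lemma triDivisor_le_ker_toCube (hπ : ∀ i, IsPencil β i (π i)) (M : Fin 3 → GL (Fin 2) k) :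
    triDivisor (hexagonCoeff fun i => (M i)⁻¹) ≤ (toCube hπ M).ker := by
  refine le_ker_of_local _ _ fun R g _ => ?_
  obtain ⟨κ, η, -, hη⟩ := exists_coords_of_isLocalRing (fun i => (hπ i).over_base) g
  rw [idealAlong_triDivisor _ (hasCoords_toCube hπ M hη), sum_hexagonCoeff]
  simp only [linCoord_inv_linCoord]
  rw [isHexagonal_of_isPencil hπ g κ η hη, sub_self, Ideal.span_singleton_eq_bot]

/-- Undoing the coordinate changes turns the form with coefficients `hexagonCoeff` back into the
hexagonal equation. This lets the subscheme be mapped to the blow-up, which provides the inverse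
isomorphism. -/
lemma isHexagonal_subscheme (M : Fin 3 → GL (Fin 2) k) :
    IsHexagonal fun i => (triDivisor (hexagonCoeff fun i => (M i)⁻¹)).subschemeι ≫
      Cube.proj k i ≫ linMap (M i)⁻¹ := by
  intro R g κ η hη
  have h : ∀ i, HasCoords κ ((g ≫ (triDivisor (hexagonCoeff fun i => (M i)⁻¹)).subschemeι) ≫
      Cube.proj k i) (linCoord κ (M i) (η i)) := by
    intro i
    have h1 := (hη i).linMap (M i)
    simp only [Category.assoc, linMap_inv_linMap, Category.comp_id] at h1
    rwa [Category.assoc]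
  have h2 := idealAlong_subschemeι (triDivisor (hexagonCoeff fun i => (M i)⁻¹)) g
  rw [idealAlong_triDivisor _ h, Ideal.span_singleton_eq_bot, sum_hexagonCoeff] at h2
  simp only [linCoord_inv_linCoord] at h2
  exact sub_eq_zero.1 h2

/-- The blow-up is a divisor of tridegree `(1, 1, 1)` in `(ℙ¹)³`, in all coordinates. -/
theorem exists_iso_subscheme (hβ : IsBlowUp β (threePoints k)) (hπ : ∀ i, IsPencil β i (π i))
    (M : Fin 3 → GL (Fin 2) k) :
    ∃ e : X ≅ (triDivisor (hexagonCoeff fun i => (M i)⁻¹)).subscheme,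
      e.hom ≫ (triDivisor (hexagonCoeff fun i => (M i)⁻¹)).subschemeι = toCube hπ M := by
  set I := triDivisor (hexagonCoeff fun i => (M i)⁻¹) with hI
  have hle : I.subschemeι.ker ≤ (toCube hπ M).ker := by
    rw [Scheme.IdealSheafData.ker_subschemeι]
    exact triDivisor_le_ker_toCube hπ M
  let φ : X ⟶ I.subscheme := IsClosedImmersion.lift I.subschemeι (toCube hπ M) hle
  have hφ : φ ≫ I.subschemeι = toCube hπ M := IsClosedImmersion.lift_fac _ _ _
  obtain ⟨θ, hθ⟩ := exists_lift_pencils hβ hπ (isHexagonal_subscheme M)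
    (s := I.subschemeι ≫ Cube.toSpec k) (fun i => by
      simp only [Category.assoc, linMap_toSpec, Cube.proj_toSpec]
      rfl)
  refine ⟨⟨φ, θ, hom_ext_pencils hβ hπ fun i => ?_, ?_⟩, hφ⟩
  · rw [Category.assoc, hθ, ← Category.assoc, hφ, ← Category.assoc, toCube_proj,
      Category.assoc, linMap_linMap_inv, Category.comp_id, Category.id_comp]
  · rw [← cancel_mono I.subschemeι, Category.assoc, hφ, Category.id_comp]
    refine Cube.hom_ext fun i => ?_
    rw [Category.assoc, toCube_proj, ← Category.assoc, hθ, Category.assoc, Category.assoc,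
      linMap_inv_linMap, Category.comp_id]

/-- The rational points of a divisor of tridegree `(1, 1, 1)`. -/
lemma exists_point_of_sum_eq_zero {c : (Fin 3 → Fin 2) → k} (e : X ≅ (triDivisor c).subscheme)
    {ξ : Fin 3 → Fin 2 → k} {v : Fin 3 → Fin 2} (hv : ∀ i, ξ i (v i) ≠ 0)
    (hsum : ∑ w, c w * ∏ i, ξ i (w i) = 0) :
    ∃ y : Spec (.of k) ⟶ X, ∀ i, HasCoords (R := .of k) (RingHom.id k)
      ((y ≫ e.hom ≫ (triDivisor c).subschemeι) ≫ Cube.proj k i) (ξ i) := by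
  let κ : k →+* CommRingCat.of k := RingHom.id k
  let g : Spec (.of k) ⟶ Cube k := Cube.lift (Spec.map (CommRingCat.ofHom κ))
    (fun i => pointAt κ (ξ i) (v i) (isUnit_iff_ne_zero.2 (hv i)))
    fun i => pointAt_toSpec _ _ _ _
  have hg : ∀ i, HasCoords κ (g ≫ Cube.proj k i) (ξ i) := by
    intro i
    rw [Cube.lift_proj]
    exact hasCoords_pointAt _ _ _ _
  have hle : (triDivisor c).subschemeι.ker ≤ g.ker := by
    rw [Scheme.IdealSheafData.ker_subschemeι, le_ker_iff_idealAlong_eq_bot,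
      idealAlong_triDivisor _ hg, Ideal.span_singleton_eq_bot]
    exact hsum
  refine ⟨IsClosedImmersion.lift _ g hle ≫ e.inv, fun i => ?_⟩
  rw [Category.assoc (IsClosedImmersion.lift _ g hle), e.inv_hom_id_assoc,
    IsClosedImmersion.lift_fac]
  exact hg i

lemma hexagonCoeff_ne_zero (hβ : IsBlowUp β (threePoints k)) (hπ : ∀ i, IsPencil β i (π i))
    {M : Fin 3 → GL (Fin 2) k} {a : Fin 3 → Fin 2 → closedPoints (PSpace k 1)}
    (hM : ∀ i e, IsEquation ((M i).1 e) (a i e))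
    (htriple : ∀ x : X, {p : Fin 3 × Fin 2 | x ∈ fibreSet (π p.1) (a p.1 p.2)}.ncard ≤ 2)
    (v : Fin 3 → Fin 2) : hexagonCoeff (fun i => (M i)⁻¹) v ≠ 0 := by
  intro hv
  -- The torus-fixed point at the vertex `v`, where the form takes the value of its coefficient at
  -- `v`. If that is zero, the point lies on the surface, and its vanishing coordinates, of index `v
  -- i + 1`, place it on one curve from each of the three pencils.
  let ξ : Fin 3 → Fin 2 → k := fun i e => if e = v i then 1 else 0
  have hsum : ∑ w, hexagonCoeff (fun i => (M i)⁻¹) w * ∏ i, ξ i (w i) = 0 := by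
    refine Finset.sum_eq_zero fun w _ => ?_
    by_cases hw : w = v
    · rw [hw, hv, zero_mul]
    · obtain ⟨i, hi⟩ := Function.ne_iff.1 hw
      rw [Finset.prod_eq_zero (Finset.mem_univ i) (if_neg hi), mul_zero]
  obtain ⟨e, he⟩ := exists_iso_subscheme hβ hπ M
  obtain ⟨y, hy⟩ := exists_point_of_sum_eq_zero e (v := v)
    (fun i => by simp [ξ]) hsum
  rw [he] at hy
  have hη := fun i => hasCoords_of_toCube hπ M (hy i)
  let x : Spec (.of k) := (⊥ : PrimeSpectrum k)
  have hmem : ∀ i, y x ∈ fibreSet (π i) (a i (v i + 1)) := by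
    intro i
    refine (IsEquation.apply_eq_iff (hM i (v i + 1)) (hη i) x).2 ?_
    change linCoord (RingHom.id k) (M i) (linCoord (RingHom.id k) (M i)⁻¹ (ξ i)) (v i + 1) ∈ _
    rw [linCoord_linCoord_inv]
    have : ξ i (v i + 1) = 0 := if_neg (by generalize v i = e; revert e; decide)
    rw [this]
    exact zero_mem _
  have hsub : (Set.range fun i : Fin 3 => (i, v i + 1)) ⊆
      {p : Fin 3 × Fin 2 | y x ∈ fibreSet (π p.1) (a p.1 p.2)} := by
    rintro _ ⟨i, rfl⟩
    exact hmem i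
  have h3 := (Set.ncard_le_ncard hsub (Set.toFinite _)).trans (htriple (y x))
  rw [← Set.image_univ, Set.ncard_image_of_injective _ fun i j hij => congrArg Prod.fst hij] at h3
  simp at h3

theorem exists_isoToBoundaryPair [IsAlgClosed k] (hβ : IsBlowUp β (threePoints k))
    (hπ : ∀ i, IsPencil β i (π i)) {a : Fin 3 → Fin 2 → closedPoints (PSpace k 1)}
    (ha : ∀ i, a i 0 ≠ a i 1)
    (htriple : ∀ x : X, {p : Fin 3 × Fin 2 | x ∈ fibreSet (π p.1) (a p.1 p.2)}.ncard ≤ 2) :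
    ∃ c : (Fin 3 → Fin 2) → k, (∀ v, c v ≠ 0) ∧
      IsoToBoundaryPair (β ≫ PSpace.toSpec k 2) (pairsDivisor π a) (triDivisor c) := by
  choose M hM using fun i => exists_isEquation (ha i)
  obtain ⟨e, he⟩ := exists_iso_subscheme hβ hπ M
  refine ⟨_, hexagonCoeff_ne_zero hβ hπ hM htriple, e, ?_, ?_⟩
  · rw [← Category.assoc, he, toCube_toSpec]
  · rw [← Scheme.IdealSheafData.comap_comp, he, comap_toCube_boundary hπ hM]

end Existence

/-! ### Localization of domains and factorization into primes -/

section Factorization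

lemma exists_injective_lift_away {A : Type*} [CommRing A] [IsDomain A] {r : A} (hr : r ≠ 0) :
    ∃ ψ : Localization.Away r →+* FractionRing A, Function.Injective ψ ∧
      ψ.comp (algebraMap A (Localization.Away r)) = algebraMap A (FractionRing A) := by
  have hinj : Function.Injective (algebraMap A (FractionRing A)) :=
    IsFractionRing.injective A (FractionRing A)
  obtain ⟨ψ, hψ⟩ := exists_lift_away (φ := algebraMap A (FractionRing A)) (r := r)
    (isUnit_iff_ne_zero.2 fun h => hr (hinj (h.trans (map_zero _).symm)))
  refine ⟨ψ, (injective_iff_map_eq_zero ψ).2 fun x hx => ?_, hψ⟩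
  obtain ⟨⟨a, s⟩, h⟩ := IsLocalization.surj (Submonoid.powers r) x
  have h1 := congrArg ψ h
  have h2 : algebraMap A (FractionRing A) a = 0 := by
    rw [map_mul, hx, zero_mul] at h1
    exact (congr($hψ a)).symm.trans h1.symm
  have h3 : a = 0 := hinj (h2.trans (map_zero _).symm)
  change x * algebraMap A _ s.1 = algebraMap A _ a at h
  rw [h3, map_zero] at h
  exact (IsLocalization.map_units (Localization.Away r) s).mul_left_eq_zero.1 h

lemma exists_pow_mul_eq_of_away {A : Type*} [CommRing A] [IsDomain A] {r : A} (hr : r ≠ 0)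
    {x y : A} {z : Localization.Away r}
    (h : algebraMap A (Localization.Away r) x = algebraMap A _ y * z) :
    ∃ n, y ∣ r ^ n * x := by
  obtain ⟨⟨a, ⟨_, n, rfl⟩⟩, hz⟩ := IsLocalization.surj (Submonoid.powers r) z
  refine ⟨n, a, ?_⟩
  refine IsLocalization.injective (Localization.Away r)
    (powers_le_nonZeroDivisors_of_noZeroDivisors hr) ?_
  change z * algebraMap A _ (r ^ n) = algebraMap A _ a at hz
  rw [map_mul, map_mul, h, ← hz]
  ring

/-- A factorization of a product of primes is given by a distribution of the primes over the
factors. -/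
lemma exists_map_of_associated_prod {A S T : Type*} [CommRing A] [IsDomain A] [Fintype S]
    [DecidableEq S] [Nonempty S] [DecidableEq T] {f : T → A} (hf : ∀ t, Prime (f t))
    (s : Finset T) : ∀ {F : S → A}, Associated (∏ j, F j) (∏ t ∈ s, f t) →
      ∃ φ : T → S, ∀ j, Associated (F j) (∏ t ∈ s with φ t = j, f t) := by
  induction s using Finset.induction_on with
  | empty =>
    intro F h
    rw [Finset.prod_empty, associated_one_iff_isUnit] at h
    refine ⟨fun _ => Classical.arbitrary S, fun j => ?_⟩
    rw [Finset.filter_empty, Finset.prod_empty, associated_one_iff_isUnit]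
    exact isUnit_of_dvd_unit (Finset.dvd_prod_of_mem F (Finset.mem_univ j)) h
  | insert t s ht ih =>
    intro F h
    rw [Finset.prod_insert ht] at h
    -- The prime `f t` divides some factor `F j₀`. It is cancelled there, leaving `G`, and is
    -- assigned to `j₀`.
    obtain ⟨j₀, -, G, hG⟩ := (hf t).exists_mem_finset_dvd ((dvd_mul_right _ _).trans h.symm.dvd)
    have hprod : ∏ j, F j = f t * ∏ j, Function.update F j₀ G j := by
      rw [Finset.prod_update_of_mem (Finset.mem_univ j₀), ← mul_assoc, ← hG,
        Finset.sdiff_singleton_eq_erase, Finset.mul_prod_erase _ _ (Finset.mem_univ j₀)]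
    rw [hprod] at h
    obtain ⟨φ, hφ⟩ := ih (h.of_mul_left (Associated.refl _) (hf t).ne_zero)
    refine ⟨Function.update φ t j₀, fun j => ?_⟩
    have hfilter : (s.filter fun x => Function.update φ t j₀ x = j) = s.filter fun x => φ x = j :=
      Finset.filter_congr fun x hx => by
        have hxt : x ≠ t := fun h => ht (h ▸ hx)
        rw [Function.update_of_ne hxt]
    rw [Finset.filter_insert, Function.update_self, hfilter]
    have h1 := hφ j
    by_cases hj : j₀ = j
    · subst hj
      rw [Function.update_self] at h1
      rw [if_pos rfl, Finset.prod_insert (fun h => ht (Finset.mem_filter.1 h).1), hG]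
      exact h1.mul_left _
    · rw [Function.update_of_ne (Ne.symm hj)] at h1
      rwa [if_neg hj]

end Factorization

/-! ### Global coordinates over a factorial ring -/

section Coordinates

variable {k : Type u} [Field k] {R : CommRingCat.{u}}

lemma exists_isRelPrime_of_fraction {A : Type*} [CommRing A] [IsDomain A]
    [UniqueFactorizationMonoid A] {ζ : Fin 2 → FractionRing A} {c : Fin 2} (hζ : ζ c = 1) :
    ∃ ξ : Fin 2 → A, (∀ a, IsRelPrime (ξ a) (ξ (a + 1))) ∧
      ∀ a b, algebraMap A (FractionRing A) (ξ a) * ζ b = algebraMap A _ (ξ b) * ζ a := by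
  obtain ⟨P, Q, hPQ, h⟩ := IsFractionRing.exists_reduced_fraction A (ζ (c + 1))
  have h1 : ζ (c + 1) * algebraMap A _ Q.1 = algebraMap A _ P := by
    rw [← h]; exact IsLocalization.mk'_spec _ _ _
  refine ⟨fun a => if a = c then Q.1 else P, fun a => ?_, fun a b => ?_⟩
  · fin_cases a <;> fin_cases c <;> simp <;> first | exact hPQ | exact hPQ.symm
  · fin_cases a <;> fin_cases b <;> fin_cases c <;> simp at h1 hζ ⊢ <;> simp [hζ, ← h1, mul_comm]

/-- Over a factorial ring, morphisms to the projective line have global coordinates. -/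
theorem exists_hasCoords_of_ufd [IsDomain R] [UniqueFactorizationMonoid R] {κ : k →+* R}
    {f : Spec R ⟶ PSpace k 1} (hf : f ≫ PSpace.toSpec k 1 = Spec.map (CommRingCat.ofHom κ)) :
    ∃ ξ, HasCoords κ f ξ := by
  let α : R ⟶ .of (FractionRing R) := CommRingCat.ofHom (algebraMap R (FractionRing R))
  obtain ⟨ζ, c, hζc, hζ⟩ := exists_hasCoords_of_isLocalRing (R := .of (FractionRing R))
    (κ := α.hom.comp κ) (f := Spec.map α ≫ f) (by
      rw [Category.assoc, hf, ← Spec.map_comp]; rfl)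
  -- The candidate coordinates are the numerator and denominator, in lowest terms, of the morphism
  -- at the generic point.
  obtain ⟨ξ, hrel, hξ⟩ := exists_isRelPrime_of_fraction hζc
  have hcross : ∀ r c' ζ', ζ' c' = 1 →
      HasCoords ((awayHom r).hom.comp κ) (Spec.map (awayHom r) ≫ f) ζ' →
      ∀ a b, (awayHom r).hom (ξ a) * ζ' b = (awayHom r).hom (ξ b) * ζ' a := by
    intro r c' ζ' hc' hζ' a b
    -- For `r = 0` the localization is the zero ring. Otherwise it embeds into the fraction field,
    -- where proportionality with `ζ` is known.
    by_cases hr : r = 0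
    · have h0 : IsUnit (algebraMap R (Localization.Away r) r) :=
        IsLocalization.Away.algebraMap_isUnit r
      rw [(congrArg _ hr).trans (map_zero (algebraMap R (Localization.Away r))),
        isUnit_zero_iff] at h0
      have hs : Subsingleton (Localization.Away r) := subsingleton_of_zero_eq_one h0
      exact hs.elim _ _
    · obtain ⟨ψ, hψ, hψα⟩ := exists_injective_lift_away hr
      have h1 := hζ'.comp (R := .of (Localization.Away r)) (CommRingCat.ofHom ψ)
      have h2 : HasCoords (α.hom.comp κ) (Spec.map α ≫ f) (fun a => ψ (ζ' a)) := by
        have h3 : awayHom r ≫ CommRingCat.ofHom ψ = α := CommRingCat.hom_ext hψα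
        rw [← Category.assoc, ← Spec.map_comp, h3] at h1
        refine h1.congr ?_ rfl
        rw [← h3]; rfl
      refine hψ ?_
      have h4 : ∀ x, ψ ((awayHom r).hom x) = algebraMap R (FractionRing R) x := fun x =>
        congr($hψα x)
      rw [map_mul, map_mul, h4, h4]
      have e1 := hζ.cross h2 a c
      have e2 := hζ.cross h2 b c
      have e3 := hξ a c
      have e4 := hξ b c
      rw [hζc] at e1 e2 e3 e4
      linear_combination ψ (ζ' b) * e3 - ψ (ζ' a) * e4 +
        algebraMap R (FractionRing R) (ξ c) * (ζ b * e1 - ζ a * e2)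
  refine ⟨ξ, HasCoords.of_cross_away hf ?_ hcross⟩
  -- Coprime elements need not generate the unit ideal, so the morphism enters again. Near a maximal
  -- ideal `m` containing both, `f` has coordinates with one entry `1`. Then one of the `ξ` divides
  -- a power of some `r ∉ m` times the other, hence by coprimality divides the power itself, which
  -- puts `r` in `m`.
  by_contra hne
  obtain ⟨m, hm, hle⟩ := Ideal.exists_le_maximal _ hne
  let p : Spec R := ⟨m, hm.isPrime⟩
  obtain ⟨c', hc'⟩ := exists_mem_std (f p)
  obtain ⟨r, hr, hle'⟩ := exists_awayHom_le f _ p hc'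
  obtain ⟨ζ', hζc', hζ'⟩ := exists_hasCoords_of_le_std (κ := (awayHom r).hom.comp κ)
    (f := Spec.map (awayHom r) ≫ f) (by
      rw [Category.assoc, hf, ← Spec.map_comp]; rfl) hle'
  have h1 := hcross r c' ζ' hζc' hζ' (c' + 1) c'
  rw [hζc', mul_one] at h1
  have hr0 : r ≠ 0 := fun h => hr (h ▸ zero_mem _)
  obtain ⟨n, hn⟩ := exists_pow_mul_eq_of_away hr0 h1
  have h2 := (hrel c').dvd_of_dvd_mul_right hn
  have h3 : r ^ n ∈ m := m.mem_of_dvd h2 (hle (Ideal.subset_span ⟨c', rfl⟩))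
  exact hr (hm.isPrime.mem_of_pow_mem n h3)

end Coordinates

/-! ### The six curves in the affine charts -/

section ChartEquations

open MvPolynomial

variable {k : Type u} [Field k]

/-- The polynomial has degree one in some variable and its remaining term is a unit, so it is
primitive in that variable and irreducible, hence prime in the factorial ring. -/
lemma prime_C_add_C_mul_modelFrac (p i : Fin 3) {r s : k} (hr : r ≠ 0) (hs : s ≠ 0) :
    Prime (C r + C s * modelFrac p X i : MvPolynomial (Fin 2) k) := by
  have hu : IsUnit (C r : MvPolynomial (Fin 2) k) := (isUnit_iff_ne_zero.2 hr).map C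
  have hs' : (C s : MvPolynomial (Fin 2) k) ≠ 0 := by rwa [Ne, C_eq_zero]
  have h1 : ∀ j : Fin 2, Irreducible (C r + C s * X j : MvPolynomial (Fin 2) k) := by
    intro j
    rw [add_comm]
    exact irreducible_mul_X_add _ _ j hs' (by simp) (by simp) hu.isRelPrime_right
  have h2 : Irreducible (C r + C s * (X 0 * X 1) : MvPolynomial (Fin 2) k) := by
    rw [add_comm, mul_comm (X 0), ← mul_assoc]
    refine irreducible_mul_X_add _ _ 0 (mul_ne_zero hs' (X_ne_zero 1)) ?_ (by simp)
      hu.isRelPrime_right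
    rw [vars_C_mul _ hs]
    simp
  unfold modelFrac
  split_ifs
  exacts [h2.prime, (h1 0).prime, (h1 1).prime]

/-- The equations of the chosen members of the pencils on a chart. -/
def chartEq (M : Fin 3 → GL (Fin 2) k) (p : Fin 3) (e : Fin 2) (t : Fin 3 × Fin 2) :
    MvPolynomial (Fin 2) k :=
  linCoord C (M t.1) (modelCoord p e X t.1) t.2

lemma chartEq_eq (M : Fin 3 → GL (Fin 2) k) (p : Fin 3) (e : Fin 2) (t : Fin 3 × Fin 2) :
    chartEq M p e t = C ((M t.1).1 t.2 (chartIndex p e t.1)) +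
      C ((M t.1).1 t.2 (chartIndex p e t.1 + 1)) * modelFrac p X t.1 := by
  rw [chartEq, linCoord]
  unfold modelCoord
  generalize chartIndex p e t.1 = c
  fin_cases c <;> simp [add_comm]

lemma prime_chartEq {M : Fin 3 → GL (Fin 2) k} (hM : ∀ i a b, (M i).1 a b ≠ 0)
    (p : Fin 3) (e : Fin 2) (t : Fin 3 × Fin 2) : Prime (chartEq M p e t) := by
  rw [chartEq_eq]
  exact prime_C_add_C_mul_modelFrac _ _ (hM _ _ _) (hM _ _ _)

/-- Divisibility between irreducibles would make the two associated, but the equation has a nonzero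
constant term. So the generic point of each curve lies off the coordinate axes. -/
lemma X_notMem_span_chartEq {M : Fin 3 → GL (Fin 2) k} (hM : ∀ i a b, (M i).1 a b ≠ 0)
    (p : Fin 3) (e : Fin 2) (t : Fin 3 × Fin 2) (j : Fin 2) :
    (X j : MvPolynomial (Fin 2) k) ∉ Ideal.span {chartEq M p e t} := by
  rw [Ideal.mem_span_singleton]
  intro h
  have h1 : (X j : MvPolynomial (Fin 2) k) ∣ chartEq M p e t :=
    ((prime_chartEq hM p e t).irreducible.associated_of_dvd X_prime.irreducible h).symm.dvd
  obtain ⟨c, hc⟩ := h1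
  have h2 := congrArg (eval (0 : Fin 2 → k)) hc
  rw [chartEq_eq, map_mul, eval_X, Pi.zero_apply, zero_mul, map_add, map_mul, eval_C,
    map_modelFrac] at h2
  have h3 : modelFrac p (eval (0 : Fin 2 → k) ∘ X) t.1 = 0 := by
    unfold modelFrac
    split_ifs <;> simp
  rw [h3, mul_zero, add_zero] at h2
  exact hM _ _ _ h2

/-- Each equation prescribes a nonzero value for one of `w 0`, `w 1`, `w 0 * w 1`. Any two of these
can be prescribed independently, so members of different pencils meet already in the chart `(0, 0)`.
-/
lemma exists_eval_chartEq_eq_zero {M : Fin 3 → GL (Fin 2) k} (hM : ∀ i a b, (M i).1 a b ≠ 0)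
    {t t' : Fin 3 × Fin 2} (h : t.1 ≠ t'.1) :
    ∃ w : Fin 2 → k, eval w (chartEq M 0 0 t) = 0 ∧ eval w (chartEq M 0 0 t') = 0 := by
  have key : ∀ (i i' : Fin 3) (r r' : k), i ≠ i' → r ≠ 0 → r' ≠ 0 →
      ∃ w : Fin 2 → k, modelFrac 0 w i = r ∧ modelFrac 0 w i' = r' := by
    intro i i' r r' hi hr hr'
    fin_cases i <;> fin_cases i' <;> simp [modelFrac] at hi ⊢
    · exact ⟨![r', r / r'], by simp; field_simp, rfl⟩
    · exact ⟨![r / r', r'], by simp; field_simp, rfl⟩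
    · exact ⟨![r, r' / r], rfl, by simp; field_simp⟩
    · exact ⟨![r, r'], rfl, rfl⟩
    · exact ⟨![r' / r, r], rfl, by simp; field_simp⟩
    · exact ⟨![r', r], rfl, rfl⟩
  have key2 : ∀ t : Fin 3 × Fin 2, ∃ r : k, r ≠ 0 ∧ ∀ w : Fin 2 → k, modelFrac 0 w t.1 = r →
      eval w (chartEq M 0 0 t) = 0 := by
    intro t
    refine ⟨-((M t.1).1 t.2 (chartIndex 0 0 t.1) / (M t.1).1 t.2 (chartIndex 0 0 t.1 + 1)),
      neg_ne_zero.2 (div_ne_zero (hM _ _ _) (hM _ _ _)), fun w hw => ?_⟩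
    rw [chartEq_eq, map_add, map_mul, eval_C, eval_C, map_modelFrac]
    have : eval w ∘ X = w := by funext j; simp
    rw [this, hw, mul_neg, mul_div_cancel₀ _ (hM _ _ _), add_neg_cancel]
  obtain ⟨r, hr, h1⟩ := key2 t
  obtain ⟨r', hr', h2⟩ := key2 t'
  obtain ⟨w, hw, hw'⟩ := key _ _ r r' h hr hr'
  exact ⟨w, h1 w hw, h2 w hw'⟩

end ChartEquations

/-! ### Irreducible members have equations with nonzero coefficients -/

section Irreducible

open MvPolynomial

variable {k : Type u} [Field k] {X : Scheme.{u}} {β : X ⟶ PSpace k 2}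
  {π : Fin 3 → (X ⟶ PSpace k 1)}

lemma hasCoords_blowUpChart_pencil (hβ : IsBlowUp β (threePoints k))
    (hπ : ∀ i, IsPencil β i (π i)) (p : Fin 3) (e : Fin 2) (i : Fin 3) :
    HasCoords (C : k →+* modelRing k) (blowUpChart hβ p e ≫ π i)
      (modelCoord p e MvPolynomial.X i) := by
  rw [blowUpChart_comp_pencil hβ hπ]
  exact hasCoords_modelPencil p e i

/-- The reducible members of the pencils lie over the coordinate points. -/
lemma IsEquation.apply_ne_zero (hβ : IsBlowUp β (threePoints k)) (hπ : ∀ i, IsPencil β i (π i))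
    {l : Fin 2 → k} {q : closedPoints (PSpace k 1)} (h : IsEquation l q) {i : Fin 3}
    (hirr : IsIrreducible (fibreSet (π i) q)) (hl : l ≠ 0) (b : Fin 2) : l b ≠ 0 := by
  intro hb
  have hl' : l (b + 1) ≠ 0 := by
    intro hb'
    refine hl (funext fun c => ?_)
    fin_cases b <;> fin_cases c <;> simp_all
  have := (isOpenImmersion_blowUpChart hβ hπ i (b + 1)).1
  have hpre := hirr.2.preimage (blowUpChart hβ i (b + 1)).isOpenEmbedding
  have hmem : ∀ y : Spec (modelRing k), y ∈ blowUpChart hβ i (b + 1) ⁻¹' fibreSet (π i) q ↔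
      (MvPolynomial.X 0 * MvPolynomial.X 1 : MvPolynomial (Fin 2) k) ∈ y.asIdeal := by
    intro y
    refine (h.apply_eq_iff (hasCoords_blowUpChart_pencil hβ hπ i (b + 1) i) y).trans ?_
    have hu : IsUnit (C (l (b + 1)) : MvPolynomial (Fin 2) k) := (isUnit_iff_ne_zero.2 hl').map C
    have h2 : C (l 0) * modelCoord i (b + 1) MvPolynomial.X i 0 +
        C (l 1) * modelCoord i (b + 1) MvPolynomial.X i 1 =
        C (l (b + 1)) * (MvPolynomial.X 0 * MvPolynomial.X 1 : MvPolynomial (Fin 2) k) := by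
      fin_cases b <;> simp_all [modelCoord, chartIndex, modelFrac]
    rw [h2]
    exact Ideal.unit_mul_mem_iff_mem _ hu
  have hprime : ∀ j : Fin 2, (Ideal.span {(MvPolynomial.X j : MvPolynomial (Fin 2) k)}).IsPrime :=
    fun j => (Ideal.span_singleton_prime (X_ne_zero j)).2 X_prime
  have hnot : ∀ j : Fin 2, (MvPolynomial.X (j + 1) : MvPolynomial (Fin 2) k) ∉
      Ideal.span {(MvPolynomial.X j : MvPolynomial (Fin 2) k)} := by
    intro j hj
    rw [Ideal.mem_span_singleton, X_dvd_X] at hj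
    revert hj; revert j; simp
  -- On the chart `(i, b + 1)` the member is `w 0 * w 1 = 0`. The open sets `D 0` and `D 1` both
  -- meet it, at the generic points of the two axes, but have no common point on it.
  let D : Fin 2 → Set (Spec (modelRing k)) := fun j =>
    {y | (MvPolynomial.X j : MvPolynomial (Fin 2) k) ∉ y.asIdeal}
  have hD : ∀ j, IsOpen (D j) := fun j =>
    (PrimeSpectrum.basicOpen (MvPolynomial.X j : MvPolynomial (Fin 2) k)).2
  obtain ⟨y, hy, hy0, hy1⟩ := hpre (D 0) (D 1) (hD 0) (hD 1)
    ⟨⟨_, hprime 1⟩, (hmem _).2 (Ideal.mul_mem_left _ _ (Ideal.mem_span_singleton_self _)), hnot 1⟩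
    ⟨⟨_, hprime 0⟩, (hmem _).2 (Ideal.mul_mem_right _ _ (Ideal.mem_span_singleton_self _)), hnot 0⟩
  rw [hmem] at hy
  exact (y.2.mem_or_mem hy).elim hy0 hy1

end Irreducible

/-! ### Boundary-preserving morphisms on a chart -/

section Classification

open MvPolynomial

variable {k : Type u} [Field k] {X : Scheme.{u}} {β : X ⟶ PSpace k 2}
  {π : Fin 3 → (X ⟶ PSpace k 1)}

instance : IsDomain (modelRing k) := inferInstanceAs (IsDomain (MvPolynomial (Fin 2) k))

instance : UniqueFactorizationMonoid (modelRing k) :=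
  inferInstanceAs (UniqueFactorizationMonoid (MvPolynomial (Fin 2) k))

lemma hasCoords_blowUpChart_linMap (hβ : IsBlowUp β (threePoints k))
    (hπ : ∀ i, IsPencil β i (π i)) (M : Fin 3 → GL (Fin 2) k) (p : Fin 3) (e : Fin 2)
    (i : Fin 3) : HasCoords (C : k →+* modelRing k) (blowUpChart hβ p e ≫ π i ≫ linMap (M i))
      (fun a => chartEq M p e (i, a)) := by
  rw [← Category.assoc]
  exact (hasCoords_blowUpChart_pencil hβ hπ p e i).linMap (M i)

lemma blowUpChart_toSpec (hβ : IsBlowUp β (threePoints k)) (p : Fin 3) (e : Fin 2) :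
    blowUpChart hβ p e ≫ β ≫ PSpace.toSpec k 2 =
      Spec.map (CommRingCat.ofHom (C : k →+* modelRing k)) := by
  rw [← Category.assoc, blowUpChart_comp, (hasCoords_modelPlane p e).toSpec]

lemma exists_map_of_span_eq {A S : Type*} [CommRing A] [IsDomain A] [Fintype S]
    [DecidableEq S] [Nonempty S] {F f : S → A} (hf : ∀ t, Prime (f t))
    (h : Ideal.span {∏ s, F s} = Ideal.span {∏ s, f s}) :
    ∃ φ : S → S, ∀ s, Associated (F s) (∏ t with φ t = s, f t) :=
  exists_map_of_associated_prod hf Finset.univ (Ideal.span_singleton_eq_span_singleton.1 h)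

/-- On a chart, the coordinates of a morphism to `(ℙ¹)³` that pulls back the boundary to the six
chosen curves are products of the equations of these curves. -/
lemma exists_coords_associated (hβ : IsBlowUp β (threePoints k)) (hπ : ∀ i, IsPencil β i (π i))
    {a : Fin 3 → Fin 2 → closedPoints (PSpace k 1)} {M : Fin 3 → GL (Fin 2) k}
    (hM : ∀ i e, IsEquation ((M i).1 e) (a i e)) (hM0 : ∀ i a b, (M i).1 a b ≠ 0)
    {ψ : X ⟶ Cube k} (hψs : ψ ≫ Cube.toSpec k = β ≫ PSpace.toSpec k 2)
    (hψ : (Cube.boundary k).comap ψ = pairsDivisor π a) (p : Fin 3) (e : Fin 2) :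
    ∃ F : Fin 3 → Fin 2 → MvPolynomial (Fin 2) k,
      (∀ j, HasCoords (C : k →+* modelRing k) ((blowUpChart hβ p e ≫ ψ) ≫ Cube.proj k j) (F j)) ∧
      ∃ φ : Fin 3 × Fin 2 → Fin 3 × Fin 2,
        ∀ s, Associated (F s.1 s.2) (∏ t with φ t = s, chartEq M p e t) := by
  choose F hF using fun j => exists_hasCoords_of_ufd (R := modelRing k)
    (κ := (C : k →+* modelRing k)) (f := (blowUpChart hβ p e ≫ ψ) ≫ Cube.proj k j) (by
      rw [Category.assoc, Category.assoc, Cube.proj_toSpec, hψs, blowUpChart_toSpec])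
  refine ⟨F, hF, ?_⟩
  have h1 : idealAlong (blowUpChart hβ p e) ((Cube.boundary k).comap ψ) =
      Ideal.span {∏ s : Fin 3 × Fin 2, F s.1 s.2} := by
    rw [idealAlong_comap, idealAlong_boundary hF]
  have h2 : idealAlong (blowUpChart hβ p e) (pairsDivisor π a) =
      Ideal.span {∏ t : Fin 3 × Fin 2, chartEq M p e t} :=
    idealAlong_pairsDivisor hM (hasCoords_blowUpChart_pencil hβ hπ p e)
  rw [hψ, h2] at h1
  exact exists_map_of_span_eq (prime_chartEq hM0 p e) h1.symm

/-- Every chosen curve has a point that lies in all charts. -/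
lemma exists_mem_all_charts (hβ : IsBlowUp β (threePoints k)) (hπ : ∀ i, IsPencil β i (π i))
    {M : Fin 3 → GL (Fin 2) k} (hM0 : ∀ i a b, (M i).1 a b ≠ 0) (t : Fin 3 × Fin 2) :
    ∃ x : X, (∀ p e, x ∈ Set.range (blowUpChart hβ p e)) ∧
      (π t.1 ≫ linMap (M t.1)) x ∉ PSpace.std k 1 t.2 := by
  -- The generic point of the curve. No coordinate of a pencil used to define the charts vanishes
  -- there.
  let y : Spec (modelRing k) := ⟨Ideal.span {chartEq M 0 0 t},
    (Ideal.span_singleton_prime (prime_chartEq hM0 0 0 t).ne_zero).2 (prime_chartEq hM0 0 0 t)⟩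
  have hX : ∀ j, (MvPolynomial.X j : MvPolynomial (Fin 2) k) ∉ y.asIdeal :=
    X_notMem_span_chartEq hM0 0 0 t
  refine ⟨blowUpChart hβ 0 0 y, fun p e => ?_, ?_⟩
  · rw [(isOpenImmersion_blowUpChart hβ hπ p e).2, SetLike.mem_coe, mem_chartOpen_iff]
    intro i
    refine ((hasCoords_blowUpChart_pencil hβ hπ 0 0 i).mem_std_iff _ y).2 ?_
    have h1 : (1 : MvPolynomial (Fin 2) k) ∉ y.asIdeal :=
      fun h => y.2.ne_top ((Ideal.eq_top_iff_one _).2 h)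
    have h2 : (MvPolynomial.X 0 * MvPolynomial.X 1 : MvPolynomial (Fin 2) k) ∉ y.asIdeal :=
      fun h => (y.2.mem_or_mem h).elim (hX 0) (hX 1)
    unfold modelCoord modelFrac
    split_ifs
    exacts [h1, h2, hX 0, hX 1]
  · have h := (hasCoords_blowUpChart_linMap hβ hπ M 0 0 t.1).mem_std_iff t.2 y
    refine fun h' => (h.1 h') (Ideal.mem_span_singleton_self _)

/-- The point `x` may lie outside the chart `(0, 0)`. In a chart containing it the coordinate is
divisible by the equation of one of the six curves, and this curve has a point lying in every chart,
which carries the vanishing over to the chart `(0, 0)`. -/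
lemma not_isUnit_of_exists (hβ : IsBlowUp β (threePoints k)) (hπ : ∀ i, IsPencil β i (π i))
    {a : Fin 3 → Fin 2 → closedPoints (PSpace k 1)} {M : Fin 3 → GL (Fin 2) k}
    (hM : ∀ i e, IsEquation ((M i).1 e) (a i e)) (hM0 : ∀ i a b, (M i).1 a b ≠ 0)
    {ψ : X ⟶ Cube k} (hψs : ψ ≫ Cube.toSpec k = β ≫ PSpace.toSpec k 2)
    (hψ : (Cube.boundary k).comap ψ = pairsDivisor π a) {j : Fin 3} {b : Fin 2} {x : X}
    (hx : (ψ ≫ Cube.proj k j) x ∉ PSpace.std k 1 b) {F : Fin 2 → modelRing k}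
    (hF : HasCoords (C : k →+* modelRing k) ((blowUpChart hβ 0 0 ≫ ψ) ≫ Cube.proj k j) F) :
    ¬ IsUnit (F b) := by
  obtain ⟨p, e, hxpe⟩ := exists_mem_chartOpen (isHexagonal_of_isPencil hπ)
    (fun i => (hπ i).over_base) x
  rw [← SetLike.mem_coe, ← (isOpenImmersion_blowUpChart hβ hπ p e).2] at hxpe
  obtain ⟨y, rfl⟩ := hxpe
  obtain ⟨G, hG, φ, hφ⟩ := exists_coords_associated hβ hπ hM hM0 hψs hψ p e
  have hGy : G j b ∈ y.asIdeal := by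
    by_contra hGy
    exact hx (((hG j).mem_std_iff b y).2 hGy)
  have hdvd := (hφ (j, b)).symm.dvd
  have hmem : ∏ t with φ t = (j, b), chartEq M p e t ∈ y.asIdeal :=
    y.asIdeal.mem_of_dvd (hφ (j, b)).dvd hGy
  obtain ⟨t, ht⟩ : (Finset.univ.filter fun t => φ t = (j, b)).Nonempty := by
    rw [Finset.nonempty_iff_ne_empty]
    intro h
    rw [h, Finset.prod_empty] at hmem
    exact y.2.ne_top ((Ideal.eq_top_iff_one _).2 hmem)
  have htG : chartEq M p e t ∣ G j b := (Finset.dvd_prod_of_mem _ ht).trans hdvd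
  obtain ⟨z, hz, hzt⟩ := exists_mem_all_charts hβ hπ hM0 t
  obtain ⟨y', hy'⟩ := hz p e
  obtain ⟨y₀, hy₀⟩ := hz 0 0
  have h1 : chartEq M p e t ∈ y'.asIdeal := by
    by_contra hne
    refine hzt ?_
    rw [← hy']
    exact ((hasCoords_blowUpChart_linMap hβ hπ M p e t.1).mem_std_iff t.2 y').2 hne
  have h2 : (ψ ≫ Cube.proj k j) z ∉ PSpace.std k 1 b := by
    rw [← hy']
    exact fun h => ((hG j).mem_std_iff b y').1 h (y'.asIdeal.mem_of_dvd htG h1)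
  intro hu
  refine h2 ?_
  rw [← hy₀]
  exact (hF.mem_std_iff b y₀).2 fun h => y₀.2.ne_top (Ideal.eq_top_of_isUnit_mem _ h hu)

/-- A non-unit receives at least one prime, so with as many factors as primes each factor receives
exactly one. -/
lemma exists_equiv_of_map {S A : Type*} [CommRing A] [Fintype S] [DecidableEq S] {F f : S → A}
    {φ : S → S} (hφ : ∀ s, Associated (F s) (∏ t with φ t = s, f t))
    (hF : ∀ s, ¬ IsUnit (F s)) : ∃ t : S ≃ S, ∀ s, Associated (F s) (f (t s)) := by
  have hsurj : Function.Surjective φ := by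
    intro s
    by_contra! hne
    refine hF s ?_
    have h := hφ s
    rwa [Finset.filter_eq_empty_iff.2 fun t _ => hne t, Finset.prod_empty,
      associated_one_iff_isUnit] at h
  let E := Equiv.ofBijective φ (Finite.injective_iff_bijective.1
    (Finite.injective_iff_surjective.2 hsurj))
  refine ⟨E.symm, fun s => ?_⟩
  have h := hφ s
  have h1 : (Finset.univ.filter fun t => φ t = s) = {E.symm s} := by
    ext t
    rw [Finset.mem_filter, Finset.mem_singleton, Equiv.eq_symm_apply]
    simp [E]
  rwa [h1, Finset.prod_singleton] at h

lemma exists_perm_of_pairs {t : Fin 3 × Fin 2 ≃ Fin 3 × Fin 2}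
    (h : ∀ j, (t (j, 0)).1 = (t (j, 1)).1) :
    ∃ (τ : Equiv.Perm (Fin 3)) (ε : Fin 3 → Equiv.Perm (Fin 2)),
      ∀ j a, t (j, a) = (τ j, ε j a) := by
  have h' : ∀ j a, (t (j, a)).1 = (t (j, 0)).1 := by
    intro j a
    fin_cases a
    exacts [rfl, (h j).symm]
  have hτ : Function.Bijective fun j => (t (j, 0)).1 := by
    rw [← Finite.injective_iff_bijective, Finite.injective_iff_surjective]
    intro i
    obtain ⟨⟨j, a⟩, hja⟩ := t.surjective (i, 0)
    exact ⟨j, by change (t (j, 0)).1 = i; rw [← h' j a, hja]⟩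
  have hε : ∀ j, Function.Bijective fun a => (t (j, a)).2 := by
    intro j
    rw [← Finite.injective_iff_bijective]
    intro a b hab
    exact congrArg Prod.snd (t.injective (Prod.ext ((h' j a).trans (h' j b).symm) hab))
  exact ⟨Equiv.ofBijective _ hτ, fun j => Equiv.ofBijective _ (hε j),
    fun j a => Prod.ext (h' j a) rfl⟩

end Classification

/-! ### Composition of monomial maps and the toric symmetries -/

section MonomialMaps

variable {k : Type u} [Field k]

lemma monomialMap_one : monomialMap (1 : Fin 2 → kˣ) 1 = 𝟙 _ := by
  refine hom_ext_chartι fun b => ?_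
  have h := hasCoords_chartι (k := k) (n := 1) b
  rw [Category.comp_id]
  refine (h.monomialMap 1 1).ext (h.congr rfl ?_)
  funext a
  simp

/-- The ratio of two monomial maps is again monomial, with scalars `r`. Dividing both homogeneous
coordinates by `r 0` normalizes the first scalar to `1`, as in `ToricSymmetry`. -/
lemma exists_monomialMap_eq_comp (s s' : Fin 2 → kˣ) (ε ε' : Equiv.Perm (Fin 2)) :
    ∃ (t : kˣ) (δ : Equiv.Perm (Fin 2)),
      monomialMap s ε = monomialMap s' ε' ≫ monomialMap ![1, t] δ := by
  let δ : Equiv.Perm (Fin 2) := ε.trans ε'.symm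
  let r : Fin 2 → kˣ := fun a => s a * (s' (δ a))⁻¹
  refine ⟨r 1 * (r 0)⁻¹, δ, hom_ext_chartι fun b => ?_⟩
  have h := hasCoords_chartι (k := k) (n := 1) b
  have h1 := (h.monomialMap s' ε').monomialMap ![1, r 1 * (r 0)⁻¹] δ
  have h2 := h1.smul (c := chartScalar b (r 0 : k)) ((r 0).isUnit.map (chartScalar b))
  rw [Category.assoc] at h2
  refine (h.monomialMap s ε).ext (h2.congr rfl ?_)
  have hδ : ∀ a, ε' (δ a) = ε a := fun a => by simp [δ]
  have key : ∀ a, (r 0 : k) * ((![1, r 1 * (r 0)⁻¹] a : kˣ) * s' (δ a)) = s a := by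
    intro a
    rw [← Units.val_mul, ← Units.val_mul]
    congr 1
    fin_cases a <;> simp [r, mul_comm, mul_left_comm, mul_assoc]
  funext a
  rw [hδ, ← key a, map_mul, map_mul]
  ring

lemma ToricSymmetry.toHom_proj (g : ToricSymmetry k) (i : Fin 3) :
    g.toHom ≫ Cube.proj k i = Cube.proj k (g.axes i) ≫ monomialMap ![1, g.torus i] (g.flip i) :=
  Cube.lift_proj _ i

lemma ToricSymmetry.exists_comp_eq_id (g : ToricSymmetry k) : ∃ h, g.toHom ≫ h = 𝟙 (Cube k) := by
  choose t δ hδ using fun i => exists_monomialMap_eq_comp 1 ![1, g.torus i] 1 (g.flip i)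
  refine ⟨Cube.lift (Cube.toSpec k) (fun i => Cube.proj k (g.axes.symm i) ≫
    monomialMap ![1, t (g.axes.symm i)] (δ (g.axes.symm i)))
    (fun i => by rw [Category.assoc, monomialMap_toSpec, Cube.proj_toSpec]), ?_⟩
  refine Cube.hom_ext fun i => ?_
  rw [Category.assoc, Cube.lift_proj, ← Category.assoc, toHom_proj, Category.assoc, ← hδ,
    monomialMap_one, Category.comp_id, Equiv.apply_symm_apply, Category.id_comp]

/-- From `ψ = ψ' ≫ g` one inclusion is formal. The other is the same argument for `ψ' = ψ ≫ h`,
pulled back along `g`. -/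
lemma comap_ker_eq_of_comp {X Y : Scheme.{u}} {ψ ψ' : X ⟶ Y} {g h : Y ⟶ Y}
    (hgh : g ≫ h = 𝟙 Y) (hψ : ψ = ψ' ≫ g) : ψ.ker.comap g = ψ'.ker := by
  apply le_antisymm
  · rw [← Scheme.IdealSheafData.le_map_iff_comap_le, Scheme.IdealSheafData.map_ker, hψ]
  · have h1 : ψ'.ker.comap h ≤ ψ.ker := by
      rw [← Scheme.IdealSheafData.le_map_iff_comap_le, Scheme.IdealSheafData.map_ker, hψ,
        Category.assoc, hgh, Category.comp_id]
    have h2 : (ψ'.ker.comap h).comap g ≤ ψ.ker.comap g := Scheme.IdealSheafData.comap_mono g h1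
    rwa [← Scheme.IdealSheafData.comap_comp, hgh, Scheme.IdealSheafData.comap_id] at h2

end MonomialMaps

/-! ### Uniqueness up to toric symmetry -/

section Uniqueness

open MvPolynomial

variable {k : Type u} [Field k] {X : Scheme.{u}} {β : X ⟶ PSpace k 2}
  {π : Fin 3 → (X ⟶ PSpace k 1)}

/-- The chart `(0, 0)` meets every other chart in a nonempty, hence dense, open subset of an
integral affine plane, and the target is separated. -/
lemma hom_ext_blowUpChart (hβ : IsBlowUp β (threePoints k)) (hπ : ∀ i, IsPencil β i (π i))
    {M : Fin 3 → GL (Fin 2) k} (hM0 : ∀ i a b, (M i).1 a b ≠ 0) {Z : Scheme.{u}} [Z.IsSeparated]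
    {q q' : X ⟶ Z} (h : blowUpChart hβ 0 0 ≫ q = blowUpChart hβ 0 0 ≫ q') : q = q' := by
  refine hom_ext_of_openImmersion fun x => ?_
  obtain ⟨p, e, hx⟩ := exists_mem_chartOpen (isHexagonal_of_isPencil hπ)
    (fun i => (hπ i).over_base) x
  have h0 := (isOpenImmersion_blowUpChart hβ hπ 0 0).1
  have h1 := (isOpenImmersion_blowUpChart hβ hπ p e).1
  rw [← SetLike.mem_coe, ← (isOpenImmersion_blowUpChart hβ hπ p e).2] at hx
  refine ⟨_, blowUpChart hβ p e, h1, hx, ?_⟩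
  let V : (Spec (modelRing k)).Opens := blowUpChart hβ p e ⁻¹ᵁ (blowUpChart hβ 0 0).opensRange
  have hV : IsDominant V.ι := by
    refine ⟨?_⟩
    rw [DenseRange, Scheme.Opens.range_ι]
    obtain ⟨z, hz, -⟩ := exists_mem_all_charts hβ hπ hM0 (0, 0)
    obtain ⟨y, hy⟩ := hz p e
    exact V.2.dense ⟨y, by
      change blowUpChart hβ p e y ∈ Set.range (blowUpChart hβ 0 0)
      rw [hy]
      exact hz 0 0⟩
  refine ext_of_isDominant V.ι ?_
  have hrange : Set.range (V.ι ≫ blowUpChart hβ p e) ⊆ Set.range (blowUpChart hβ 0 0) := by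
    rintro _ ⟨y, rfl⟩
    exact y.2
  rw [← Category.assoc, ← Category.assoc, ← IsOpenImmersion.lift_fac _ _ hrange, Category.assoc,
    Category.assoc, h]

/-- A morphism to `(ℙ¹)³` that pulls back the boundary to the six chosen curves is given by the
pencils, up to a monomial automorphism. -/
theorem exists_eq_monomialMap (hβ : IsBlowUp β (threePoints k)) (hπ : ∀ i, IsPencil β i (π i))
    {a : Fin 3 → Fin 2 → closedPoints (PSpace k 1)} {M : Fin 3 → GL (Fin 2) k}
    (hM : ∀ i e, IsEquation ((M i).1 e) (a i e)) (hM0 : ∀ i a b, (M i).1 a b ≠ 0)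
    {ψ : X ⟶ Cube k} (hψs : ψ ≫ Cube.toSpec k = β ≫ PSpace.toSpec k 2)
    (hψ : (Cube.boundary k).comap ψ = pairsDivisor π a)
    (hne : ∀ (j : Fin 3) (b : Fin 2), ∃ x, (ψ ≫ Cube.proj k j) x ∉ PSpace.std k 1 b) :
    ∃ (τ : Equiv.Perm (Fin 3)) (s : Fin 3 → Fin 2 → kˣ) (ε : Fin 3 → Equiv.Perm (Fin 2)),
      ∀ j, ψ ≫ Cube.proj k j = π (τ j) ≫ linMap (M (τ j)) ≫ monomialMap (s j) (ε j) := by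
  obtain ⟨F, hF, φ, hφ⟩ := exists_coords_associated hβ hπ hM hM0 hψs hψ 0 0
  obtain ⟨t, ht⟩ := exists_equiv_of_map (F := fun s : Fin 3 × Fin 2 => F s.1 s.2) hφ fun s =>
    (hne s.1 s.2).elim fun x hx => not_isUnit_of_exists hβ hπ hM hM0 hψs hψ hx (hF s.1)
  -- The two coordinates of a morphism to `ℙ¹` generate the unit ideal, whereas equations from
  -- different pencils have a common zero `w`.
  have hpair : ∀ j, (t (j, 0)).1 = (t (j, 1)).1 := by
    intro j
    by_contra hj
    obtain ⟨w, hw0, hw1⟩ := exists_eval_chartEq_eq_zero hM0 hj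
    have h0 : ∀ b, F j b ∈ RingHom.ker (eval w) := by
      intro b
      refine (RingHom.ker (eval w)).mem_of_dvd (ht (j, b)).symm.dvd ?_
      fin_cases b
      exacts [hw0, hw1]
    have h1 : Ideal.span (Set.range (F j)) ≤ RingHom.ker (eval w) := by
      rw [Ideal.span_le]
      rintro _ ⟨b, rfl⟩
      exact h0 b
    exact RingHom.ker_ne_top (eval w) (top_le_iff.1 ((hF j).span_eq_top.symm.le.trans h1))
  obtain ⟨τ, ε, hτε⟩ := exists_perm_of_pairs hpair
  have hs : ∀ j b, ∃ s : kˣ, F j b = C (s : k) * chartEq M 0 0 (τ j, ε j b) := by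
    intro j b
    obtain ⟨u, hu⟩ := (ht (j, b)).symm
    obtain ⟨r, hr, hru⟩ := MvPolynomial.isUnit_iff_eq_C_of_isReduced.1 u.isUnit
    refine ⟨hr.unit, ?_⟩
    rw [← hτε, IsUnit.unit_spec, ← hru, mul_comm]
    exact hu.symm
  choose s hs using hs
  refine ⟨τ, s, ε, fun j => hom_ext_blowUpChart hβ hπ hM0 ?_⟩
  have h1 := (hasCoords_blowUpChart_linMap hβ hπ M 0 0 (τ j)).monomialMap (s j) (ε j)
  rw [Category.assoc, Category.assoc] at h1
  have h2 := hF j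
  rw [Category.assoc] at h2
  exact h2.ext (h1.congr rfl (funext fun b => (hs j b).symm))

lemma exists_notMem_std {c : (Fin 3 → Fin 2) → k} (hc : ∀ v, c v ≠ 0)
    (e : X ≅ (triDivisor c).subscheme) (j : Fin 3) (b : Fin 2) :
    ∃ x, ((e.hom ≫ (triDivisor c).subschemeι) ≫ Cube.proj k j) x ∉ PSpace.std k 1 b := by
  -- On the edge of the cube where the `j`-th coordinate of index `b` is zero and the next factor is
  -- at `[1 : 0]`, the form reduces to `c (v 0) Z₀ + c (v 1) Z₁`. Its zero `[c (v 1) : -c (v 0)]`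
  -- gives the point wanted.
  let v : Fin 2 → Fin 3 → Fin 2 := fun d i => if i = j then b + 1 else if i = j + 1 then 0 else d
  let ξ : Fin 3 → Fin 2 → k := fun i d =>
    if i = j then (if d = b + 1 then 1 else 0) else
      if i = j + 1 then (if d = 0 then 1 else 0) else if d = 0 then c (v 1) else -c (v 0)
  have hv : ∀ i, ξ i (v 0 i) ≠ 0 := by
    intro i
    by_cases h1 : i = j
    · simp [ξ, v, h1]
    · by_cases h2 : i = j + 1
      · simp [ξ, v, h2]
      · simp [ξ, v, h1, h2, hc]
  have hprod : ∀ d, ∏ i, ξ i (v d i) = if d = 0 then c (v 1) else -c (v 0) := by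
    intro d
    rw [Fin.prod_univ_three]
    simp only [ξ, v]
    fin_cases j <;> simp
  have hne : v 0 ≠ v 1 := by
    intro h
    have := congrFun h (j + 2)
    revert this
    simp only [v]
    fin_cases j <;> simp
  have hsum : ∑ w, c w * ∏ i, ξ i (w i) = 0 := by
    rw [Fintype.sum_eq_add (v 0) (v 1) hne, hprod, hprod]
    · simp; ring
    · rintro w ⟨hw0, hw1⟩
      refine mul_eq_zero_of_right _ ?_
      by_cases h0 : w j = b + 1
      · by_cases h1 : w (j + 1) = 0
        · have hw : w = v (w (j + 2)) := by
            funext i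
            obtain rfl | rfl | rfl : i = j ∨ i = j + 1 ∨ i = j + 2 := by
              clear * -; revert i j; decide
            · simp [v, h0]
            · simp [v, h1]
            · simp [v]
          have hwv : ∀ d : Fin 2, w ≠ v d := Fin.forall_fin_two.2 ⟨hw0, hw1⟩
          exact absurd hw (hwv _)
        · refine Finset.prod_eq_zero (Finset.mem_univ (j + 1)) ?_
          simp [ξ, h1]
      · refine Finset.prod_eq_zero (Finset.mem_univ j) ?_
        simp [ξ, h0]
  obtain ⟨y, hy⟩ := exists_point_of_sum_eq_zero e hv hsum
  let z : Spec (.of k) := (⊥ : PrimeSpectrum k)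
  refine ⟨y z, fun hmem => ((hy j).mem_std_iff b z).1 ?_ ?_⟩
  · rw [Category.assoc]
    exact hmem
  · have : ξ j b = 0 := by
      simp only [ξ, if_true]
      exact if_neg ((by decide : ∀ b : Fin 2, b ≠ b + 1) b)
    rw [this]
    exact zero_mem _

theorem exists_toricSymmetry [IsAlgClosed k] (hβ : IsBlowUp β (threePoints k))
    (hπ : ∀ i, IsPencil β i (π i)) {a : Fin 3 → Fin 2 → closedPoints (PSpace k 1)}
    (ha : ∀ i, a i 0 ≠ a i 1) (hirr : ∀ i e, IsIrreducible (fibreSet (π i) (a i e)))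
    {c c' : (Fin 3 → Fin 2) → k} (hc : ∀ v, c v ≠ 0) (hc' : ∀ v, c' v ≠ 0)
    (h : IsoToBoundaryPair (β ≫ PSpace.toSpec k 2) (pairsDivisor π a) (triDivisor c))
    (h' : IsoToBoundaryPair (β ≫ PSpace.toSpec k 2) (pairsDivisor π a) (triDivisor c')) :
    ∃ g : ToricSymmetry k, (triDivisor c).comap g.toHom = triDivisor c' := by
  choose M hM using fun i => exists_isEquation (ha i)
  have hM0 : ∀ i a b, (M i).1 a b ≠ 0 := by
    intro i e b
    refine IsEquation.apply_ne_zero hβ hπ (hM i e) (hirr i e) (fun h0 => ?_) b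
    have h1 := congrFun (congrFun (Units.mul_inv (M i)) e) e
    rw [Matrix.mul_apply, Finset.sum_eq_zero (fun x _ => by rw [h0, Pi.zero_apply, zero_mul]),
      Matrix.one_apply_eq] at h1
    exact zero_ne_one h1
  obtain ⟨e, he, hD⟩ := h
  obtain ⟨e', he', hD'⟩ := h'
  obtain ⟨τ, s, ε, hτ⟩ := exists_eq_monomialMap hβ hπ hM hM0
    (ψ := e.hom ≫ (triDivisor c).subschemeι) (by rw [Category.assoc, he])
    (by rw [Scheme.IdealSheafData.comap_comp, hD]) (exists_notMem_std hc e)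
  obtain ⟨τ', s', ε', hτ'⟩ := exists_eq_monomialMap hβ hπ hM hM0
    (ψ := e'.hom ≫ (triDivisor c').subschemeι) (by rw [Category.assoc, he'])
    (by rw [Scheme.IdealSheafData.comap_comp, hD']) (exists_notMem_std hc' e')
  -- The component `i` of the first embedding and the component `τ'.symm (τ i)` of the second come
  -- from the same pencil, so they differ by a monomial map of `ℙ¹`.
  choose t δ hδ using fun i => exists_monomialMap_eq_comp (s i) (s' (τ'.symm (τ i))) (ε i)
    (ε' (τ'.symm (τ i)))
  let g : ToricSymmetry k := ⟨t, δ, τ.trans τ'.symm⟩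
  have hg : e.hom ≫ (triDivisor c).subschemeι =
      (e'.hom ≫ (triDivisor c').subschemeι) ≫ g.toHom := by
    refine Cube.hom_ext fun i => ?_
    have h1 := hτ' (g.axes i)
    have h2 : τ' (g.axes i) = τ i := by simp [g]
    rw [h2] at h1
    rw [hτ, hδ, Category.assoc _ g.toHom, g.toHom_proj, ← Category.assoc _ (Cube.proj k _), h1]
    simp only [Category.assoc]
    rfl
  obtain ⟨h, hh⟩ := g.exists_comp_eq_id
  refine ⟨g, ?_⟩
  have key := comap_ker_eq_of_comp hh hg
  rwa [Scheme.Hom.ker_comp_of_isIso, Scheme.Hom.ker_comp_of_isIso,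
    Scheme.IdealSheafData.ker_subschemeι, Scheme.IdealSheafData.ker_subschemeι] at key

end Uniqueness

end ThreePairs

end

theorem mainTheorem11 {k : Type u} [Field k] [IsAlgClosed k] [CharZero k]
    -- the blow-up of the plane at the three coordinate points, with its three pencils
    {X : Scheme.{u}} (β : X ⟶ ThreePairs.PSpace k 2)
    (hβ : ThreePairs.IsBlowUp β (ThreePairs.threePoints k))
    (π : Fin 3 → (X ⟶ ThreePairs.PSpace k 1)) (hπ : ∀ i, ThreePairs.IsPencil β i (π i))
    -- two distinct irreducible elements of each pencil, without triple points
    (a : Fin 3 → Fin 2 → closedPoints (ThreePairs.PSpace k 1))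
    (ha : ∀ i, a i 0 ≠ a i 1)
    (hirr : ∀ i e, IsIrreducible (ThreePairs.fibreSet (π i) (a i e)))
    (htriple : ∀ x : X,
      {p : Fin 3 × Fin 2 | x ∈ ThreePairs.fibreSet (π p.1) (a p.1 p.2)}.ncard ≤ 2) :
    (∃ c : (Fin 3 → Fin 2) → k, (∀ v, c v ≠ 0) ∧
      ThreePairs.IsoToBoundaryPair (β ≫ ThreePairs.PSpace.toSpec k 2)
        (ThreePairs.pairsDivisor π a) (ThreePairs.triDivisor c)) ∧
    (∀ c c' : (Fin 3 → Fin 2) → k, (∀ v, c v ≠ 0) → (∀ v, c' v ≠ 0) →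
      ThreePairs.IsoToBoundaryPair (β ≫ ThreePairs.PSpace.toSpec k 2)
        (ThreePairs.pairsDivisor π a) (ThreePairs.triDivisor c) →
      ThreePairs.IsoToBoundaryPair (β ≫ ThreePairs.PSpace.toSpec k 2)
        (ThreePairs.pairsDivisor π a) (ThreePairs.triDivisor c') →
      ∃ g : ThreePairs.ToricSymmetry k,
        (ThreePairs.triDivisor c).comap g.toHom = ThreePairs.triDivisor c') := by
  exact ⟨ThreePairs.exists_isoToBoundaryPair hβ hπ ha htriple, fun _ _ hc hc' h h' =>
    ThreePairs.exists_toricSymmetry hβ hπ ha hirr hc hc' h h'⟩
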